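/- **Conventions.** $S^1$ is the unit circle with its counter-clockwise circular order. For distinct $u,v\in S^1$ let $(u,v)$ be the open arc from $u$ counter-clockwise to $v$ (a *good interval*), and $(u,v)^*=(v,u)$. Write $\ell(I)=\{I,I^*\}$, and say that $\ell(I)$ *lies on* $J$ if $I\subseteq J$ or $I^*\subseteq J$. A *lamination system* is a nonempty set $\mathscr L$ of good intervals such that (i) $I\in\mathscr L$ implies $I^*\in\mathscr L$; (ii) for $I,J\in\mathscr L$, $\ell(I)$ lies on $J$ or on $J^*$; (iii) the union of an ascending sequence of elements of $\mathscr L$ belongs to $\mathscr L$ if it is a good interval. Its *leaves* are the sets $\ell(I)$, $I\in\mathscr L$. A *gap* of $\mathscr L$ is a set $\mathscr G\subseteq\mathscr L$ of pairwise disjoint intervals such that every leaf of $\mathscr L$ lies on some element of $\mathscr G$ (so each leaf is a gap); its *vertex set* is $v(\mathscr G)=S^1\setminus\bigcup\mathscr G$. An *ideal polygon* is a gap with finitely many vertices. A *crown* is a gap of the form $\{(t_k,t_{k+1}):k\in\mathbb Z\}$ with vertex set $\{t_k:k\in\mathbb Z\}\cup\{p\}$ for some $p\in S^1$ with $p\neq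 t_k$ for all $k$. The *endpoint set* of $\mathscr L$ is $E(\mathscr L)=\bigcup_{I\in\mathscr L}v(\ell(I))$. $\mathscr L$ is *quite full* if every gap is an ideal polygon or a crown, and *loose* if any two distinct gaps that are not leaves have disjoint vertex sets. A *pseudo-fibered pair* $\mathscr C=\{\mathscr L_1,\mathscr L_2\}$ consists of two quite full, loose lamination systems with $E(\mathscr L_1)\cap E(\mathscr L_2)=\emptyset$. An *interleaving pair* of $\mathscr C$ is a pair $(\mathscr G_1,\mathscr G_2)$ of gaps, $\mathscr G_i$ of $\mathscr L_i$, such that every $I\in\mathscr G_1$ contains exactly one point of $v(\mathscr G_2)$ and every $I\in\mathscr G_2$ contains exactly one point of $v(\mathscr G_1)$; it is an *asterisk* unless both gaps are leaves. $\operatorname{Aut}(\mathscr C)$ is the group of orientation preserving homeomorphisms $g$ of $S^1$ with $g(\mathscr L_1)=\mathscr L_1$ and $g(\mathscr L_2)=\mathscr L_2$; $g$ preserves $(\mathscr G_1,\mathscr G_2)$ if $g(\mathscr G_i)=\mathscr G_i$ for $i=1,2$. A non-trivial $g\in\operatorname{Aut}(\mathscr C)$ is *elliptic* if it has finite order; *parabolic*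 if it has exactly one fixed point; *hyperbolic* if it has exactly two fixed points, one attracting and one repelling (a fixed point $p$ is *attracting* if some good interval $I$ whose only fixed point is $p$ satisfies $g(\overline I)\subset I$, and *repelling* if some such $I$ satisfies $\overline I\subset g(I)$); *pA-like* if it is neither elliptic nor parabolic and preserves an interleaving pair of $\mathscr C$; *properly pseudo-Anosov* if it is pA-like and has a fixed point. **Theorem.** Let $\mathscr C=\{\mathscr L_1,\mathscr L_2\}$ be a pseudo-fibered pair and $G$ a subgroup of $\operatorname{Aut}(\mathscr C)$. If $G$ has an infinite cyclic normal subgroup, then $G$ is isomorphic to $\mathbb Z$, the infinite dihedral group, $\mathbb Z\times\mathbb Z_n$ for some $n\in\mathbb N$ with $n>1$, or $\mathbb Z\times\mathbb Z$. Furthermore: 1. When $G\cong\mathbb Z$, $G$ is generated by a parabolic, a hyperbolic, or a pA-like automorphism. 2. When $G$ is isomorphic to the infinite dihedral group, $G$ is generated by a hyperbolic automorphism $g$ and an elliptic automorphism $e$ of order two, and $G=\langle g,e\mid e^2=1,\ ege=g^{-1}\rangle$. 3. When $G\cong\mathbb Z\times\mathbb Z_n$ with $n>1$, $G$ preserves a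 unique interleaving pair of ideal polygons of $\mathscr C$, and there are a pA-like automorphism $g$ and an elliptic automorphism $e$ of order $n$ such that $G=\langle g\rangle\times\langle e\rangle$. 4. When $G\cong\mathbb Z\times\mathbb Z$, $G$ preserves a unique asterisk of crowns of $\mathscr C$, and there are a properly pseudo-Anosov $g$ and a parabolic automorphism $h$ such that $G=\langle g\rangle\times\langle h\rangle$. -/

import Mathlib

open Set

namespace Laminar

/-! ### The circular order of the unit circle and orientation preserving homeomorphisms -/

/-- The triple `(x, y, z)` of points of the unit circle is counter-clockwise: the three points are
distinct and are met in this order when the circle is traversed with increasing argument. This is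
the circular order of Mathlib on angles, read on the circle. -/
def CCW (x y z : Circle) : Prop :=
  sbtw ((Complex.arg (x : ℂ) : ℝ) : Real.Angle) ((Complex.arg (y : ℂ) : ℝ) : Real.Angle)
    ((Complex.arg (z : ℂ) : ℝ) : Real.Angle)

theorem arg_angle_injective :
    Function.Injective fun z : Circle => ((Complex.arg (z : ℂ) : ℝ) : Real.Angle) := by
  intro z w h
  have h' : (Complex.arg (z : ℂ) : Real.Angle).toReal = (Complex.arg (w : ℂ) : Real.Angle).toReal :=
    congrArg Real.Angle.toReal h
  rw [Complex.arg_coe_angle_toReal_eq_arg, Complex.arg_coe_angle_toReal_eq_arg] at h'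
  exact Circle.injective_arg h'

theorem CCW.rotate {x y z : Circle} (h : CCW x y z) : CCW y z x :=
  SBtw.sbtw.cyclic_left h

theorem CCW.asymm {x y z : Circle} (h : CCW x y z) : ¬ CCW z y x :=
  SBtw.sbtw.not_sbtw h

theorem CCW.ne {x y z : Circle} (h : CCW x y z) : x ≠ y ∧ y ≠ z ∧ z ≠ x := by
  refine ⟨?_, ?_, ?_⟩
  · rintro rfl; exact sbtw_irrefl_left h
  · rintro rfl; exact sbtw_irrefl_right h
  · rintro rfl; exact sbtw_irrefl_left_right h

theorem CCW.of_ne {x y z : Circle} (hxy : x ≠ y) (hyz : y ≠ z) (hzx : z ≠ x) :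
    CCW x y z ∨ CCW z y x := by
  by_contra hcon
  rw [not_or] at hcon
  have h1 := btw_iff_not_sbtw.2 hcon.1
  have h2 := btw_iff_not_sbtw.2 hcon.2
  rcases Btw.btw.antisymm h2 h1 with h | h | h
  · exact hxy (arg_angle_injective h)
  · exact hyz (arg_angle_injective h)
  · exact hzx (arg_angle_injective h)

/-- A homeomorphism of the circle is orientation preserving if it preserves the circular order. -/
def OrientationPreserving (g : Circle ≃ₜ Circle) : Prop :=
  ∀ x y z : Circle, CCW x y z → CCW (g x) (g y) (g z)

theorem OrientationPreserving.ccw_iff {g : Circle ≃ₜ Circle} (hg : OrientationPreserving g)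
    {x y z : Circle} : CCW (g x) (g y) (g z) ↔ CCW x y z := by
  refine ⟨fun h => ?_, hg x y z⟩
  obtain ⟨h1, h2, h3⟩ := h.ne
  rcases CCW.of_ne (fun e => h1 (congrArg g e)) (fun e => h2 (congrArg g e))
    (fun e => h3 (congrArg g e)) with h' | h'
  · exact h'
  · exact absurd (hg _ _ _ h') h.asymm

/-- The group of orientation preserving homeomorphisms of the circle. -/
noncomputable def homeoPlus : Subgroup (Circle ≃ₜ Circle) where
  carrier := {g | OrientationPreserving g}
  mul_mem' := fun {a b} ha hb x y z h => ha _ _ _ (hb x y z h)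
  one_mem' := fun _ _ _ h => h
  inv_mem' := fun {a} ha x y z h => by
    have ha' : OrientationPreserving a := ha
    rw [← ha'.ccw_iff]
    simpa using h

/-! ### Good intervals -/

/-- A good open interval `(left, right)` of the circle, given by its two distinct endpoints. -/
@[ext]
structure GoodInterval where
  left : Circle
  right : Circle
  ne : left ≠ right

namespace GoodInterval

/-- The underlying open arc, running counter-clockwise from `left` to `right`. -/
def arc (I : GoodInterval) : Set Circle := {z | CCW I.left z I.right}

/-- The complementary good interval `I*`: `(u, v)* = (v, u)`. -/
def opp (I : GoodInterval) : GoodInterval := ⟨I.right, I.left, I.ne.symm⟩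

/-- The image of a good interval `(u, v)`, that is `(g u, g v)`; for orientation preserving `g` its
arc is the image of the arc, see `arc_map`. -/
noncomputable def map (g : Circle ≃ₜ Circle) (I : GoodInterval) : GoodInterval :=
  ⟨g I.left, g I.right, fun h => I.ne (g.injective h)⟩

theorem arc_map {g : Circle ≃ₜ Circle} (hg : OrientationPreserving g) (I : GoodInterval) :
    (I.map g).arc = g '' I.arc := by
  ext z
  obtain ⟨w, rfl⟩ := g.surjective z
  simp [arc, map, hg.ccw_iff]

theorem map_one (I : GoodInterval) : I.map 1 = I := rfl

theorem map_mul (g h : Circle ≃ₜ Circle) (I : GoodInterval) :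
    I.map (g * h) = (I.map h).map g := rfl

end GoodInterval

/-- The leaf `ℓ(I) = {I, I*}`. -/
def leaf (I : GoodInterval) : Set GoodInterval := {I, I.opp}

/-- The leaf `ℓ(I)` lies on the interval `J`. -/
def LiesOn (I J : GoodInterval) : Prop := I.arc ⊆ J.arc ∨ I.opp.arc ⊆ J.arc

/-! ### Lamination systems and gaps -/

/-- Lamination systems: nonempty families of good intervals that are closed under `I ↦ I*`,
unlinked, and closed under ascending unions that are good intervals. -/
structure IsLaminationSystem (L : Set GoodInterval) : Prop where
  nonempty : L.Nonempty
  opp_mem : ∀ I ∈ L, I.opp ∈ L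
  unlinked : ∀ I ∈ L, ∀ J ∈ L, LiesOn I J ∨ LiesOn I J.opp
  closed : ∀ (I : ℕ → GoodInterval) (J : GoodInterval), (∀ k, I k ∈ L) →
    Monotone (fun k => (I k).arc) → J.arc = ⋃ k, (I k).arc → J ∈ L

/-- A gap of `L`: a subset of `L` of pairwise disjoint intervals such that each leaf of `L` lies on
some interval of the subset. A leaf is a gap. -/
structure IsGap (L G : Set GoodInterval) : Prop where
  subset : G ⊆ L
  disjoint : ∀ I ∈ G, ∀ J ∈ G, I ≠ J → Disjoint I.arc J.arc
  lies : ∀ I ∈ L, ∃ J ∈ G, LiesOn I J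

/-- The vertex set `v(G)`: the complement of the union of the intervals of `G`. -/
def vertexSet (G : Set GoodInterval) : Set Circle := (⋃ I ∈ G, I.arc)ᶜ

/-- The set of endpoints of `L`: all vertices of leaves of `L`. -/
def endpointSet (L : Set GoodInterval) : Set Circle := ⋃ I ∈ L, vertexSet (leaf I)

/-- A gap of `L` that is not a leaf of `L`. -/
def IsNonLeafGap (L G : Set GoodInterval) : Prop := IsGap L G ∧ ¬ ∃ I ∈ L, G = leaf I

/-- An ideal polygon of `L`: a gap with finitely many vertices. -/
def IsIdealPolygon (L G : Set GoodInterval) : Prop := IsGap L G ∧ (vertexSet G).Finite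

/-- A crown of `L`: a gap `{(t_k, t_{k+1}) : k ∈ ℤ}` with vertex set `{t_k : k ∈ ℤ} ∪ {p}`, where
`p`, the pivot, is none of the `t_k`. -/
def IsCrown (L G : Set GoodInterval) : Prop :=
  IsGap L G ∧ ∃ (t : ℤ → Circle) (p : Circle) (ht : ∀ k, t k ≠ t (k + 1)),
    (∀ k, p ≠ t k) ∧
    G = range (fun k : ℤ => (⟨t k, t (k + 1), ht k⟩ : GoodInterval)) ∧
    vertexSet G = range t ∪ {p}

/-- `L` is quite full: each gap is an ideal polygon or a crown. -/
def QuiteFull (L : Set GoodInterval) : Prop :=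
  ∀ G, IsGap L G → IsIdealPolygon L G ∨ IsCrown L G

/-- `L` is loose: distinct non-leaf gaps share no vertex. -/
def Loose (L : Set GoodInterval) : Prop :=
  ∀ G H, IsNonLeafGap L G → IsNonLeafGap L H → G ≠ H → Disjoint (vertexSet G) (vertexSet H)

/-- The pair `{L₁, L₂}` is pseudo-fibered: two quite full and loose lamination systems that are
strongly transverse, i.e. have no common endpoint. -/
structure IsPseudoFibered (L₁ L₂ : Set GoodInterval) : Prop where
  lamination_left : IsLaminationSystem L₁
  lamination_right : IsLaminationSystem L₂
  quiteFull_left : QuiteFull L₁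
  quiteFull_right : QuiteFull L₂
  loose_left : Loose L₁
  loose_right : Loose L₂
  stronglyTransverse : endpointSet L₁ ∩ endpointSet L₂ = ∅

/-- `G₁` and `G₂` interleave: each interval of one contains exactly one vertex of the other. -/
def Interleave (G₁ G₂ : Set GoodInterval) : Prop :=
  (∀ I ∈ G₁, ∃ x, I.arc ∩ vertexSet G₂ = {x}) ∧ (∀ I ∈ G₂, ∃ x, I.arc ∩ vertexSet G₁ = {x})

/-- `(G₁, G₂)` is an interleaving pair of `(L₁, L₂)`. -/
def IsInterleavingPair (L₁ L₂ G₁ G₂ : Set GoodInterval) : Prop :=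
  IsGap L₁ G₁ ∧ IsGap L₂ G₂ ∧ Interleave G₁ G₂

/-- An asterisk: an interleaving pair that is not a stitch, i.e. not a pair of leaves. -/
def IsAsterisk (L₁ L₂ G₁ G₂ : Set GoodInterval) : Prop :=
  IsInterleavingPair L₁ L₂ G₁ G₂ ∧ ¬ ((∃ I ∈ L₁, G₁ = leaf I) ∧ (∃ J ∈ L₂, G₂ = leaf J))

/-! ### Laminar automorphisms -/

/-- `g` preserves the family `F` of good intervals: `g(F) = F`. -/
def Preserves (g : Circle ≃ₜ Circle) (F : Set GoodInterval) : Prop :=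
  GoodInterval.map g '' F = F

/-- The laminar automorphism group of `L`: all orientation preserving homeomorphisms of the circle
that preserve `L`. -/
noncomputable def aut (L : Set GoodInterval) : Subgroup (Circle ≃ₜ Circle) where
  carrier := {g | g ∈ homeoPlus ∧ Preserves g L}
  mul_mem' := by
    rintro a b ⟨ha, ha'⟩ ⟨hb, hb'⟩
    refine ⟨mul_mem ha hb, ?_⟩
    have : GoodInterval.map (a * b) = GoodInterval.map a ∘ GoodInterval.map b := rfl
    unfold Preserves at *
    rw [this, image_comp, hb', ha']
  one_mem' := ⟨one_mem _, image_id L⟩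
  inv_mem' := by
    rintro a ⟨ha, ha'⟩
    refine ⟨inv_mem ha, ?_⟩
    unfold Preserves at *
    conv_lhs => rw [← ha']
    rw [← image_comp]
    have : GoodInterval.map a⁻¹ ∘ GoodInterval.map a = id := by
      funext I
      change I.map (a⁻¹ * a) = I
      rw [inv_mul_cancel, GoodInterval.map_one]
    rw [this, image_id]

/-- The laminar automorphism group of the pair `{L₁, L₂}`. -/
noncomputable def autPair (L₁ L₂ : Set GoodInterval) : Subgroup (Circle ≃ₜ Circle) := aut L₁ ⊓ aut L₂

/-- The set of fixed points of `g`. -/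
def Fix (g : Circle ≃ₜ Circle) : Set Circle := Function.fixedPoints g

/-- `p` is an attracting fixed point of `g`. -/
def IsAttracting (g : Circle ≃ₜ Circle) (p : Circle) : Prop :=
  ∃ I : GoodInterval, I.arc ∩ Fix g = {p} ∧ g '' closure I.arc ⊆ I.arc

/-- `p` is a repelling fixed point of `g`. -/
def IsRepelling (g : Circle ≃ₜ Circle) (p : Circle) : Prop :=
  ∃ I : GoodInterval, I.arc ∩ Fix g = {p} ∧ closure I.arc ⊆ g '' I.arc

/-- Elliptic: non-trivial of finite order. -/
def IsElliptic (g : Circle ≃ₜ Circle) : Prop := g ≠ 1 ∧ IsOfFinOrder g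

/-- Parabolic: exactly one fixed point. -/
def IsParabolic (g : Circle ≃ₜ Circle) : Prop := ∃ p, Fix g = {p}

/-- Hyperbolic: exactly two fixed points, one attracting and the other repelling. -/
def IsHyperbolic (g : Circle ≃ₜ Circle) : Prop :=
  ∃ p q, p ≠ q ∧ Fix g = {p, q} ∧ IsAttracting g p ∧ IsRepelling g q

/-- pA-like: a non-trivial laminar automorphism of the pair that is neither elliptic nor parabolic
and preserves an interleaving pair. -/
def IsPALike (L₁ L₂ : Set GoodInterval) (g : Circle ≃ₜ Circle) : Prop :=
  g ∈ autPair L₁ L₂ ∧ g ≠ 1 ∧ ¬ IsElliptic g ∧ ¬ IsParabolic g ∧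
    ∃ G₁ G₂, IsInterleavingPair L₁ L₂ G₁ G₂ ∧ Preserves g G₁ ∧ Preserves g G₂

/-- Properly pseudo-Anosov: pA-like with a fixed point. -/
def IsProperlyPA (L₁ L₂ : Set GoodInterval) (g : Circle ≃ₜ Circle) : Prop :=
  IsPALike L₁ L₂ g ∧ (Fix g).Nonempty

/-! ### Groups -/

/-- `G = ⟨g⟩ × ⟨h⟩` as an internal direct product of the two cyclic subgroups. -/
def IsInternalProduct {Γ : Type*} [Group Γ] (G : Subgroup Γ) (g h : Γ) : Prop :=
  G = Subgroup.zpowers g ⊔ Subgroup.zpowers h ∧ Commute g h ∧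
    Disjoint (Subgroup.zpowers g) (Subgroup.zpowers h)

/-- The relators of `⟨g, e | e² = 1, e g e = g⁻¹⟩`, with `g` and `e` the generators `0` and `1`. -/
def dihedralRelators : Set (FreeGroup (Fin 2)) :=
  {FreeGroup.of 1 ^ 2,
    FreeGroup.of 1 * FreeGroup.of 0 * FreeGroup.of 1 * ((FreeGroup.of 0)⁻¹)⁻¹}

/-- `G = ⟨g, e | e² = 1, e g e = g⁻¹⟩`: the presented group is isomorphic to `G` by an isomorphism
that sends the two generators to `g` and `e`. -/
def HasDihedralPresentation {Γ : Type*} [Group Γ] (G : Subgroup Γ) (g e : Γ) : Prop :=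
  ∃ φ : PresentedGroup dihedralRelators ≃* G,
    (φ (PresentedGroup.of 0) : Γ) = g ∧ (φ (PresentedGroup.of 1) : Γ) = e

end Laminar

/-!
Two laminations without common endpoints control the fixed points of an automorphism of both, and
the theorem follows from a description of these fixed point sets.

**One automorphism.** Endpoints of each lamination are dense, and by looseness no point is an
endpoint of three leaves of one lamination, so an automorphism that fixes one end of a leaf fixes
the other (`IsTame.fixed_of_lf`). Let `k` be non-trivial with at least two fixed points, and let
`(a, b)` be a component of the complement of its fixed point set. A leaf of either lamination
crosses out of `(a, b)` (`IsTame.exists_crossing`), and its images under `k ^ n` and `k ^ (-n)`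
converge, at `b` and at `a`, to a point or to a leaf. Since a point is an endpoint of at most one
of the laminations, comparing the two limits at `a` and at `b` shows that either `a` and `b` are
the only fixed points, and `k` is hyperbolic, or leaves of the two laminations span the unions of
`(a, b)` with its two neighbours (`IsPseudoFibered.step`). In the second case the fixed points
form a bi-infinite or periodic sequence `P`, whose even terms are joined consecutively by leaves
of one lamination and whose odd terms by leaves of the other, with at most one further fixed point
(`IsZigzag`, `IsPseudoFibered.exists_zigzag`). The even and the odd terms are the vertices, up to
that point, of two interleaving gaps, ideal polygons if the sequence is periodic, and otherwise
crowns whose common pivot is the further fixed point.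

**Groups acting freely on a component.** Such a group is cyclic
(`IsPseudoFibered.exists_zpowers`). The ends in `(a, b)` of the leaves of `L₁` that cross out of
it, and likewise for `L₂`, form two disjoint invariant sets that contain their limits from above,
and this keeps orbits from accumulating inside `(a, b)`.

**The group.** Let `g₀` be a generator of the infinite cyclic normal subgroup. Some power of `g₀`
has a fixed point (`QuiteFull.exists_pow_fixed`), and conjugation by `G` takes this power to
itself or its inverse, so that `G` preserves its fixed point set. There are three cases.

* The fixed points form a zigzag (`IsZigzag.outcome`). The elements of `G` that fix all of them
  act freely on the component between two consecutive ones, hence form a cyclic group `⟨l⟩`; the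
  others shift the zigzag by an even number of steps, which preserves the direction of motion, so
  `l` is central. Thus `G` is generated by `l` and an element `f` with minimal shift, and `f`
  commutes with `l`. For a pair of crowns `G` is `⟨l⟩` or `⟨l⟩ × ⟨f⟩`, with `f` parabolic; for a
  pair of polygons a power of `f` lies in `⟨l⟩`, and Bézout's identity gives `G = ⟨g⟩ × ⟨e⟩` with
  `e` of finite order.
* There are two fixed points (`IsPseudoFibered.outcome_of_fix_pair`). Their stabilizer in `G` is
  generated by a hyperbolic element, and an element that exchanges them inverts it.
* There is one fixed point `p` (`IsPseudoFibered.outcome_of_fix_singleton`). It is the pivot of a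
  crown preserved by `G`. Either `G` acts faithfully by shifts on the crown and is generated by a
  parabolic element, or a non-trivial element fixes all vertices of the crown and the first case
  applies to it.

The preserved pairs are unique because an elliptic automorphism has no fixed point and then
preserves at most one gap (`IsGap.eq_of_preserves`), and because a parabolic one fixes the pivots
of the crowns it preserves (`IsTame.eq_of_isCrown`). The four groups are told apart by
commutativity, cyclicity and the number of torsion elements.
-/

open Set

namespace Laminar

open Filter Topology

/-! ### Charts of the circle -/

/-- The parametrisation `s ↦ p * exp (i s)` of the circle, starting at `p`. -/
noncomputable def lift (p : Circle) (s : ℝ) : Circle := p * Circle.exp s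

/-- The position of `z` counter-clockwise from `p`, in `[0, 2π)`. -/
noncomputable def pos (p z : Circle) : ℝ :=
  toIcoMod Real.two_pi_pos 0 (Complex.arg (z : ℂ) - Complex.arg (p : ℂ))

theorem pos_nonneg (p z : Circle) : 0 ≤ pos p z := (toIcoMod_mem_Ico Real.two_pi_pos 0 _).1

theorem pos_lt (p z : Circle) : pos p z < 2 * Real.pi := by
  have h := (toIcoMod_mem_Ico Real.two_pi_pos 0 (Complex.arg (z : ℂ) - Complex.arg (p : ℂ))).2
  rw [zero_add] at h
  exact h

theorem lift_pos (p z : Circle) : lift p (pos p z) = z := by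
  have h : Circle.exp (pos p z) = Circle.exp (Complex.arg (z : ℂ) - Complex.arg (p : ℂ)) := by
    rw [Circle.exp_eq_exp]
    refine ⟨-toIcoDiv Real.two_pi_pos 0 (Complex.arg (z : ℂ) - Complex.arg (p : ℂ)), ?_⟩
    have := toIcoMod_add_toIcoDiv_zsmul Real.two_pi_pos 0
      (Complex.arg (z : ℂ) - Complex.arg (p : ℂ))
    simp only [zsmul_eq_mul] at this
    unfold pos
    push_cast
    linarith
  rw [lift, h, sub_eq_add_neg, Circle.exp_add, Circle.exp_neg, Circle.exp_arg, Circle.exp_arg]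
  rw [mul_comm z, mul_inv_cancel_left]

theorem lift_eq_iff {p : Circle} {s t : ℝ} :
    lift p s = lift p t ↔ ∃ m : ℤ, s = t + m * (2 * Real.pi) := by
  rw [lift, lift, mul_right_inj, Circle.exp_eq_exp]

theorem lift_zero (p : Circle) : lift p 0 = p := by simp [lift]

theorem lift_two_pi (p : Circle) : lift p (2 * Real.pi) = p := by simp [lift]

theorem lift_injOn {p : Circle} {s t : ℝ} (hs : 0 ≤ s) (hs' : s < 2 * Real.pi) (ht : 0 ≤ t)
    (ht' : t < 2 * Real.pi) (h : lift p s = lift p t) : s = t := by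
  obtain ⟨m, hm⟩ := lift_eq_iff.1 h
  have hpi := Real.two_pi_pos
  have h1 : (m : ℝ) < 1 := by nlinarith
  have h2 : (-1 : ℝ) < m := by nlinarith
  have h1' : m < 1 := by exact_mod_cast h1
  have h2' : -1 < m := by exact_mod_cast h2
  have : m = 0 := by omega
  subst this
  simpa using hm

theorem pos_lift {p : Circle} {s : ℝ} (hs : 0 ≤ s) (hs' : s < 2 * Real.pi) :
    pos p (lift p s) = s :=
  lift_injOn (pos_nonneg _ _) (pos_lt _ _) hs hs' (lift_pos _ _)

theorem pos_self (p : Circle) : pos p p = 0 := by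
  conv_lhs => rw [← lift_zero p]
  rw [lift_zero]
  have := pos_lift (p := p) le_rfl Real.two_pi_pos
  rwa [lift_zero] at this

theorem pos_injective (p : Circle) : Function.Injective (pos p) := fun x y h => by
  rw [← lift_pos p x, h, lift_pos]

theorem pos_inj {p x y : Circle} : pos p x = pos p y ↔ x = y := (pos_injective p).eq_iff

theorem continuous_lift (p : Circle) : Continuous (lift p) := by
  unfold lift; fun_prop

theorem isOpenMap_lift (p : Circle) : IsOpenMap (lift p) := by
  have h := isLocalHomeomorph_circleExp.isOpenMap
  exact (isOpenMap_mul_left p).comp h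

theorem toIcoMod_cases {d : ℝ} (h1 : -(2 * Real.pi) < d) (h2 : d < 2 * Real.pi) :
    (0 ≤ d ∧ toIcoMod Real.two_pi_pos 0 d = d) ∨
      (d < 0 ∧ toIcoMod Real.two_pi_pos 0 d = d + 2 * Real.pi) := by
  rcases le_or_gt 0 d with h | h
  · exact Or.inl ⟨h, (toIcoMod_eq_iff _).2 ⟨⟨h, by linarith⟩, 0, by simp⟩⟩
  · exact Or.inr ⟨h, (toIcoMod_eq_iff _).2 ⟨⟨by linarith, by linarith⟩, -1, by simp⟩⟩

theorem toIocMod_cases {d : ℝ} (h1 : -(2 * Real.pi) < d) (h2 : d < 2 * Real.pi) :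
    (0 < d ∧ toIocMod Real.two_pi_pos 0 d = d) ∨
      (d ≤ 0 ∧ toIocMod Real.two_pi_pos 0 d = d + 2 * Real.pi) := by
  rcases lt_or_ge 0 d with h | h
  · exact Or.inl ⟨h, (toIocMod_eq_iff _).2 ⟨⟨h, by linarith⟩, 0, by simp⟩⟩
  · exact Or.inr ⟨h, (toIocMod_eq_iff _).2 ⟨⟨by linarith, by linarith⟩, -1, by simp⟩⟩

theorem coe_arg_lift (p : Circle) (s : ℝ) :
    ((Complex.arg (lift p s : ℂ) : ℝ) : Real.Angle) = ((Complex.arg (p : ℂ) + s : ℝ) : Real.Angle) := by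
  have h : Circle.exp (Complex.arg (lift p s : ℂ)) = Circle.exp (Complex.arg (p : ℂ) + s) := by
    rw [Circle.exp_arg, Circle.exp_add, Circle.exp_arg, lift]
  obtain ⟨m, hm⟩ := Circle.exp_eq_exp.1 h
  rw [Real.Angle.angle_eq_iff_two_pi_dvd_sub]
  exact ⟨m, by rw [hm]; ring⟩

theorem ccw_lift {p : Circle} {s t u : ℝ} (hs : 0 ≤ s) (hs' : s < 2 * Real.pi) (ht : 0 ≤ t)
    (ht' : t < 2 * Real.pi) (hu : 0 ≤ u) (hu' : u < 2 * Real.pi) :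
    CCW (lift p s) (lift p t) (lift p u) ↔
      (s < t ∧ t < u) ∨ (t < u ∧ u < s) ∨ (u < s ∧ s < t) := by
  unfold CCW
  rw [coe_arg_lift, coe_arg_lift, coe_arg_lift, sbtw_iff_not_btw]
  have : Fact (0 < 2 * Real.pi) := ⟨Real.two_pi_pos⟩
  have key := @QuotientAddGroup.btw_coe_iff' ℝ _ _ _ _ (2 * Real.pi) this
    (Complex.arg (p : ℂ) + u) (Complex.arg (p : ℂ) + t) (Complex.arg (p : ℂ) + s)
  refine (not_congr key).trans ?_
  rw [not_le, add_sub_add_left_eq_sub, add_sub_add_left_eq_sub]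
  rcases toIcoMod_cases (d := t - u) (by linarith) (by linarith) with ⟨h1, h2⟩ | ⟨h1, h2⟩ <;>
  rcases toIocMod_cases (d := s - u) (by linarith) (by linarith) with ⟨h3, h4⟩ | ⟨h3, h4⟩ <;>
  rw [h2, h4] <;> constructor
  all_goals first
    | (rintro h; first
        | exact Or.inl ⟨by linarith, by linarith⟩
        | exact Or.inr (Or.inl ⟨by linarith, by linarith⟩)
        | exact Or.inr (Or.inr ⟨by linarith, by linarith⟩))
    | (rintro (⟨h, h'⟩ | ⟨h, h'⟩ | ⟨h, h'⟩) <;> linarith)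

/-- The circular order read in the chart based at any point `p`. -/
theorem ccw_iff (p : Circle) {x y z : Circle} :
    CCW x y z ↔ (pos p x < pos p y ∧ pos p y < pos p z) ∨ (pos p y < pos p z ∧ pos p z < pos p x) ∨
      (pos p z < pos p x ∧ pos p x < pos p y) := by
  conv_lhs => rw [← lift_pos p x, ← lift_pos p y, ← lift_pos p z]
  exact ccw_lift (pos_nonneg _ _) (pos_lt _ _) (pos_nonneg _ _) (pos_lt _ _) (pos_nonneg _ _)
    (pos_lt _ _)

theorem pos_pos {p x : Circle} (h : x ≠ p) : 0 < pos p x := by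
  refine lt_of_le_of_ne (pos_nonneg _ _) fun h' => h ?_
  rw [← pos_self p] at h'
  exact (pos_injective p h').symm

theorem ccw_base {p x y : Circle} : CCW p x y ↔ 0 < pos p x ∧ pos p x < pos p y := by
  rw [ccw_iff p, pos_self]
  have h1 := pos_nonneg p x
  have h2 := pos_nonneg p y
  constructor
  · rintro (⟨h, h'⟩ | ⟨h, h'⟩ | ⟨h, h'⟩)
    · exact ⟨h, h'⟩
    · linarith
    · linarith
  · exact fun h => Or.inl h

theorem ccw_base_right {p x y : Circle} : CCW x p y ↔ 0 < pos p y ∧ pos p y < pos p x := by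
  rw [← ccw_base]; exact ⟨CCW.rotate, fun h => h.rotate.rotate⟩

theorem exists_ccw {a b : Circle} (h : a ≠ b) : ∃ z, CCW a z b := by
  have h1 := pos_pos h.symm
  refine ⟨lift a (pos a b / 2), ?_⟩
  have h2 := pos_lt a b
  rw [ccw_base, pos_lift (by linarith) (by linarith)]
  constructor <;> linarith

namespace GoodInterval

theorem mem_arc {I : GoodInterval} {z : Circle} : z ∈ I.arc ↔ CCW I.left z I.right := Iff.rfl

theorem mem_opp_arc {I : GoodInterval} {z : Circle} : z ∈ I.opp.arc ↔ CCW I.right z I.left := Iff.rfl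

theorem mem_arc_iff_pos {I : GoodInterval} {z : Circle} :
    z ∈ I.arc ↔ 0 < pos I.left z ∧ pos I.left z < pos I.left I.right := ccw_base

theorem opp_opp (I : GoodInterval) : I.opp.opp = I := rfl

theorem nonempty_arc (I : GoodInterval) : I.arc.Nonempty := exists_ccw I.ne

theorem left_notMem (I : GoodInterval) : I.left ∉ I.arc := fun h => h.ne.1 rfl

theorem right_notMem (I : GoodInterval) : I.right ∉ I.arc := fun h => h.ne.2.1 rfl

theorem disjoint_opp (I : GoodInterval) : Disjoint I.arc I.opp.arc := by
  rw [Set.disjoint_left]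
  intro z hz hz'
  exact hz.asymm hz'

theorem mem_or (I : GoodInterval) (z : Circle) :
    z ∈ I.arc ∨ z ∈ I.opp.arc ∨ z = I.left ∨ z = I.right := by
  by_cases h1 : z = I.left
  · exact Or.inr (Or.inr (Or.inl h1))
  by_cases h2 : z = I.right
  · exact Or.inr (Or.inr (Or.inr h2))
  rcases CCW.of_ne (Ne.symm h1) h2 I.ne.symm with h | h
  · exact Or.inl h
  · exact Or.inr (Or.inl h)

theorem notMem_arc_iff {I : GoodInterval} {z : Circle} :
    z ∉ I.arc ↔ z ∈ I.opp.arc ∨ z = I.left ∨ z = I.right := by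
  constructor
  · intro h; exact (I.mem_or z).resolve_left h
  · rintro (h | rfl | rfl) h'
    · exact Set.disjoint_left.1 I.disjoint_opp h' h
    · exact I.left_notMem h'
    · exact I.right_notMem h'

/-- In the chart at the left endpoint of `J`, inclusion of arcs is an inequality of positions. The
strict inequality makes the degenerate position of `J.left` as a right endpoint harmless. -/
theorem arc_subset_iff {I J : GoodInterval} :
    I.arc ⊆ J.arc ↔ pos J.left I.left < pos J.left I.right ∧
      pos J.left I.right ≤ pos J.left J.right := by
  have hl := pos_nonneg J.left I.left
  have hl' := pos_lt J.left I.left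
  have hr := pos_nonneg J.left I.right
  have hr' := pos_lt J.left I.right
  have hne : pos J.left I.left ≠ pos J.left I.right := fun h => I.ne (pos_injective _ h)
  have hJ := pos_lt J.left J.right
  have hJ0 : 0 < pos J.left J.right := pos_pos J.ne.symm
  constructor
  · intro h
    -- a witness in `I` close to the offending end
    have wit : ∀ s, 0 ≤ s → s < 2 * Real.pi →
        ((pos J.left I.left < s ∧ s < pos J.left I.right) ∨
          (s < pos J.left I.right ∧ pos J.left I.right < pos J.left I.left) ∨
          (pos J.left I.right < pos J.left I.left ∧ pos J.left I.left < s)) →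
        0 < s ∧ s < pos J.left J.right := by
      intro s hs hs' hc
      have hm : lift J.left s ∈ I.arc := by
        rw [mem_arc, ccw_iff J.left, pos_lift hs hs']; exact hc
      have := h hm
      rwa [mem_arc_iff_pos, pos_lift hs hs'] at this
    rcases lt_or_gt_of_ne hne with h1 | h1
    · refine ⟨h1, ?_⟩
      by_contra h2
      rw [not_le] at h2
      have h3 := max_lt h1 h2
      set m := max (pos J.left I.left) (pos J.left J.right)
      have h4 : pos J.left I.left ≤ m := le_max_left _ _
      have h5 : pos J.left J.right ≤ m := le_max_right _ _
      have := wit ((m + pos J.left I.right) / 2) (by linarith) (by linarith)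
        (Or.inl ⟨by linarith, by linarith⟩)
      linarith
    · exfalso
      have h3 := max_lt hl' hJ
      set m := max (pos J.left I.left) (pos J.left J.right)
      have h4 : pos J.left I.left ≤ m := le_max_left _ _
      have h5 : pos J.left J.right ≤ m := le_max_right _ _
      have := wit ((m + 2 * Real.pi) / 2) (by linarith) (by linarith)
        (Or.inr (Or.inr ⟨by linarith, by linarith⟩))
      linarith
  · rintro ⟨h1, h2⟩ z hz
    rw [mem_arc, ccw_iff J.left] at hz
    rw [mem_arc_iff_pos]
    have hz0 := pos_nonneg J.left z
    rcases hz with ⟨h, h'⟩ | ⟨h, h'⟩ | ⟨h, h'⟩ <;> constructor <;> linarith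

theorem eq_of_arc_eq {I J : GoodInterval} (h : I.arc = J.arc) : I = J := by
  have h1 := arc_subset_iff.1 h.subset
  have h2 := arc_subset_iff.1 h.symm.subset
  have h0 := pos_nonneg J.left I.left
  have hl : I.left = J.left := by
    by_contra hne
    have hpos := pos_pos hne
    -- the chart at `I.left` is a translate of the chart at `J.left`
    have : CCW J.left I.left J.right := ccw_base.2 ⟨hpos, by linarith [h1.1, h1.2]⟩
    exact I.left_notMem (h ▸ this)
  have hr : I.right = J.right := by
    rw [hl] at h2
    exact pos_injective _ (le_antisymm h1.2 h2.2)
  exact GoodInterval.ext hl hr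

theorem isOpen_arc (I : GoodInterval) : IsOpen I.arc := by
  have : I.arc = lift I.left '' Ioo 0 (pos I.left I.right) := by
    ext z
    rw [mem_arc_iff_pos]
    constructor
    · exact fun h => ⟨pos I.left z, h, lift_pos _ _⟩
    · rintro ⟨s, hs, rfl⟩
      rwa [pos_lift hs.1.le (hs.2.trans (pos_lt _ _))]
  rw [this]
  exact isOpenMap_lift _ _ isOpen_Ioo

theorem closure_arc_subset (I : GoodInterval) : closure I.arc ⊆ insert I.left (insert I.right I.arc) := by
  have : closure I.arc ⊆ (I.opp.arc)ᶜ :=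
    closure_minimal (Set.subset_compl_iff_disjoint_right.2 I.disjoint_opp)
      I.opp.isOpen_arc.isClosed_compl
  intro z hz
  have h := this hz
  rcases I.mem_or z with h1 | h1 | h1 | h1
  · exact Or.inr (Or.inr h1)
  · exact absurd h1 h
  · exact Or.inl h1
  · exact Or.inr (Or.inl h1)

theorem not_countable_arc (I : GoodInterval) : ¬ I.arc.Countable := by
  intro h
  have h2 : (Ioo 0 (pos I.left I.right)).Countable := by
    have : Ioo 0 (pos I.left I.right) ⊆ lift I.left ⁻¹' I.arc ∩ Ioo 0 (pos I.left I.right) := by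
      intro s hs
      refine ⟨?_, hs⟩
      rw [mem_preimage, mem_arc_iff_pos, pos_lift hs.1.le (hs.2.trans (pos_lt _ _))]
      exact hs
    refine Set.Countable.mono this ?_
    refine Set.MapsTo.countable_of_injOn (f := lift I.left) (t := I.arc) (fun s hs => hs.1) ?_ h
    intro s hs t ht hst
    exact lift_injOn hs.2.1.le (hs.2.2.trans (pos_lt _ _)) ht.2.1.le (ht.2.2.trans (pos_lt _ _)) hst
  rw [Cardinal.Real.Ioo_countable_iff] at h2
  exact absurd (pos_pos I.ne.symm) (not_lt.2 h2)

/-- Arcs are disjoint exactly when one lies in the opposite of the other. -/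
theorem disjoint_iff_subset_opp {I J : GoodInterval} :
    Disjoint I.arc J.arc ↔ I.arc ⊆ J.opp.arc := by
  constructor
  · intro h z hz
    have hzJ : z ∉ J.arc := Set.disjoint_left.1 h hz
    have key : ∀ w, w ∈ I.arc → ¬ (w = J.left ∨ w = J.right) := by
      intro w hw hw'
      have hcl : w ∈ closure J.arc := by
        have hop := I.isOpen_arc
        rw [mem_closure_iff_nhds]
        intro U hU
        have hV := continuous_lift J.left
        rcases hw' with rfl | rfl
        · have : Tendsto (lift J.left) (𝓝[>] 0) (𝓝 J.left) := by
            have := (hV.tendsto 0).mono_left (nhdsWithin_le_nhds (s := Ioi 0))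
            rwa [lift_zero] at this
          obtain ⟨s, hs, hs'⟩ := ((this.eventually hU).and
            (Ioo_mem_nhdsGT (pos_pos J.ne.symm))).exists
          exact ⟨lift J.left s, hs, mem_arc_iff_pos.2 (by
            rwa [pos_lift hs'.1.le (hs'.2.trans (pos_lt _ _))])⟩
        · have : Tendsto (lift J.left) (𝓝[<] (pos J.left J.right)) (𝓝 J.right) := by
            have := (hV.tendsto (pos J.left J.right)).mono_left
              (nhdsWithin_le_nhds (s := Iio (pos J.left J.right)))
            rwa [lift_pos] at this
          obtain ⟨s, hs, hs'⟩ := ((this.eventually hU).and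
            (Ioo_mem_nhdsLT (pos_pos J.ne.symm))).exists
          exact ⟨lift J.left s, hs, mem_arc_iff_pos.2 (by
            rwa [pos_lift hs'.1.le (hs'.2.trans (pos_lt _ _))])⟩
      obtain ⟨v, hv, hv'⟩ := mem_closure_iff.1 hcl I.arc I.isOpen_arc hw
      exact Set.disjoint_left.1 h hv hv'
    rcases J.mem_or z with h1 | h1 | h1
    · exact absurd h1 hzJ
    · exact h1
    · exact absurd h1 (key z hz)
  · intro h
    exact (J.disjoint_opp.mono_right h).symm

theorem opp_subset_opp {I J : GoodInterval} : I.opp.arc ⊆ J.opp.arc ↔ J.arc ⊆ I.arc := by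
  have := @disjoint_iff_subset_opp I.opp J
  have h2 := @disjoint_iff_subset_opp J I.opp
  rw [← this, disjoint_comm, h2, opp_opp]

theorem opp_subset_comm {I J : GoodInterval} : I.opp.arc ⊆ J.arc ↔ J.opp.arc ⊆ I.arc := by
  have := @opp_subset_opp I J.opp
  rwa [opp_opp] at this

theorem subset_opp_comm {I J : GoodInterval} : I.arc ⊆ J.opp.arc ↔ J.arc ⊆ I.opp.arc := by
  have := @opp_subset_opp I.opp J
  rwa [opp_opp] at this

/-- Arcs that share a left endpoint meet. -/
theorem not_disjoint_of_left_eq {I J : GoodInterval} (h : I.left = J.left) :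
    ¬ Disjoint I.arc J.arc := by
  intro hd
  have h1 := pos_pos I.ne.symm
  have h2 := pos_pos J.ne.symm
  rw [← h] at h2
  have h3 := lt_min h1 h2
  set m := min (pos I.left I.right) (pos I.left J.right)
  have h4 : m ≤ pos I.left I.right := min_le_left _ _
  have h5 : m ≤ pos I.left J.right := min_le_right _ _
  have h6 := pos_lt I.left I.right
  have hp : pos I.left (lift I.left (m / 2)) = m / 2 := pos_lift (by linarith) (by linarith)
  have hI : lift I.left (m / 2) ∈ I.arc := by
    rw [mem_arc_iff_pos, hp]; constructor <;> linarith
  have hJ : lift I.left (m / 2) ∈ J.arc := by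
    rw [mem_arc_iff_pos, ← h, hp]; constructor <;> linarith
  exact Set.disjoint_left.1 hd hI hJ

/-- Arcs that share a right endpoint meet. -/
theorem not_disjoint_of_right_eq {I J : GoodInterval} (h : I.right = J.right) :
    ¬ Disjoint I.arc J.arc := by
  intro hd
  rw [disjoint_iff_subset_opp] at hd
  have := arc_subset_iff.1 hd
  simp only [opp, ← h, pos_self] at this
  linarith [pos_nonneg I.right I.left]

end GoodInterval

/-! ### Images of arcs, orbits, and limits -/

theorem lift_lift (p : Circle) (s u : ℝ) : lift (lift p s) u = lift p (s + u) := by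
  unfold lift; rw [Circle.exp_add, mul_assoc]

theorem lift_ne {p : Circle} {s t : ℝ} (h : s < t) (h' : t < s + 2 * Real.pi) :
    lift p s ≠ lift p t := by
  have : lift p t = lift (lift p s) (t - s) := by rw [lift_lift]; congr 1; ring
  rw [this]
  intro e
  have h2 := pos_lift (p := lift p s) (s := t - s) (by linarith) (by linarith)
  rw [← e, pos_self] at h2
  linarith

theorem pos_lift_lift {p : Circle} {s t : ℝ} (h : s ≤ t) (h' : t < s + 2 * Real.pi) :
    pos (lift p s) (lift p t) = t - s := by
  have : lift p t = lift (lift p s) (t - s) := by rw [lift_lift]; congr 1; ring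
  rw [this, pos_lift (by linarith) (by linarith)]

theorem arc_lift {p : Circle} {s t : ℝ} (h : s < t) (h' : t < s + 2 * Real.pi)
    (hne : lift p s ≠ lift p t) :
    (⟨lift p s, lift p t, hne⟩ : GoodInterval).arc = lift p '' Ioo s t := by
  ext z
  rw [GoodInterval.mem_arc_iff_pos]
  change 0 < pos (lift p s) z ∧ pos (lift p s) z < pos (lift p s) (lift p t) ↔ _
  rw [pos_lift_lift h.le h']
  constructor
  · rintro ⟨h1, h2⟩
    refine ⟨s + pos (lift p s) z, ⟨by linarith, by linarith⟩, ?_⟩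
    rw [← lift_lift, lift_pos]
  · rintro ⟨u, ⟨h1, h2⟩, rfl⟩
    rw [pos_lift_lift h1.le (by linarith)]
    constructor <;> linarith

theorem arc_of_left_eq {I : GoodInterval} {p : Circle} {s : ℝ} (h : I.left = lift p s) :
    ∃ d, 0 < d ∧ d < 2 * Real.pi ∧ I.right = lift p (s + d) ∧ I.arc = lift p '' Ioo s (s + d) := by
  have h1 := pos_pos I.ne.symm
  have h2 := pos_lt I.left I.right
  have h3 : I.right = lift p (s + pos I.left I.right) := by rw [← lift_lift, ← h, lift_pos]
  refine ⟨pos I.left I.right, h1, h2, h3, ?_⟩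
  have hne : lift p s ≠ lift p (s + pos I.left I.right) := lift_ne (by linarith) (by linarith)
  rw [← arc_lift (by linarith) (by linarith) hne]
  congr 1
  exact GoodInterval.ext h h3

theorem arc_of_right_eq {I : GoodInterval} {p : Circle} {s : ℝ} (h : I.right = lift p s) :
    ∃ d, 0 < d ∧ d < 2 * Real.pi ∧ I.left = lift p (s - d) ∧ I.arc = lift p '' Ioo (s - d) s := by
  obtain ⟨d, h1, h2, h3, -⟩ := arc_of_left_eq (I := I.opp) (s := s) h
  have h4 : I.left = lift p (s - (2 * Real.pi - d)) := by
    have h3' : I.left = lift p (s + d) := h3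
    rw [h3', lift_eq_iff]
    exact ⟨1, by push_cast; ring⟩
  refine ⟨2 * Real.pi - d, by linarith, by linarith, h4, ?_⟩
  have hne : lift p (s - (2 * Real.pi - d)) ≠ lift p s := lift_ne (by linarith) (by linarith)
  rw [← arc_lift (by linarith) (by linarith) hne]
  congr 1
  exact GoodInterval.ext h4 h

namespace GoodInterval

variable {k : Circle ≃ₜ Circle}

theorem mem_map_arc (hk : OrientationPreserving k) {I : GoodInterval} {z : Circle} :
    k z ∈ (I.map k).arc ↔ z ∈ I.arc := hk.ccw_iff

theorem map_arc_subset (hk : OrientationPreserving k) {I J : GoodInterval} :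
    (I.map k).arc ⊆ (J.map k).arc ↔ I.arc ⊆ J.arc := by
  rw [arc_map hk, arc_map hk, image_subset_image_iff k.injective]

theorem map_inj {I J : GoodInterval} : I.map k = J.map k ↔ I = J := by
  constructor
  · intro h
    have h1 := congrArg GoodInterval.left h
    have h2 := congrArg GoodInterval.right h
    exact GoodInterval.ext (k.injective h1) (k.injective h2)
  · rintro rfl; rfl

theorem map_opp (I : GoodInterval) : I.opp.map k = (I.map k).opp := rfl

theorem map_map_inv (I : GoodInterval) : (I.map k⁻¹).map k = I := by
  rw [← map_mul, mul_inv_cancel, map_one]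

theorem map_eq_self {I : GoodInterval} : I.map k = I ↔ k I.left = I.left ∧ k I.right = I.right := by
  constructor
  · intro h
    exact ⟨congrArg GoodInterval.left h, congrArg GoodInterval.right h⟩
  · rintro ⟨h1, h2⟩
    exact GoodInterval.ext h1 h2

end GoodInterval

theorem Preserves.mem_iff {k : Circle ≃ₜ Circle} {F : Set GoodInterval} (h : Preserves k F)
    {I : GoodInterval} : I.map k ∈ F ↔ I ∈ F := by
  constructor
  · intro hI
    rw [← h] at hI
    obtain ⟨J, hJ, e⟩ := hI
    rwa [← GoodInterval.map_inj.1 e]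
  · intro hI
    rw [← h]
    exact mem_image_of_mem _ hI

theorem preserves_iff {k : Circle ≃ₜ Circle} {F : Set GoodInterval} :
    Preserves k F ↔ ∀ I, I.map k ∈ F ↔ I ∈ F := by
  refine ⟨fun h I => h.mem_iff, fun h => ?_⟩
  ext I
  constructor
  · rintro ⟨J, hJ, rfl⟩
    exact (h J).2 hJ
  · intro hI
    refine ⟨I.map k⁻¹, (h _).1 ?_, GoodInterval.map_map_inv I⟩
    rwa [GoodInterval.map_map_inv]

theorem Preserves.inv {k : Circle ≃ₜ Circle} {F : Set GoodInterval} (h : Preserves k F) :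
    Preserves k⁻¹ F := by
  rw [preserves_iff]
  intro I
  rw [← h.mem_iff, GoodInterval.map_map_inv]

theorem Preserves.mul {k l : Circle ≃ₜ Circle} {F : Set GoodInterval} (h : Preserves k F)
    (h' : Preserves l F) : Preserves (k * l) F := by
  rw [preserves_iff]
  intro I
  rw [GoodInterval.map_mul, h.mem_iff, h'.mem_iff]

theorem Preserves.pow {k : Circle ≃ₜ Circle} {F : Set GoodInterval} (h : Preserves k F) (n : ℕ) :
    Preserves (k ^ n) F := by
  induction n with
  | zero => exact image_id F
  | succ n ih => rw [pow_succ]; exact ih.mul h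

theorem OrientationPreserving.inv {k : Circle ≃ₜ Circle} (h : OrientationPreserving k) :
    OrientationPreserving k⁻¹ := homeoPlus.inv_mem h

theorem OrientationPreserving.pow {k : Circle ≃ₜ Circle} (h : OrientationPreserving k) (n : ℕ) :
    OrientationPreserving (k ^ n) := homeoPlus.pow_mem h n

theorem pow_succ_apply (k : Circle ≃ₜ Circle) (n : ℕ) (x : Circle) :
    (k ^ (n + 1)) x = k ((k ^ n) x) := by rw [pow_succ']; rfl

theorem pow_succ_apply' (k : Circle ≃ₜ Circle) (n : ℕ) (x : Circle) :
    (k ^ (n + 1)) x = (k ^ n) (k x) := by rw [pow_succ]; rfl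

theorem inv_apply_self (k : Circle ≃ₜ Circle) (x : Circle) : k⁻¹ (k x) = x := k.symm_apply_apply x

theorem apply_inv_self (k : Circle ≃ₜ Circle) (x : Circle) : k (k⁻¹ x) = x := k.apply_symm_apply x

theorem inv_apply_eq {k : Circle ≃ₜ Circle} {x y : Circle} : k⁻¹ x = y ↔ x = k y :=
  ⟨fun h => by rw [← h, apply_inv_self], fun h => by rw [h, inv_apply_self]⟩

theorem mem_Fix {k : Circle ≃ₜ Circle} {x : Circle} : x ∈ Fix k ↔ k x = x := Iff.rfl

theorem Fix_inv (k : Circle ≃ₜ Circle) : Fix k⁻¹ = Fix k := by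
  ext x
  rw [mem_Fix, mem_Fix, inv_apply_eq, eq_comm]

theorem pow_fix {k : Circle ≃ₜ Circle} {x : Circle} (h : k x = x) (n : ℕ) : (k ^ n) x = x := by
  induction n with
  | zero => rfl
  | succ n ih => rw [pow_succ_apply, ih, h]

section Orbits

variable {k : Circle ≃ₜ Circle} {a : Circle}

theorem pos_map_lt (hk : OrientationPreserving k) (ha : k a = a) {x y : Circle} :
    pos a (k x) < pos a (k y) ↔ pos a x < pos a y := by
  by_cases hx : x = a
  · subst hx
    rw [ha, pos_self]
    constructor
    · intro h
      refine pos_pos ?_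
      rintro rfl
      rw [ha, pos_self] at h
      exact lt_irrefl _ h
    · intro h
      refine pos_pos fun e => ?_
      have := k.injective (e.trans ha.symm)
      rw [this, pos_self] at h
      exact lt_irrefl _ h
  · have hkx : k x ≠ a := fun e => hx (k.injective (e.trans ha.symm))
    have h1 := @ccw_base a x y
    have h2 := @ccw_base a (k x) (k y)
    have h3 : CCW a (k x) (k y) ↔ CCW a x y := by
      conv_lhs => rw [← ha]
      exact hk.ccw_iff
    have := pos_pos hx
    have := pos_pos hkx
    tauto

theorem pos_map_le (hk : OrientationPreserving k) (ha : k a = a) {x y : Circle} :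
    pos a (k x) ≤ pos a (k y) ↔ pos a x ≤ pos a y := by
  rw [← not_lt, ← not_lt, pos_map_lt hk ha]

theorem fixed_of_tendsto {x : Circle} {s : ℝ}
    (h : Tendsto (fun n : ℕ => pos a ((k ^ n) x)) atTop (𝓝 s)) : k (lift a s) = lift a s := by
  have h1 : Tendsto (fun n : ℕ => (k ^ n) x) atTop (𝓝 (lift a s)) := by
    have := ((continuous_lift a).tendsto s).comp h
    simpa only [Function.comp_def, lift_pos] using this
  have h2 : Tendsto (fun n : ℕ => k ((k ^ n) x)) atTop (𝓝 (k (lift a s))) :=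
    (k.continuous.tendsto _).comp h1
  have h3 : Tendsto (fun n : ℕ => k ((k ^ n) x)) atTop (𝓝 (lift a s)) := by
    have := h1.comp (tendsto_add_atTop_nat 1)
    refine this.congr fun n => ?_
    simp only [Function.comp_def]
    rw [pow_succ_apply]
  exact tendsto_nhds_unique h2 h3

/-- A point moved forward in the chart at a fixed point converges forward to a fixed point. -/
theorem orbit_up (hk : OrientationPreserving k) (ha : k a = a) {x : Circle}
    (h : pos a x < pos a (k x)) :
    ∃ s, s ≤ 2 * Real.pi ∧ StrictMono (fun n : ℕ => pos a ((k ^ n) x)) ∧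
      (∀ n, pos a ((k ^ n) x) < s) ∧ Tendsto (fun n : ℕ => pos a ((k ^ n) x)) atTop (𝓝 s) ∧
      k (lift a s) = lift a s := by
  have hm : StrictMono (fun n : ℕ => pos a ((k ^ n) x)) := by
    refine strictMono_nat_of_lt_succ fun n => ?_
    rw [pow_succ_apply']
    induction n with
    | zero => exact h
    | succ n ih =>
      rw [pow_succ_apply, pow_succ_apply]
      exact (pos_map_lt hk ha).2 ih
  have hb : BddAbove (range fun n : ℕ => pos a ((k ^ n) x)) :=
    ⟨2 * Real.pi, by rintro _ ⟨n, rfl⟩; exact (pos_lt _ _).le⟩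
  have ht := tendsto_atTop_ciSup hm.monotone hb
  refine ⟨_, ciSup_le fun n => (pos_lt _ _).le, hm, fun n => ?_, ht, fixed_of_tendsto ht⟩
  exact (hm (Nat.lt_succ_self n)).trans_le (le_ciSup hb (n + 1))

/-- A point moved backward in the chart at a fixed point converges backward to a fixed point. -/
theorem orbit_down (hk : OrientationPreserving k) (ha : k a = a) {x : Circle}
    (h : pos a (k x) < pos a x) :
    ∃ s, 0 ≤ s ∧ StrictAnti (fun n : ℕ => pos a ((k ^ n) x)) ∧
      (∀ n, s < pos a ((k ^ n) x)) ∧ Tendsto (fun n : ℕ => pos a ((k ^ n) x)) atTop (𝓝 s) ∧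
      k (lift a s) = lift a s := by
  have hm : StrictAnti (fun n : ℕ => pos a ((k ^ n) x)) := by
    refine strictAnti_nat_of_succ_lt fun n => ?_
    rw [pow_succ_apply']
    induction n with
    | zero => exact h
    | succ n ih =>
      rw [pow_succ_apply, pow_succ_apply]
      exact (pos_map_lt hk ha).2 ih
  have hb : BddBelow (range fun n : ℕ => pos a ((k ^ n) x)) :=
    ⟨0, by rintro _ ⟨n, rfl⟩; exact pos_nonneg _ _⟩
  have ht := tendsto_atTop_ciInf hm.antitone hb
  refine ⟨_, le_ciInf fun n => pos_nonneg _ _, hm, fun n => ?_, ht, fixed_of_tendsto ht⟩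
  exact (ciInf_le hb (n + 1)).trans_lt (hm (Nat.lt_succ_self n))

theorem pos_inv_lt (hk : OrientationPreserving k) (ha : k a = a) {x : Circle} :
    pos a (k⁻¹ x) < pos a x ↔ pos a x < pos a (k x) := by
  rw [← pos_map_lt hk ha, apply_inv_self]

theorem lt_pos_inv (hk : OrientationPreserving k) (ha : k a = a) {x : Circle} :
    pos a x < pos a (k⁻¹ x) ↔ pos a (k x) < pos a x := by
  rw [← pos_map_lt hk ha, apply_inv_self]

end Orbits

/-! ### Leaves -/

/-- `x` and `y` are the endpoints of a leaf of `L`. -/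
def Lf (L : Set GoodInterval) (x y : Circle) : Prop := ∃ h : x ≠ y, (⟨x, y, h⟩ : GoodInterval) ∈ L

theorem Lf.of_mem {L : Set GoodInterval} {I : GoodInterval} (h : I ∈ L) : Lf L I.left I.right :=
  ⟨I.ne, h⟩

theorem Lf.symm {L : Set GoodInterval} (hL : IsLaminationSystem L) {x y : Circle} (h : Lf L x y) :
    Lf L y x := ⟨h.1.symm, hL.opp_mem _ h.2⟩

theorem Lf.map_iff {L : Set GoodInterval} {k : Circle ≃ₜ Circle} (hk : Preserves k L)
    {x y : Circle} : Lf L (k x) (k y) ↔ Lf L x y := by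
  constructor
  · rintro ⟨h, h'⟩
    have hne : x ≠ y := fun e => h (e ▸ rfl)
    exact ⟨hne, hk.mem_iff.1 (show (GoodInterval.mk x y hne).map k ∈ L from h')⟩
  · rintro ⟨h, h'⟩
    exact ⟨fun e => h (k.injective e), hk.mem_iff.2 h'⟩

theorem vertexSet_leaf (I : GoodInterval) : vertexSet (leaf I) = {I.left, I.right} := by
  ext z
  simp only [vertexSet, leaf, mem_insert_iff, mem_singleton_iff, mem_compl_iff, mem_iUnion,
    exists_prop, not_exists, not_and, forall_eq_or_imp, forall_eq]
  constructor
  · rintro ⟨h1, h2⟩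
    rcases I.mem_or z with h | h | h
    · exact absurd h h1
    · exact absurd h h2
    · exact h
  · rintro (rfl | rfl)
    · exact ⟨I.left_notMem, I.opp.right_notMem⟩
    · exact ⟨I.right_notMem, I.opp.left_notMem⟩

theorem mem_endpointSet {L : Set GoodInterval} (hL : IsLaminationSystem L) {x : Circle} :
    x ∈ endpointSet L ↔ ∃ y, Lf L x y := by
  simp only [endpointSet, mem_iUnion, vertexSet_leaf, mem_insert_iff, mem_singleton_iff, exists_prop]
  constructor
  · rintro ⟨I, hI, rfl | rfl⟩
    · exact ⟨_, Lf.of_mem hI⟩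
    · exact ⟨_, (Lf.of_mem hI).symm hL⟩
  · rintro ⟨y, h, h'⟩
    exact ⟨_, h', Or.inl rfl⟩

section Lamination

variable {L : Set GoodInterval} (hL : IsLaminationSystem L)

include hL

theorem IsLaminationSystem.trichotomy {I J : GoodInterval} (hI : I ∈ L) (hJ : J ∈ L) :
    I.arc ⊆ J.arc ∨ J.arc ⊆ I.arc ∨ Disjoint I.arc J.arc ∨ I.opp.arc ⊆ J.arc := by
  rcases hL.unlinked I hI J hJ with (h | h) | (h | h)
  · exact Or.inl h
  · exact Or.inr (Or.inr (Or.inr h))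
  · exact Or.inr (Or.inr (Or.inl (GoodInterval.disjoint_iff_subset_opp.2 h)))
  · exact Or.inr (Or.inl (GoodInterval.opp_subset_opp.1 h))

/-- A leaf does not separate the two ends of another leaf. -/
theorem IsLaminationSystem.not_linked {x y u v : Circle} (h : Lf L x y) (h' : Lf L u v)
    (h1 : CCW u x v) (h2 : CCW v y u) : False := by
  obtain ⟨hne, hI⟩ := h
  obtain ⟨hne', hJ⟩ := h'
  rcases hL.trichotomy hI hJ with h | h | h | h
  · have h3 := GoodInterval.arc_subset_iff.1 h
    simp only at h3
    simp only [ccw_iff u, pos_self] at h1 h2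
    have := pos_nonneg u x
    have := pos_nonneg u y
    have := pos_nonneg u u
    have := pos_nonneg u v
    rcases h1 with h1 | h1 | h1 <;> rcases h2 with h2 | h2 | h2 <;> linarith [h3.1, h3.2]
  · have h3 := GoodInterval.arc_subset_iff.1 h
    simp only at h3
    simp only [ccw_iff x, pos_self] at h1 h2
    have := pos_nonneg x x
    have := pos_nonneg x y
    have := pos_nonneg x u
    have := pos_nonneg x v
    rcases h1 with h1 | h1 | h1 <;> rcases h2 with h2 | h2 | h2 <;> linarith [h3.1, h3.2]
  · rw [GoodInterval.disjoint_iff_subset_opp] at h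
    have h3 := GoodInterval.arc_subset_iff.1 h
    simp only [GoodInterval.opp] at h3
    simp only [ccw_iff v, pos_self] at h1 h2
    have := pos_nonneg v x
    have := pos_nonneg v y
    have := pos_nonneg v u
    have := pos_nonneg v v
    rcases h1 with h1 | h1 | h1 <;> rcases h2 with h2 | h2 | h2 <;> linarith [h3.1, h3.2]
  · have h3 := GoodInterval.arc_subset_iff.1 h
    simp only [GoodInterval.opp] at h3
    simp only [ccw_iff u, pos_self] at h1 h2
    have := pos_nonneg u x
    have := pos_nonneg u y
    have := pos_nonneg u u
    have := pos_nonneg u v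
    rcases h1 with h1 | h1 | h1 <;> rcases h2 with h2 | h2 | h2 <;> linarith [h3.1, h3.2]

/-- A monotone sequence of widening leaves converges to a leaf, provided that the limits of the ends
are distinct points. -/
theorem IsLaminationSystem.lf_limit {p : Circle} {s t : ℕ → ℝ} {S T : ℝ} (hs : Antitone s)
    (ht : Monotone t) (hS : Tendsto s atTop (𝓝 S)) (hT : Tendsto t atTop (𝓝 T))
    (hlt : ∀ n, s n < t n) (hST : T < S + 2 * Real.pi)
    (h : ∀ n, Lf L (lift p (s n)) (lift p (t n))) : Lf L (lift p S) (lift p T) := by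
  have hs' : ∀ n, S ≤ s n := fun n => hs.le_of_tendsto hS n
  have ht' : ∀ n, t n ≤ T := fun n => ht.ge_of_tendsto hT n
  have hlt' : S < T := (hs' 0).trans_lt ((hlt 0).trans_le (ht' 0))
  have hne : lift p S ≠ lift p T := lift_ne hlt' hST
  have harc : ∀ n, (⟨lift p (s n), lift p (t n), (h n).1⟩ : GoodInterval).arc
      = lift p '' Ioo (s n) (t n) := fun n =>
    arc_lift (hlt n) (by linarith [hs' n, ht' n]) _
  refine ⟨hne, hL.closed (fun n => ⟨lift p (s n), lift p (t n), (h n).1⟩) _ (fun n => (h n).2)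
    ?_ ?_⟩
  · intro m n hmn
    simp only [harc]
    exact image_mono (Ioo_subset_Ioo (hs hmn) (ht hmn))
  · simp only [harc]
    rw [arc_lift hlt' hST, ← image_iUnion]
    congr 1
    ext u
    simp only [mem_Ioo, mem_iUnion]
    constructor
    · rintro ⟨h1, h2⟩
      obtain ⟨n, hn, hn'⟩ := ((hS.eventually (gt_mem_nhds h1)).and
        (hT.eventually (lt_mem_nhds h2))).exists
      exact ⟨n, hn, hn'⟩
    · rintro ⟨n, h1, h2⟩
      exact ⟨(hs' n).trans_lt h1, h2.trans_le (ht' n)⟩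

end Lamination

/-! ### Gaps cut out by a selection of intervals -/

/-- An increasing union of arcs that misses two points is an arc. -/
theorem exists_arc_eq_iUnion {K : ℕ → GoodInterval} (hK : Monotone fun n => (K n).arc)
    {u v : Circle} (huv : u ≠ v) (hu : ∀ n, u ∉ (K n).arc) (hv : ∀ n, v ∉ (K n).arc) :
    ∃ J : GoodInterval, J.arc = ⋃ n, (K n).arc := by
  set U : Set Circle := ⋃ n, (K n).arc with hU
  have conv : ∀ x ∈ U, ∀ y ∈ U, ∀ z, pos u x < pos u z → pos u z < pos u y → z ∈ U := by
    intro x hx y hy z hxz hzy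
    obtain ⟨m, hm⟩ := mem_iUnion.1 hx
    obtain ⟨n, hn⟩ := mem_iUnion.1 hy
    have hx' := hK (le_max_left m n) hm
    have hy' := hK (le_max_right m n) hn
    refine mem_iUnion.2 ⟨max m n, ?_⟩
    have hu' := hu (max m n)
    simp only [GoodInterval.mem_arc, ccw_iff u, pos_self] at hx' hy' hu' ⊢
    have h0 := pos_nonneg u (K (max m n)).left
    have h1 := pos_nonneg u (K (max m n)).right
    have h2 := pos_nonneg u x
    have h3 : 0 < pos u (K (max m n)).right ∨ pos u (K (max m n)).right = 0 := by
      rcases h1.lt_or_eq with h | h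
      · exact Or.inl h
      · exact Or.inr h.symm
    grind
  have lower : ∀ z ∈ U, ∃ x ∈ U, pos u x < pos u z := by
    intro z hz
    obtain ⟨m, hm⟩ := mem_iUnion.1 hz
    obtain ⟨w, hw⟩ := exists_ccw (a := (K m).left) (b := z) (by rintro rfl; exact (K m).left_notMem hm)
    have hu' := hu m
    have hw0 := pos_nonneg u w
    have h0 := pos_nonneg u (K m).left
    have h1 := pos_nonneg u (K m).right
    have hz0 := pos_nonneg u z
    have hmem : w ∈ (K m).arc ∧ pos u w < pos u z := by
      simp only [GoodInterval.mem_arc, ccw_iff u, pos_self] at hm hw hu' ⊢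
      grind
    exact ⟨w, mem_iUnion.2 ⟨m, hmem.1⟩, hmem.2⟩
  have upper : ∀ z ∈ U, ∃ x ∈ U, pos u z < pos u x := by
    intro z hz
    obtain ⟨m, hm⟩ := mem_iUnion.1 hz
    obtain ⟨w, hw⟩ := exists_ccw (a := z) (b := (K m).right)
      (by rintro rfl; exact (K m).right_notMem hm)
    have hu' := hu m
    have hw0 := pos_nonneg u w
    have h0 := pos_nonneg u (K m).left
    have h1 := pos_nonneg u (K m).right
    have hz0 := pos_nonneg u z
    have hmem : w ∈ (K m).arc ∧ pos u z < pos u w := by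
      have hzu : z ≠ u := by rintro rfl; exact hu' hm
      have := pos_pos hzu
      simp only [GoodInterval.mem_arc, ccw_iff u, pos_self] at hm hw hu' ⊢
      grind
    exact ⟨w, mem_iUnion.2 ⟨m, hmem.1⟩, hmem.2⟩
  have hUne : (pos u '' U).Nonempty := by
    obtain ⟨z, hz⟩ := (K 0).nonempty_arc
    exact ⟨_, mem_image_of_mem _ (mem_iUnion.2 ⟨0, hz⟩)⟩
  have hbb : BddBelow (pos u '' U) := ⟨0, by rintro _ ⟨z, -, rfl⟩; exact pos_nonneg _ _⟩
  have hba : BddAbove (pos u '' U) := ⟨2 * Real.pi, by rintro _ ⟨z, -, rfl⟩; exact (pos_lt _ _).le⟩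
  set lo := sInf (pos u '' U)
  set hi := sSup (pos u '' U)
  have hlo : 0 ≤ lo := le_csInf hUne (by rintro _ ⟨z, -, rfl⟩; exact pos_nonneg _ _)
  have hhi : hi ≤ 2 * Real.pi := csSup_le hUne (by rintro _ ⟨z, -, rfl⟩; exact (pos_lt _ _).le)
  have hmem : ∀ z, z ∈ U ↔ lo < pos u z ∧ pos u z < hi := by
    intro z
    constructor
    · intro hz
      obtain ⟨x, hx, hxz⟩ := lower z hz
      obtain ⟨y, hy, hzy⟩ := upper z hz
      exact ⟨(csInf_le hbb (mem_image_of_mem _ hx)).trans_lt hxz,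
        hzy.trans_le (le_csSup hba (mem_image_of_mem _ hy))⟩
    · rintro ⟨h1, h2⟩
      obtain ⟨_, ⟨x, hx, rfl⟩, hxz⟩ := exists_lt_of_csInf_lt hUne h1
      obtain ⟨_, ⟨y, hy, rfl⟩, hzy⟩ := exists_lt_of_lt_csSup hUne h2
      exact conv x hx y hy z hxz hzy
  have hlohi : lo < hi := by
    obtain ⟨_, ⟨z, hz, rfl⟩⟩ := hUne
    exact ((hmem z).1 hz).1.trans ((hmem z).1 hz).2
  have hvU : v ∉ U := by
    intro h
    obtain ⟨m, hm⟩ := mem_iUnion.1 h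
    exact hv m hm
  have hlt : hi < lo + 2 * Real.pi := by
    have h1 := pos_pos huv.symm
    have h2 := pos_lt u v
    by_contra hcon
    exact hvU ((hmem v).2 ⟨by linarith, by linarith⟩)
  refine ⟨⟨lift u lo, lift u hi, lift_ne hlohi hlt⟩, ?_⟩
  rw [arc_lift hlohi hlt]
  ext z
  rw [hmem]
  constructor
  · rintro ⟨s, hs, rfl⟩
    rw [pos_lift (hlo.trans hs.1.le) (hs.2.trans_le hhi)]
    exact hs
  · exact fun h => ⟨pos u z, h, lift_pos _ _⟩

/-- A selection of one side of each leaf of `L` such that two selected intervals cover the circle up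
to endpoints only if they are opposite, stable under increasing unions, and such that the selected
intervals larger than a given one miss two common points. Its maximal elements form a gap. -/
structure IsSelection (L S : Set GoodInterval) : Prop where
  subset : S ⊆ L
  half : ∀ I ∈ L, I ∈ S ∨ I.opp ∈ S
  noncover : ∀ I ∈ S, ∀ J ∈ S, I.opp.arc ⊆ J.arc → J = I.opp
  closed : ∀ (I : ℕ → GoodInterval) (J : GoodInterval), (∀ k, I k ∈ S) → J ∈ L →
    Monotone (fun k => (I k).arc) → J.arc = ⋃ k, (I k).arc → J ∈ S
  bounded : ∀ I ∈ S, ∃ u v, u ≠ v ∧ ∀ J ∈ S, I.arc ⊆ J.arc → u ∉ J.arc ∧ v ∉ J.arc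

/-- The elements of `S` with inclusion-maximal arc. -/
def maximalIntervals (S : Set GoodInterval) : Set GoodInterval :=
  {I | I ∈ S ∧ ∀ J ∈ S, I.arc ⊆ J.arc → J = I}

section Selection

variable {L S : Set GoodInterval} (hL : IsLaminationSystem L) (hS : IsSelection L S)

include hL hS

theorem IsSelection.chain {I J J' : GoodInterval} (hJ : J ∈ S) (hJ' : J' ∈ S)
    (h : I.arc ⊆ J.arc) (h' : I.arc ⊆ J'.arc) : J.arc ⊆ J'.arc ∨ J'.arc ⊆ J.arc := by
  rcases hL.trichotomy (hS.subset hJ) (hS.subset hJ') with h1 | h1 | h1 | h1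
  · exact Or.inl h1
  · exact Or.inr h1
  · obtain ⟨z, hz⟩ := I.nonempty_arc
    exact absurd (h' hz) (Set.disjoint_left.1 h1 (h hz))
  · obtain ⟨z, hz⟩ := I.nonempty_arc
    have h2 := hS.noncover _ hJ _ hJ' h1
    exact absurd (h2 ▸ h' hz) (Set.disjoint_left.1 J.disjoint_opp (h hz))

/-- By second countability the union of the chain of selected intervals above `I` is the union of an
ascending sequence. -/
theorem IsSelection.exists_maximal {I : GoodInterval} (hI : I ∈ S) :
    ∃ J ∈ maximalIntervals S, I.arc ⊆ J.arc := by
  classical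
  obtain ⟨T, hT, hTc, hTU⟩ := TopologicalSpace.isOpen_biUnion_countable
    {J | J ∈ S ∧ I.arc ⊆ J.arc} GoodInterval.arc (fun J _ => J.isOpen_arc)
  have hTne : T.Nonempty := by
    rcases T.eq_empty_or_nonempty with h | h
    · exfalso
      rw [h] at hTU
      obtain ⟨z, hz⟩ := I.nonempty_arc
      have : z ∈ ⋃ J ∈ {J | J ∈ S ∧ I.arc ⊆ J.arc}, J.arc :=
        mem_biUnion (x := I) ⟨hI, subset_rfl⟩ hz
      rw [← hTU] at this
      simp at this
    · exact h
  obtain ⟨e, rfl⟩ := hTc.exists_eq_range hTne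
  have he : ∀ n, e n ∈ S ∧ I.arc ⊆ (e n).arc := fun n => hT (mem_range_self n)
  let K : ℕ → GoodInterval := fun n => Nat.rec (e 0)
    (fun n K => if K.arc ⊆ (e (n + 1)).arc then e (n + 1) else K) n
  have hK0 : K 0 = e 0 := rfl
  have hKs : ∀ n, K (n + 1) = if (K n).arc ⊆ (e (n + 1)).arc then e (n + 1) else K n := fun n => rfl
  have hK : ∀ n, K n ∈ S ∧ I.arc ⊆ (K n).arc := by
    intro n
    induction n with
    | zero => rw [hK0]; exact he 0
    | succ n ih => rw [hKs]; split_ifs; exacts [he _, ih]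
  have hmono : Monotone fun n => (K n).arc := by
    refine monotone_nat_of_le_succ fun n => ?_
    rw [hKs]
    split_ifs with h
    · exact h
    · exact subset_rfl
  have heK : ∀ n, (e n).arc ⊆ (K n).arc := by
    intro n
    cases n with
    | zero => rw [hK0]
    | succ n =>
      rw [hKs]
      split_ifs with h
      · exact subset_rfl
      · exact (hS.chain hL (hK n).1 (he (n + 1)).1 (hK n).2 (he (n + 1)).2).resolve_left h
  obtain ⟨u, v, huv, hb⟩ := hS.bounded I hI
  obtain ⟨J, hJ⟩ := exists_arc_eq_iUnion hmono huv (fun n => (hb _ (hK n).1 (hK n).2).1)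
    (fun n => (hb _ (hK n).1 (hK n).2).2)
  have hJL : J ∈ L := hL.closed K J (fun n => hS.subset (hK n).1) hmono hJ
  have hJS : J ∈ S := hS.closed K J (fun n => (hK n).1) hJL hmono hJ
  have hIJ : I.arc ⊆ J.arc := (hK 0).2.trans (hJ ▸ subset_iUnion (fun n => (K n).arc) 0)
  refine ⟨J, ⟨hJS, fun J' hJ' h => ?_⟩, hIJ⟩
  refine GoodInterval.eq_of_arc_eq (subset_antisymm ?_ h)
  intro z hz
  have : z ∈ ⋃ J ∈ {J | J ∈ S ∧ I.arc ⊆ J.arc}, J.arc :=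
    mem_biUnion (x := J') ⟨hJ', hIJ.trans h⟩ hz
  rw [← hTU] at this
  simp only [mem_range, iUnion_exists, iUnion_iUnion_eq', mem_iUnion] at this
  obtain ⟨n, hn⟩ := this
  rw [hJ]
  exact mem_iUnion.2 ⟨n, heK n hn⟩

theorem IsSelection.isGap : IsGap L (maximalIntervals S) where
  subset := fun I hI => hS.subset hI.1
  disjoint := by
    intro I hI J hJ hne
    rcases hL.trichotomy (hS.subset hI.1) (hS.subset hJ.1) with h1 | h1 | h1 | h1
    · exact absurd (hI.2 J hJ.1 h1).symm hne
    · exact absurd (hJ.2 I hI.1 h1) hne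
    · exact h1
    · rw [hS.noncover _ hI.1 _ hJ.1 h1]; exact I.disjoint_opp
  lies := by
    intro I hI
    rcases hS.half I hI with h | h
    · obtain ⟨J, hJ, hJ'⟩ := hS.exists_maximal hL h
      exact ⟨J, hJ, Or.inl hJ'⟩
    · obtain ⟨J, hJ, hJ'⟩ := hS.exists_maximal hL h
      exact ⟨J, hJ, Or.inr hJ'⟩

end Selection

theorem preserves_maximalIntervals {S : Set GoodInterval} {k : Circle ≃ₜ Circle}
    (hk : OrientationPreserving k) (h : Preserves k S) : Preserves k (maximalIntervals S) := by
  rw [preserves_iff]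
  intro I
  constructor
  · rintro ⟨h1, h2⟩
    refine ⟨h.mem_iff.1 h1, fun J hJ hIJ => ?_⟩
    exact GoodInterval.map_inj.1 (h2 _ (h.mem_iff.2 hJ) ((GoodInterval.map_arc_subset hk).2 hIJ))
  · rintro ⟨h1, h2⟩
    refine ⟨h.mem_iff.2 h1, fun J hJ hIJ => ?_⟩
    rw [← GoodInterval.map_map_inv (k := k) J] at hJ hIJ ⊢
    rw [h2 _ (h.mem_iff.1 hJ) ((GoodInterval.map_arc_subset hk).1 hIJ)]

/-! ### Vertices and sides of gaps -/

theorem mem_vertexSet {Q : Set GoodInterval} {z : Circle} :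
    z ∈ vertexSet Q ↔ ∀ I ∈ Q, z ∉ I.arc := by
  simp [vertexSet]

theorem isClosed_vertexSet (Q : Set GoodInterval) : IsClosed (vertexSet Q) := by
  rw [vertexSet, isClosed_compl_iff]
  exact isOpen_biUnion fun I _ => I.isOpen_arc

theorem Preserves.apply_mem_vertexSet {k : Circle ≃ₜ Circle} (hk : OrientationPreserving k)
    {Q : Set GoodInterval} (h : Preserves k Q) {z : Circle} :
    k z ∈ vertexSet Q ↔ z ∈ vertexSet Q := by
  rw [mem_vertexSet, mem_vertexSet]
  constructor
  · intro hz I hI hzI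
    exact hz _ (h.mem_iff.2 hI) ((GoodInterval.mem_map_arc hk).2 hzI)
  · intro hz I hI hzI
    rw [← GoodInterval.map_map_inv (k := k) I] at hI hzI
    exact hz _ (h.mem_iff.1 hI) ((GoodInterval.mem_map_arc hk).1 hzI)

theorem isGap_leaf {L : Set GoodInterval} (hL : IsLaminationSystem L) {I : GoodInterval}
    (hI : I ∈ L) : IsGap L (leaf I) where
  subset := by
    rintro J (rfl | rfl)
    · exact hI
    · exact hL.opp_mem _ hI
  disjoint := by
    rintro J (rfl | rfl) K (rfl | rfl) hne
    · exact absurd rfl hne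
    · exact J.disjoint_opp
    · exact K.disjoint_opp.symm
    · exact absurd rfl hne
  lies := by
    intro J hJ
    rcases hL.unlinked J hJ I hI with h | h
    · exact ⟨I, Or.inl rfl, h⟩
    · exact ⟨I.opp, Or.inr rfl, h⟩

section Gap

variable {L Q : Set GoodInterval}

theorem IsGap.eq_of_mem (hQ : IsGap L Q) {I J : GoodInterval} (hI : I ∈ Q) (hJ : J ∈ Q)
    {z : Circle} (hz : z ∈ I.arc) (hz' : z ∈ J.arc) : I = J := by
  by_contra h
  exact Set.disjoint_left.1 (hQ.disjoint I hI J hJ h) hz hz'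

theorem IsGap.left_mem (hQ : IsGap L Q) {I : GoodInterval} (hI : I ∈ Q) :
    I.left ∈ vertexSet Q := by
  rw [mem_vertexSet]
  intro J hJ h
  by_cases e : J = I
  · subst e; exact J.left_notMem h
  · exact I.opp.right_notMem (GoodInterval.disjoint_iff_subset_opp.1 (hQ.disjoint J hJ I hI e) h)

theorem IsGap.right_mem (hQ : IsGap L Q) {I : GoodInterval} (hI : I ∈ Q) :
    I.right ∈ vertexSet Q := by
  rw [mem_vertexSet]
  intro J hJ h
  by_cases e : J = I
  · subst e; exact J.right_notMem h
  · exact I.opp.left_notMem (GoodInterval.disjoint_iff_subset_opp.1 (hQ.disjoint J hJ I hI e) h)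

theorem IsGap.eq_of_left_eq (hQ : IsGap L Q) {I J : GoodInterval} (hI : I ∈ Q) (hJ : J ∈ Q)
    (h : I.left = J.left) : I = J := by
  by_contra e
  exact GoodInterval.not_disjoint_of_left_eq h (hQ.disjoint I hI J hJ e)

theorem IsGap.eq_of_right_eq (hQ : IsGap L Q) {I J : GoodInterval} (hI : I ∈ Q) (hJ : J ∈ Q)
    (h : I.right = J.right) : I = J := by
  by_contra e
  exact GoodInterval.not_disjoint_of_right_eq h (hQ.disjoint I hI J hJ e)

theorem IsGap.nonempty (hL : IsLaminationSystem L) (hQ : IsGap L Q) : Q.Nonempty := by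
  obtain ⟨I, hI⟩ := hL.nonempty
  obtain ⟨J, hJ, -⟩ := hQ.lies I hI
  exact ⟨J, hJ⟩

/-- Two vertices with no vertex in between are joined by a side. -/
theorem IsGap.mem_of_no_vertex (hQ : IsGap L Q) {x y : Circle} (hx : x ∈ vertexSet Q)
    (hy : y ∈ vertexSet Q) (hne : x ≠ y) (h : ∀ z, CCW x z y → z ∉ vertexSet Q) :
    (⟨x, y, hne⟩ : GoodInterval) ∈ Q := by
  obtain ⟨z, hz⟩ := exists_ccw hne
  have hzv := h z hz
  rw [mem_vertexSet] at hzv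
  push Not at hzv
  obtain ⟨J, hJ, hzJ⟩ := hzv
  have h1 := mem_vertexSet.1 hx J hJ
  have h2 := mem_vertexSet.1 hy J hJ
  have h3 : ¬ CCW x J.left y := fun e => h _ e (hQ.left_mem hJ)
  have h4 : ¬ CCW x J.right y := fun e => h _ e (hQ.right_mem hJ)
  rw [GoodInterval.mem_arc] at hzJ h1 h2
  simp only [ccw_iff x, pos_self] at hz hzJ h1 h2 h3 h4
  have g1 := pos_nonneg x J.left
  have g2 := pos_nonneg x J.right
  have g3 := pos_pos hne.symm
  have g4 := pos_nonneg x z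
  have e1 : pos x J.left = 0 := by grind
  have e2 : pos x J.right = pos x y := by grind
  have e3 : J.left = x := by rw [← pos_inj (p := x), pos_self, e1]
  have e4 : J.right = y := pos_inj.1 e2
  have : J = ⟨x, y, hne⟩ := GoodInterval.ext e3 e4
  exact this ▸ hJ

/-- In a finite set, the closest point counter-clockwise from `x`. -/
theorem exists_next {V : Set Circle} (hV : V.Finite) {x y : Circle} (hy : y ∈ V) (hne : y ≠ x) :
    ∃ z ∈ V, z ≠ x ∧ ∀ w ∈ V, ¬ CCW x w z := by
  obtain ⟨z, ⟨hz, hzx⟩, hmin⟩ := Set.exists_min_image (V \ {x}) (pos x) hV.sdiff ⟨y, hy, hne⟩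
  refine ⟨z, hz, hzx, fun w hw h => ?_⟩
  have := hmin w ⟨hw, h.ne.1.symm⟩
  rw [ccw_base] at h
  linarith [h.2]

/-- In a finite set, the closest point clockwise from `x`. -/
theorem exists_prev {V : Set Circle} (hV : V.Finite) {x y : Circle} (hy : y ∈ V) (hne : y ≠ x) :
    ∃ z ∈ V, z ≠ x ∧ ∀ w ∈ V, ¬ CCW z w x := by
  obtain ⟨z, ⟨hz, hzx⟩, hmax⟩ := Set.exists_max_image (V \ {x}) (pos x) hV.sdiff ⟨y, hy, hne⟩
  refine ⟨z, hz, hzx, fun w hw h => ?_⟩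
  have := hmax w ⟨hw, h.ne.2.1⟩
  replace h := h.rotate.rotate
  rw [ccw_base] at h
  linarith [h.2]

/-- In a quite full lamination system each vertex of a gap, with at most one exception, is an
endpoint of sides of the gap on both sides. -/
theorem QuiteFull.exists_sides (hL : IsLaminationSystem L) (hq : QuiteFull L) (hQ : IsGap L Q) :
    ∃ P : Set Circle, P.Subsingleton ∧ ∀ x ∈ vertexSet Q, x ∉ P →
      (∃ I ∈ Q, I.left = x) ∧ ∃ I ∈ Q, I.right = x := by
  rcases hq Q hQ with ⟨-, hfin⟩ | ⟨-, t, p, ht, hp, hQt, hv⟩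
  · refine ⟨∅, subsingleton_empty, fun x hx _ => ?_⟩
    obtain ⟨y, hy, hyx⟩ : ∃ y ∈ vertexSet Q, y ≠ x := by
      obtain ⟨I, hI⟩ := hQ.nonempty hL
      by_cases e : I.left = x
      · exact ⟨I.right, hQ.right_mem hI, fun e' => I.ne (e.trans e'.symm)⟩
      · exact ⟨I.left, hQ.left_mem hI, e⟩
    constructor
    · obtain ⟨z, hz, hzx, hno⟩ := exists_next hfin hy hyx
      exact ⟨_, hQ.mem_of_no_vertex hx hz hzx.symm fun w hw hwv => hno w hwv hw, rfl⟩
    · obtain ⟨z, hz, hzx, hno⟩ := exists_prev hfin hy hyx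
      exact ⟨_, hQ.mem_of_no_vertex hz hx hzx fun w hw hwv => hno w hwv hw, rfl⟩
  · refine ⟨{p}, subsingleton_singleton, fun x hx hxp => ?_⟩
    rw [hv] at hx
    rcases hx with ⟨k, rfl⟩ | hx
    · refine ⟨⟨⟨t k, t (k + 1), ht k⟩, by rw [hQt]; exact ⟨k, rfl⟩, rfl⟩,
        ⟨⟨t (k - 1), t (k - 1 + 1), ht (k - 1)⟩, by rw [hQt]; exact ⟨k - 1, rfl⟩, ?_⟩⟩
      change t (k - 1 + 1) = t k
      rw [sub_add_cancel]
    · exact absurd hx hxp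

theorem QuiteFull.countable_vertexSet (hq : QuiteFull L) (hQ : IsGap L Q) :
    (vertexSet Q).Countable := by
  rcases hq Q hQ with ⟨-, hfin⟩ | ⟨-, t, p, ht, hp, hQt, hv⟩
  · exact hfin.countable
  · rw [hv]
    exact (countable_range t).union (countable_singleton p)

/-- A vertex that is a limit of vertices from the clockwise side is not a right endpoint. -/
theorem no_limit_left {p : Circle} {u : ℕ → ℝ} {s : ℝ}
    (hu : Tendsto u atTop (𝓝 s)) (hlt : ∀ n, u n < s) (hv : ∀ n, lift p (u n) ∈ vertexSet Q)
    {I : GoodInterval} (hI : I ∈ Q) (h : I.right = lift p s) : False := by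
  obtain ⟨d, hd, -, -, harc⟩ := arc_of_right_eq h
  obtain ⟨n, hn⟩ := (hu.eventually (lt_mem_nhds (show s - d < s by linarith))).exists
  exact mem_vertexSet.1 (hv n) I hI (harc ▸ ⟨u n, ⟨hn, hlt n⟩, rfl⟩)

/-- A vertex that is a limit of vertices from the counter-clockwise side is not a left endpoint. -/
theorem no_limit_right {p : Circle} {u : ℕ → ℝ} {s : ℝ}
    (hu : Tendsto u atTop (𝓝 s)) (hlt : ∀ n, s < u n) (hv : ∀ n, lift p (u n) ∈ vertexSet Q)
    {I : GoodInterval} (hI : I ∈ Q) (h : I.left = lift p s) : False := by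
  obtain ⟨d, hd, -, -, harc⟩ := arc_of_left_eq h
  obtain ⟨n, hn⟩ := (hu.eventually (gt_mem_nhds (show s < s + d by linarith))).exists
  exact mem_vertexSet.1 (hv n) I hI (harc ▸ ⟨u n, ⟨hlt n, hn⟩, rfl⟩)

/-- If a gap of a quite full system is preserved and two of its vertices are fixed, then all of its
vertices are fixed: a moved vertex would have an orbit accumulating at two vertices. -/
theorem IsGap.vertex_fixed (hL : IsLaminationSystem L) (hq : QuiteFull L) (hQ : IsGap L Q)
    {k : Circle ≃ₜ Circle} (hk : OrientationPreserving k) (hkQ : Preserves k Q) {a b x : Circle}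
    (hab : a ≠ b) (ha : k a = a) (hb : k b = b) (hx : x ∈ vertexSet Q) : k x = x := by
  obtain ⟨P, hP, hsides⟩ := hq.exists_sides hL hQ
  have main : ∀ k : Circle ≃ₜ Circle, OrientationPreserving k → Preserves k Q → k a = a →
      k b = b → ¬ pos a x < pos a (k x) := by
    intro k hk hkQ ha hb hlt
    have ha' : k⁻¹ a = a := by rw [inv_apply_eq, ha]
    obtain ⟨s, hs, hsm, hslt, hst, hsf⟩ := orbit_up hk ha hlt
    obtain ⟨s', hs', hsm', hslt', hst', hsf'⟩ := orbit_down hk.inv ha' ((pos_inv_lt hk ha).2 hlt)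
    have hv : ∀ n : ℕ, (k ^ n) x ∈ vertexSet Q := fun n =>
      ((hkQ.pow n).apply_mem_vertexSet (hk.pow n)).2 hx
    have hv' : ∀ n : ℕ, (k⁻¹ ^ n) x ∈ vertexSet Q := fun n =>
      ((hkQ.inv.pow n).apply_mem_vertexSet (hk.inv.pow n)).2 hx
    have hlim : lift a s ∈ vertexSet Q := by
      refine (isClosed_vertexSet Q).mem_of_tendsto (((continuous_lift a).tendsto s).comp hst)
        (Eventually.of_forall fun n => ?_)
      rw [Function.comp, lift_pos]
      exact hv n
    have hlim' : lift a s' ∈ vertexSet Q := by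
      refine (isClosed_vertexSet Q).mem_of_tendsto (((continuous_lift a).tendsto s').comp hst')
        (Eventually.of_forall fun n => ?_)
      rw [Function.comp, lift_pos]
      exact hv' n
    have hPs : lift a s ∈ P := by
      by_contra hn
      obtain ⟨-, I, hI, hIr⟩ := hsides _ hlim hn
      exact no_limit_left hst hslt (fun n => by rw [lift_pos]; exact hv n) hI hIr
    have hPs' : lift a s' ∈ P := by
      by_contra hn
      obtain ⟨⟨I, hI, hIl⟩, -⟩ := hsides _ hlim' hn
      exact no_limit_right hst' hslt' (fun n => by rw [lift_pos]; exact hv' n) hI hIl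
    have heq := hP hPs' hPs
    have h0 : s' < pos a x := hslt' 0
    have h1 : pos a x < s := hslt 0
    -- the limits can only be equal if both are the base point `a`
    have hbs : pos a b ≤ s' ∨ s ≤ pos a b := by
      rcases lt_trichotomy (pos a b) (pos a x) with h | h | h
      · left
        refine ge_of_tendsto hst' (Eventually.of_forall fun n => ?_)
        have hb' : (k⁻¹ ^ n) b = b := pow_fix (by rw [inv_apply_eq, hb]) n
        rw [← hb']
        exact ((pos_map_lt (hk.inv.pow n) (pow_fix ha' n)).2 h).le
      · exfalso
        rw [← pos_inj.1 h, hb] at hlt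
        exact lt_irrefl _ hlt
      · right
        refine le_of_tendsto hst (Eventually.of_forall fun n => ?_)
        have hb' : (k ^ n) b = b := pow_fix hb n
        rw [← hb']
        exact ((pos_map_lt (hk.pow n) (pow_fix ha n)).2 h).le
    have hb0 := pos_pos hab.symm
    have hb1 := pos_lt a b
    refine lift_ne (p := a) (s := s') (t := s) (by linarith) ?_ heq
    rcases hbs with h | h <;> linarith
  rcases lt_trichotomy (pos a x) (pos a (k x)) with h | h | h
  · exact absurd h (main k hk hkQ ha hb)
  · exact (pos_inj.1 h).symm
  · exact absurd ((lt_pos_inv hk ha).2 h)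
      (main k⁻¹ hk.inv hkQ.inv (by rw [inv_apply_eq, ha]) (by rw [inv_apply_eq, hb]))

end Gap

/-! ### Density of endpoints and leaves at a common endpoint -/

theorem GoodInterval.exists_two (A : GoodInterval) :
    ∃ u v, u ≠ v ∧ u ∈ A.arc ∧ v ∈ A.arc := by
  obtain ⟨z, hz⟩ := A.nonempty_arc
  obtain ⟨w, hw⟩ := exists_ccw hz.ne.1
  refine ⟨z, w, hw.ne.2.1.symm, hz, ?_⟩
  rw [GoodInterval.mem_arc, ccw_base] at *
  exact ⟨hw.1, hw.2.trans hz.2⟩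

theorem GoodInterval.subset_or_of_notMem {A I : GoodInterval} (h1 : I.left ∉ A.arc)
    (h2 : I.right ∉ A.arc) : A.arc ⊆ I.arc ∨ A.arc ⊆ I.opp.arc := by
  by_contra hcon
  rw [not_or, Set.not_subset, Set.not_subset] at hcon
  obtain ⟨⟨z, hz, hz'⟩, ⟨w, hw, hw'⟩⟩ := hcon
  have hz2 : z ∈ I.opp.arc := by
    rcases GoodInterval.notMem_arc_iff.1 hz' with h | h | h
    · exact h
    · exact absurd (h ▸ hz) h1
    · exact absurd (h ▸ hz) h2
  have hw2 : w ∈ I.arc := by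
    rcases GoodInterval.notMem_arc_iff.1 hw' with h | h | h
    · exact h
    · change w = I.right at h
      exact absurd (h ▸ hw) h2
    · change w = I.left at h
      exact absurd (h ▸ hw) h1
  simp only [GoodInterval.mem_arc, GoodInterval.opp, ccw_iff A.left, pos_self] at h1 h2 hz hw hz2 hw2
  have := pos_nonneg A.left I.left
  have := pos_nonneg A.left I.right
  have := pos_nonneg A.left A.right
  have := pos_nonneg A.left z
  have := pos_nonneg A.left w
  grind

/-- The selection of all intervals that avoid a set `P` of at least two points. -/
theorem isSelection_avoiding {L : Set GoodInterval} {P : Set Circle} {u v : Circle} (huv : u ≠ v)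
    (hu : u ∈ P) (hv : v ∈ P) (half : ∀ I ∈ L, Disjoint I.arc P ∨ Disjoint I.opp.arc P)
    (hopp : ∀ I ∈ L, I.opp ∈ L) : IsSelection L {I | I ∈ L ∧ Disjoint I.arc P} where
  subset := fun I h => h.1
  half := fun I hI => (half I hI).imp (fun h => ⟨hI, h⟩) (fun h => ⟨hopp I hI, h⟩)
  noncover := by
    rintro I ⟨-, hI⟩ J ⟨-, hJ⟩ h
    have key : ∀ w ∈ P, w = I.left ∨ w = I.right := by
      intro w hw
      have h1 : w ∉ I.arc := fun e => Set.disjoint_left.1 hI e hw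
      have h2 : w ∉ I.opp.arc := fun e => Set.disjoint_left.1 hJ (h e) hw
      rcases I.mem_or w with h | h | h
      · exact absurd h h1
      · exact absurd h h2
      · exact h
    have hl : I.left ∈ P ∧ I.right ∈ P := by
      rcases key u hu with h1 | h1 <;> rcases key v hv with h2 | h2
      · exact absurd (h1.trans h2.symm) huv
      · exact ⟨h1 ▸ hu, h2 ▸ hv⟩
      · exact ⟨h2 ▸ hv, h1 ▸ hu⟩
      · exact absurd (h1.trans h2.symm) huv
    refine GoodInterval.eq_of_arc_eq (subset_antisymm ?_ h)
    rcases GoodInterval.subset_or_of_notMem (A := J) (I := I)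
      (fun e => Set.disjoint_left.1 hJ e hl.1) (fun e => Set.disjoint_left.1 hJ e hl.2) with h1 | h1
    · obtain ⟨z, hz⟩ := I.opp.nonempty_arc
      exact absurd hz (Set.disjoint_left.1 I.disjoint_opp (h1 (h hz)))
    · exact h1
  closed := by
    intro I J hI hJL hm hJ
    refine ⟨hJL, ?_⟩
    rw [hJ, Set.disjoint_iUnion_left]
    exact fun n => (hI n).2
  bounded := fun I _ => ⟨u, v, huv, fun J hJ _ =>
    ⟨fun e => Set.disjoint_left.1 hJ.2 e hu, fun e => Set.disjoint_left.1 hJ.2 e hv⟩⟩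

theorem subset_vertexSet_avoiding {L : Set GoodInterval} {P : Set Circle} :
    P ⊆ vertexSet (maximalIntervals {I | I ∈ L ∧ Disjoint I.arc P}) := by
  intro z hz
  rw [mem_vertexSet]
  exact fun I hI e => Set.disjoint_left.1 hI.1.2 e hz

/-- The endpoints of a quite full lamination system are dense: otherwise the intervals avoiding an
arc select a gap with uncountably many vertices. -/
theorem QuiteFull.exists_endpoint {L : Set GoodInterval} (hL : IsLaminationSystem L)
    (hq : QuiteFull L) (A : GoodInterval) : ∃ x ∈ A.arc, ∃ y, Lf L x y := by
  by_contra hcon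
  push Not at hcon
  obtain ⟨u, v, huv, hu, hv⟩ := A.exists_two
  have hS := isSelection_avoiding (L := L) huv hu hv (fun I hI => by
    rcases GoodInterval.subset_or_of_notMem (A := A) (I := I)
      (fun e => hcon _ e _ (Lf.of_mem hI)) (fun e => hcon _ e _ ((Lf.of_mem hI).symm hL)) with h | h
    · exact Or.inr (I.disjoint_opp.symm.mono_right h)
    · exact Or.inl (I.disjoint_opp.mono_right h)) hL.opp_mem
  exact A.not_countable_arc ((hq.countable_vertexSet (hS.isGap hL)).mono subset_vertexSet_avoiding)

/-- A quite full and loose lamination system whose endpoint set has dense complement. -/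
structure IsTame (L : Set GoodInterval) : Prop where
  lam : IsLaminationSystem L
  full : QuiteFull L
  loose : Loose L
  thin : ∀ A : GoodInterval, ∃ x ∈ A.arc, ∀ y, ¬ Lf L x y

theorem IsPseudoFibered.disjoint_endpoints {L₁ L₂ : Set GoodInterval} (h : IsPseudoFibered L₁ L₂)
    {x y z : Circle} (h1 : Lf L₁ x y) (h2 : Lf L₂ x z) : False := by
  have : x ∈ endpointSet L₁ ∩ endpointSet L₂ :=
    ⟨(mem_endpointSet h.lamination_left).2 ⟨y, h1⟩, (mem_endpointSet h.lamination_right).2 ⟨z, h2⟩⟩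
  rw [h.stronglyTransverse] at this
  exact this

theorem IsPseudoFibered.symm {L₁ L₂ : Set GoodInterval} (h : IsPseudoFibered L₁ L₂) :
    IsPseudoFibered L₂ L₁ :=
  ⟨h.lamination_right, h.lamination_left, h.quiteFull_right, h.quiteFull_left, h.loose_right,
    h.loose_left, by rw [inter_comm]; exact h.stronglyTransverse⟩

/-- The endpoints of the other lamination system are dense and are not endpoints of this one. -/
theorem IsPseudoFibered.isTame_left {L₁ L₂ : Set GoodInterval} (h : IsPseudoFibered L₁ L₂) :
    IsTame L₁ := by
  refine ⟨h.lamination_left, h.quiteFull_left, h.loose_left, fun A => ?_⟩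
  obtain ⟨x, hx, z, hz⟩ := h.quiteFull_right.exists_endpoint h.lamination_right A
  exact ⟨x, hx, fun y hy => h.disjoint_endpoints hy hz⟩

theorem IsPseudoFibered.isTame_right {L₁ L₂ : Set GoodInterval} (h : IsPseudoFibered L₁ L₂) :
    IsTame L₂ := h.symm.isTame_left

section Fan

variable {L : Set GoodInterval}

/-- Two consecutive leaves at `x` are sides of a common gap that is not a leaf. -/
theorem IsLaminationSystem.exists_gap_of_adjacent (hL : IsLaminationSystem L) {x a b : Circle}
    (ha : Lf L x a) (hb : Lf L x b) (hab : CCW x a b) (hno : ∀ c, CCW a c b → ¬ Lf L x c) :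
    ∃ Q, IsNonLeafGap L Q ∧ x ∈ vertexSet Q ∧ (⟨x, a, ha.1⟩ : GoodInterval) ∈ Q ∧
      (⟨b, x, hb.1.symm⟩ : GoodInterval) ∈ Q := by
  have hxa := ha.1
  have hxb := hb.1
  have hba := hab.ne.2.1
  set A : GoodInterval := ⟨x, a, hxa⟩ with hA
  set B : GoodInterval := ⟨b, x, hxb.symm⟩ with hB
  set P : Set Circle := {x, a, b} with hP
  have ha0 := pos_pos hxa.symm
  have hb0 := pos_pos hxb.symm
  have hab' := (ccw_base.1 hab).2
  have hBmem : B ∈ L := (hb.symm hL).2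
  have hAmem : A ∈ L := ha.2
  have half : ∀ I ∈ L, Disjoint I.arc P ∨ Disjoint I.opp.arc P := by
    intro I hI
    have n1 : ∀ y, (I.left = x ∧ I.right = y) ∨ (I.right = x ∧ I.left = y) → ¬ CCW a y b := by
      rintro y (⟨h, rfl⟩ | ⟨h, rfl⟩) h'
      · exact hno _ h' (h ▸ Lf.of_mem hI)
      · exact hno _ h' (h ▸ (Lf.of_mem hI).symm hL)
    have n2 : ¬ (CCW x I.left a ∧ CCW a I.right x) := fun h =>
      hL.not_linked (Lf.of_mem hI) ha h.1 h.2
    have n3 : ¬ (CCW x I.right a ∧ CCW a I.left x) := fun h =>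
      hL.not_linked ((Lf.of_mem hI).symm hL) ha h.1 h.2
    have n4 : ¬ (CCW x I.left b ∧ CCW b I.right x) := fun h =>
      hL.not_linked (Lf.of_mem hI) hb h.1 h.2
    have n5 : ¬ (CCW x I.right b ∧ CCW b I.left x) := fun h =>
      hL.not_linked ((Lf.of_mem hI).symm hL) hb h.1 h.2
    have n6 := n1 I.right
    have n7 := n1 I.left
    rw [← pos_inj (p := x)] at n6
    rw [← pos_inj (p := x) (x := I.right) (y := x)] at n7
    have hne : pos x I.left ≠ pos x I.right := fun h => I.ne (pos_injective _ h)
    have g1 := pos_nonneg x I.left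
    have g2 := pos_nonneg x I.right
    by_contra hcon
    rw [not_or, Set.not_disjoint_iff, Set.not_disjoint_iff] at hcon
    obtain ⟨⟨z, hz, hz'⟩, ⟨w, hw, hw'⟩⟩ := hcon
    simp only [GoodInterval.mem_arc, GoodInterval.opp] at hz hw
    simp only [ccw_iff x, pos_self] at hz hw n2 n3 n4 n5 n6 n7
    simp only [hP, mem_insert_iff, mem_singleton_iff] at hz' hw'
    rcases hz' with rfl | rfl | rfl <;> rcases hw' with rfl | rfl | rfl <;>
      (try simp only [pos_self] at *) <;> grind
  have hS := isSelection_avoiding (P := P) hxa (by simp [hP]) (by simp [hP]) half hL.opp_mem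
  set Q := maximalIntervals {I | I ∈ L ∧ Disjoint I.arc P} with hQ
  have hgap := hS.isGap hL
  have hPv : P ⊆ vertexSet Q := subset_vertexSet_avoiding
  have hAP : Disjoint A.arc P := by
    rw [Set.disjoint_right]
    rintro z (rfl | rfl | rfl) hz
    · exact A.left_notMem hz
    · exact A.right_notMem hz
    · rw [GoodInterval.mem_arc, ccw_base] at hz; simp only [hA] at hz; linarith [hz.2]
  have hBP : Disjoint B.arc P := by
    rw [Set.disjoint_right]
    rintro z (rfl | rfl | rfl) hz
    · exact B.right_notMem hz
    · rw [GoodInterval.mem_arc] at hz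
      simp only [hB, ccw_iff x, pos_self] at hz
      rcases hz with hz | hz | hz <;> linarith [hz.1, hz.2]
    · exact B.left_notMem hz
  have hmax : ∀ I : GoodInterval, I ∈ L → Disjoint I.arc P → I.left ∈ P → I.right ∈ P → I ∈ Q := by
    intro I hI hIP hl hr
    refine ⟨⟨hI, hIP⟩, fun J hJ hIJ => GoodInterval.eq_of_arc_eq (subset_antisymm ?_ hIJ)⟩
    rcases GoodInterval.subset_or_of_notMem (A := J) (I := I)
      (fun e => Set.disjoint_left.1 hJ.2 e hl) (fun e => Set.disjoint_left.1 hJ.2 e hr) with h | h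
    · exact h
    · obtain ⟨z, hz⟩ := I.nonempty_arc
      exact absurd (h (hIJ hz)) (Set.disjoint_left.1 I.disjoint_opp hz)
  have hAQ : A ∈ Q := hmax A hAmem hAP (by simp [hP, hA]) (by simp [hP, hA])
  have hBQ : B ∈ Q := hmax B hBmem hBP (by simp [hP, hB]) (by simp [hP, hB])
  refine ⟨Q, ⟨hgap, ?_⟩, hPv (by simp [hP]), hAQ, hBQ⟩
  rintro ⟨I, hI, h⟩
  have h1 : vertexSet Q = {I.left, I.right} := by rw [h, vertexSet_leaf]
  rw [h1] at hPv
  have hx : x = I.left ∨ x = I.right := hPv (by simp [hP])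
  have ha' : a = I.left ∨ a = I.right := hPv (by simp [hP])
  have hb' : b = I.left ∨ b = I.right := hPv (by simp [hP])
  grind

/-- No three leaves of a tame system share an endpoint: the set of leaves at `x` would have two
complementary intervals, hence `x` would be a vertex of two non-leaf gaps. -/
theorem IsTame.no_three (h : IsTame L) {x a b c : Circle} (ha : Lf L x a) (hb : Lf L x b)
    (hc : Lf L x c) (hab : CCW x a b) (hbc : CCW x b c) : False := by
  have hL := h.lam
  have adj : ∀ a b, Lf L x a → Lf L x b → CCW x a b → ∃ a' b', pos x a ≤ pos x a' ∧
      pos x b' ≤ pos x b ∧ Lf L x a' ∧ Lf L x b' ∧ CCW x a' b' ∧ ∀ c, CCW a' c b' → ¬ Lf L x c := by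
    intro a b ha hb hab
    obtain ⟨w, hw, hwL⟩ := h.thin ⟨a, b, hab.ne.2.1⟩
    rw [GoodInterval.mem_arc] at hw
    simp only [ccw_iff x] at hw
    rw [ccw_base] at hab
    have hw' : pos x a < pos x w ∧ pos x w < pos x b := by
      rcases hw with hw | hw | hw
      · exact hw
      · linarith [hw.1, hw.2]
      · linarith [hw.1, hw.2]
    have hwx : ¬ Lf L x w := fun e => hwL _ (e.symm hL)
    -- the last leaf before `w` and the first leaf after `w`
    set S : Set ℝ := {s | 0 ≤ s ∧ s ≤ pos x w ∧ Lf L x (lift x s)} with hS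
    set T : Set ℝ := {s | pos x w ≤ s ∧ s ≤ pos x b ∧ Lf L x (lift x s)} with hT
    have hwlt := pos_lt x w
    have hblt := pos_lt x b
    have haS : pos x a ∈ S := ⟨hab.1.le, hw'.1.le, by rwa [lift_pos]⟩
    have hbT : pos x b ∈ T := ⟨hw'.2.le, le_rfl, by rwa [lift_pos]⟩
    have hSb : BddAbove S := ⟨pos x w, fun s hs => hs.2.1⟩
    have hTb : BddBelow T := ⟨pos x w, fun s hs => hs.1⟩
    have h1 : pos x a ≤ sSup S := le_csSup hSb haS
    have h2 : sSup S ≤ pos x w := csSup_le ⟨_, haS⟩ fun s hs => hs.2.1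
    have h3 : sInf T ≤ pos x b := csInf_le hTb hbT
    have h4 : pos x w ≤ sInf T := le_csInf ⟨_, hbT⟩ fun s hs => hs.1
    have hlS : Lf L x (lift x (sSup S)) := by
      obtain ⟨u, hu, hu', huS⟩ := exists_seq_tendsto_sSup ⟨_, haS⟩ hSb
      have hpos : ∀ n, 0 < u n := fun n => by
        refine lt_of_le_of_ne (huS n).1 fun e => (huS n).2.2.1 ?_
        rw [← e, lift_zero]
      have := hL.lf_limit (p := x) (s := fun _ => 0) (t := u) (S := 0) (T := sSup S)
        antitone_const hu tendsto_const_nhds hu' hpos (by linarith)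
        (fun n => by rw [lift_zero]; exact (huS n).2.2)
      rwa [lift_zero] at this
    have hlT : Lf L x (lift x (sInf T)) := by
      obtain ⟨u, hu, hu', huT⟩ := exists_seq_tendsto_sInf ⟨_, hbT⟩ hTb
      have := hL.lf_limit (p := x) (s := u) (t := fun _ => 2 * Real.pi) (S := sInf T)
        (T := 2 * Real.pi) hu monotone_const hu' tendsto_const_nhds
        (fun n => by linarith [(huT n).2.1]) (by linarith)
        (fun n => by rw [lift_two_pi]; exact (huT n).2.2.symm hL)
      rw [lift_two_pi] at this
      exact this.symm hL
    have p1 : pos x (lift x (sSup S)) = sSup S := pos_lift (by linarith) (by linarith)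
    have p2 : pos x (lift x (sInf T)) = sInf T := pos_lift (by linarith) (by linarith)
    have h5 : sSup S ≠ pos x w := fun e => hwx (by rwa [e, lift_pos] at hlS)
    have h6 : sInf T ≠ pos x w := fun e => hwx (by rwa [e, lift_pos] at hlT)
    have h5' := lt_of_le_of_ne h2 h5
    have h6' := lt_of_le_of_ne h4 h6.symm
    refine ⟨lift x (sSup S), lift x (sInf T), by rwa [p1], by rwa [p2], hlS, hlT, ?_, ?_⟩
    · rw [ccw_base, p1, p2]; constructor <;> linarith
    · intro c hc hcL
      simp only [ccw_iff x, p1, p2] at hc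
      have hc' : sSup S < pos x c ∧ pos x c < sInf T := by
        rcases hc with hc | hc | hc
        · exact hc
        · linarith [hc.1, hc.2]
        · linarith [hc.1, hc.2]
      rcases le_total (pos x c) (pos x w) with hcw | hcw
      · have := le_csSup hSb (show pos x c ∈ S from ⟨pos_nonneg _ _, hcw, by rwa [lift_pos]⟩)
        linarith [hc'.1]
      · have := csInf_le hTb (show pos x c ∈ T from ⟨hcw, by linarith [hc'.2], by rwa [lift_pos]⟩)
        linarith [hc'.2]
  obtain ⟨a1, b1, ha1, hb1, hla1, hlb1, hab1, hno1⟩ := adj a b ha hb hab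
  obtain ⟨a2, b2, ha2, hb2, hla2, hlb2, hab2, hno2⟩ := adj b c hb hc hbc
  obtain ⟨Q1, hQ1, hx1, hA1, hB1⟩ := hL.exists_gap_of_adjacent hla1 hlb1 hab1 hno1
  obtain ⟨Q2, hQ2, hx2, hA2, hB2⟩ := hL.exists_gap_of_adjacent hla2 hlb2 hab2 hno2
  by_cases e : Q1 = Q2
  · subst e
    have := congrArg GoodInterval.right (hQ1.1.eq_of_left_eq hA1 hA2 rfl)
    simp only at this
    rw [this] at hab1
    rw [ccw_base] at hab1
    linarith [hab1.2]
  · exact Set.disjoint_left.1 (h.loose Q1 Q2 hQ1 hQ2 e) hx1 hx2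

/-- An automorphism that fixes one end of a leaf fixes the other end. -/
theorem IsTame.fixed_of_lf (h : IsTame L) {k : Circle ≃ₜ Circle} (hk : OrientationPreserving k)
    (hkL : Preserves k L) {x y : Circle} (hx : k x = x) (hxy : Lf L x y) : k y = y := by
  have main : ∀ k : Circle ≃ₜ Circle, OrientationPreserving k → Preserves k L → k x = x →
      ¬ pos x y < pos x (k y) := by
    intro k hk hkL hx hlt
    have h1 : Lf L x (k y) := by
      have := (Lf.map_iff hkL).2 hxy
      rwa [hx] at this
    have h2 : Lf L x (k (k y)) := by
      have := (Lf.map_iff hkL).2 h1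
      rwa [hx] at this
    have hy := pos_pos hxy.1.symm
    exact h.no_three hxy h1 h2 (ccw_base.2 ⟨hy, hlt⟩)
      (ccw_base.2 ⟨hy.trans hlt, (pos_map_lt hk hx).2 hlt⟩)
  rcases lt_trichotomy (pos x y) (pos x (k y)) with h | h | h
  · exact absurd h (main k hk hkL hx)
  · exact (pos_inj.1 h).symm
  · exact absurd ((lt_pos_inv hk hx).2 h) (main k⁻¹ hk.inv hkL.inv (by rw [inv_apply_eq, hx]))

end Fan

/-! ### Preserved gaps and nested intervals -/

section Tree

variable {L : Set GoodInterval} {k : Circle ≃ₜ Circle}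

/-- An automorphism of a lamination system preserves a gap, or strictly shrinks an interval. If it
does neither, the intervals disjoint from their images form a selection, hence a preserved gap. -/
theorem IsLaminationSystem.gap_or_nested (hL : IsLaminationSystem L) (hk : OrientationPreserving k)
    (hkL : Preserves k L) : (∃ Q, IsGap L Q ∧ Preserves k Q) ∨
      ∃ I ∈ L, (I.map k).arc ⊆ I.arc ∧ I.map k ≠ I := by
  by_contra hcon
  rw [not_or] at hcon
  obtain ⟨hgap, hnest⟩ := hcon
  have hfix : ∀ I ∈ L, I.map k ≠ I := by
    intro I hI h
    refine hgap ⟨leaf I, isGap_leaf hL hI, ?_⟩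
    unfold Preserves leaf
    rw [image_pair, h, GoodInterval.map_opp, h]
  set S : Set GoodInterval := {I | I ∈ L ∧ Disjoint I.arc (I.map k).arc} with hS
  have hsel : IsSelection L S := by
    refine ⟨fun I h => h.1, fun I hI => ?_, ?_, ?_, ?_⟩
    · rcases hL.trichotomy (hkL.mem_iff.2 hI) hI with h | h | h | h
      · exact absurd ⟨I, hI, h, hfix I hI⟩ hnest
      · refine absurd ⟨I.opp, hL.opp_mem I hI, ?_, hfix _ (hL.opp_mem I hI)⟩ hnest
        rw [GoodInterval.map_opp]
        exact GoodInterval.opp_subset_opp.2 h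
      · exact Or.inl ⟨hI, h.symm⟩
      · refine Or.inr ⟨hL.opp_mem I hI, ?_⟩
        rw [disjoint_comm, GoodInterval.disjoint_iff_subset_opp]
        exact h
    · rintro I ⟨hI, hId⟩ J ⟨hJ, hJd⟩ h
      have h1 : (I.map k).arc ⊆ J.arc :=
        (GoodInterval.disjoint_iff_subset_opp.1 hId.symm).trans h
      have h2 : Disjoint (I.map k).arc (J.map k).arc := hJd.mono_left h1
      rw [GoodInterval.disjoint_iff_subset_opp, ← GoodInterval.map_opp,
        GoodInterval.map_arc_subset hk, GoodInterval.subset_opp_comm] at h2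
      exact GoodInterval.eq_of_arc_eq (subset_antisymm h2 h)
    · intro I J hI hJ hm hU
      refine ⟨hJ, ?_⟩
      rw [Set.disjoint_left]
      intro z hz hz'
      rw [GoodInterval.arc_map hk] at hz'
      obtain ⟨w, hw, rfl⟩ := hz'
      rw [hU] at hz hw
      obtain ⟨m, hm'⟩ := mem_iUnion.1 hz
      obtain ⟨n, hn'⟩ := mem_iUnion.1 hw
      refine Set.disjoint_left.1 (hI (max m n)).2 (hm (le_max_left m n) hm') ?_
      exact (GoodInterval.mem_map_arc hk).2 (hm (le_max_right m n) hn')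
    · rintro I ⟨hI, hId⟩
      obtain ⟨u, v, huv, hu, hv⟩ := (I.map k).exists_two
      refine ⟨u, v, huv, fun J hJ hIJ => ?_⟩
      have := (GoodInterval.map_arc_subset hk).2 hIJ
      exact ⟨fun e => Set.disjoint_left.1 hJ.2 e (this hu),
        fun e => Set.disjoint_left.1 hJ.2 e (this hv)⟩
  refine hgap ⟨_, hsel.isGap hL, preserves_maximalIntervals hk (preserves_iff.2 fun I => ?_)⟩
  simp only [hS, mem_ofPred_eq, hkL.mem_iff]
  refine and_congr_right fun _ => ?_
  rw [GoodInterval.disjoint_iff_subset_opp, GoodInterval.disjoint_iff_subset_opp,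
    ← GoodInterval.map_opp, GoodInterval.map_arc_subset hk]

/-- An interval mapped into itself has a fixed point in its closure. -/
theorem exists_fixed_of_nested (hk : OrientationPreserving k) {I : GoodInterval}
    (h : (I.map k).arc ⊆ I.arc) : ∃ z, k z = z ∧ z ∉ I.opp.arc := by
  set a := I.left with ha
  set b := I.right with hb
  have hstep : ∀ n : ℕ, (I.map (k ^ (n + 1))).arc ⊆ (I.map (k ^ n)).arc := by
    intro n
    rw [pow_succ, GoodInterval.map_mul]
    exact (GoodInterval.map_arc_subset (hk.pow n)).2 h
  have hsub : ∀ n : ℕ, (I.map (k ^ n)).arc ⊆ I.arc := by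
    intro n
    induction n with
    | zero => exact subset_rfl
    | succ n ih => exact (hstep n).trans ih
  have h1 : ∀ n : ℕ, pos a ((k ^ n) a) < pos a ((k ^ n) b) ∧ pos a ((k ^ n) b) ≤ pos a b :=
    fun n => GoodInterval.arc_subset_iff.1 (hsub n)
  have hm : Monotone fun n : ℕ => pos a ((k ^ n) a) := by
    refine monotone_nat_of_le_succ fun n => ?_
    have h2 := GoodInterval.arc_subset_iff.1 (hstep n)
    simp only [GoodInterval.map, ← ha, ← hb] at h2
    by_cases e : (k ^ (n + 1)) a = (k ^ n) a
    · rw [e]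
    · have h3 : CCW ((k ^ n) a) ((k ^ (n + 1)) a) ((k ^ n) b) :=
        ccw_base.2 ⟨pos_pos e, by linarith [h2.1, h2.2]⟩
      rw [ccw_iff a] at h3
      have := (h1 n).1
      rcases h3 with h3 | h3 | h3 <;> linarith [h3.1, h3.2]
  have hbd : BddAbove (range fun n : ℕ => pos a ((k ^ n) a)) :=
    ⟨pos a b, by rintro _ ⟨n, rfl⟩; exact (h1 n).1.le.trans (h1 n).2⟩
  have ht := tendsto_atTop_ciSup hm hbd
  set s := ⨆ n : ℕ, pos a ((k ^ n) a)
  have hs0 : 0 ≤ s := (pos_nonneg _ _).trans (le_ciSup hbd 0)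
  have hsb : s ≤ pos a b := ciSup_le fun n => (h1 n).1.le.trans (h1 n).2
  refine ⟨lift a s, fixed_of_tendsto ht, fun e => ?_⟩
  rw [GoodInterval.mem_opp_arc, ← ha, ← hb] at e
  have e' := e.rotate.rotate
  rw [ccw_base, pos_lift hs0 (hsb.trans_lt (pos_lt _ _))] at e'
  linarith [e'.2]

/-- The pivot of a preserved crown is fixed. -/
theorem fixed_pivot (hk : OrientationPreserving k) {Q : Set GoodInterval} (hkQ : Preserves k Q)
    {p : Circle} (hp : ∀ x, x ∈ vertexSet Q ∧ (∀ I ∈ Q, I.left ≠ x) ↔ x = p) : k p = p := by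
  obtain ⟨h1, h2⟩ := (hp p).2 rfl
  refine (hp _).1 ⟨(hkQ.apply_mem_vertexSet hk).2 h1, fun I hI e => ?_⟩
  rw [← GoodInterval.map_map_inv (k := k) I] at hI e
  exact h2 _ (hkQ.mem_iff.1 hI) (k.injective e)

theorem IsCrown.exists_pivot {Q : Set GoodInterval} (h : IsCrown L Q) :
    ∃ p, p ∈ vertexSet Q ∧ (∀ I ∈ Q, I.left ≠ p ∧ I.right ≠ p) ∧
      ∀ x, x ∈ vertexSet Q ∧ (∀ I ∈ Q, I.left ≠ x) ↔ x = p := by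
  obtain ⟨-, t, p, ht, hp, hQt, hv⟩ := h
  have h1 : p ∈ vertexSet Q := by rw [hv]; exact Or.inr rfl
  have h2 : ∀ I ∈ Q, I.left ≠ p ∧ I.right ≠ p := by
    rw [hQt]
    rintro _ ⟨k, rfl⟩
    exact ⟨(hp k).symm, (hp (k + 1)).symm⟩
  refine ⟨p, h1, h2, fun x => ⟨?_, ?_⟩⟩
  · rintro ⟨hx, hx'⟩
    rw [hv] at hx
    rcases hx with ⟨k, rfl⟩ | hx
    · exact absurd rfl (hx' ⟨t k, t (k + 1), ht k⟩ (by rw [hQt]; exact ⟨k, rfl⟩))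
    · exact hx
  · rintro rfl
    exact ⟨h1, fun I hI => (h2 I hI).1⟩

/-- Some positive power of an automorphism has a fixed point: a vertex of a preserved ideal polygon,
the pivot of a preserved crown, or a point of an interval mapped into itself. -/
theorem QuiteFull.exists_pow_fixed (hL : IsLaminationSystem L) (hq : QuiteFull L)
    (hk : OrientationPreserving k) (hkL : Preserves k L) : ∃ m : ℕ, 0 < m ∧ ∃ x, (k ^ m) x = x := by
  rcases hL.gap_or_nested hk hkL with ⟨Q, hQ, hkQ⟩ | ⟨I, hI, hn, -⟩
  · rcases hq Q hQ with ⟨-, hfin⟩ | hcr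
    · obtain ⟨I, hI⟩ := hQ.nonempty hL
      have hv : ∀ n : ℕ, (k ^ n) I.left ∈ vertexSet Q := fun n =>
        ((hkQ.pow n).apply_mem_vertexSet (hk.pow n)).2 (hQ.left_mem hI)
      have : Finite (vertexSet Q) := hfin
      obtain ⟨i, j, hij, e⟩ := Finite.exists_ne_map_eq_of_infinite
        (fun n : ℕ => (⟨(k ^ n) I.left, hv n⟩ : vertexSet Q))
      have e' : (k ^ i) I.left = (k ^ j) I.left := congrArg Subtype.val e
      have key : ∀ i j : ℕ, i < j → (k ^ i) I.left = (k ^ j) I.left →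
          ∃ m : ℕ, 0 < m ∧ ∃ x, (k ^ m) x = x := by
        intro i j h e
        refine ⟨j - i, by omega, I.left, ?_⟩
        have : k ^ j = k ^ i * k ^ (j - i) := by rw [← pow_add]; congr 1; omega
        rw [this] at e
        exact ((k ^ i).injective e).symm
      rcases lt_or_gt_of_ne hij with h | h
      · exact key i j h e'
      · exact key j i h e'.symm
    · obtain ⟨p, -, -, hp⟩ := hcr.exists_pivot
      exact ⟨1, one_pos, p, by rw [pow_one]; exact fixed_pivot hk hkQ hp⟩
  · obtain ⟨z, hz, -⟩ := exists_fixed_of_nested hk hn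
    exact ⟨1, one_pos, z, by rwa [pow_one]⟩

/-- The single fixed point of an automorphism is the pivot of a crown. Nested intervals would give a
second fixed point, so that the automorphism preserves a gap. None of its sides is preserved, hence
none ends at the fixed point. -/
theorem IsTame.exists_crown (h : IsTame L) (hk : OrientationPreserving k) (hkL : Preserves k L)
    {p : Circle} (hp : Fix k = {p}) : ∃ Q, IsCrown L Q ∧ p ∈ vertexSet Q ∧
      ∀ I ∈ Q, I.left ≠ p ∧ I.right ≠ p := by
  have hL := h.lam
  have huniq : ∀ x, k x = x → x = p := fun x hx => by
    have : x ∈ Fix k := hx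
    rwa [hp] at this
  have hpf : k p = p := by
    have : p ∈ Fix k := by rw [hp]; rfl
    exact this
  rcases hL.gap_or_nested hk hkL with ⟨Q, hQ, hkQ⟩ | ⟨I, hI, hn, hne⟩
  · have hside : ∀ I ∈ Q, I.map k ≠ I := by
      intro I hI e
      rw [GoodInterval.map_eq_self] at e
      exact I.ne ((huniq _ e.1).trans (huniq _ e.2).symm)
    have hpv : p ∈ vertexSet Q := by
      rw [mem_vertexSet]
      intro I hI hpI
      refine hside I hI (hQ.eq_of_mem (hkQ.mem_iff.2 hI) hI (z := p) ?_ hpI)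
      rw [← hpf]
      exact (GoodInterval.mem_map_arc hk).2 hpI
    have hl : ∀ I ∈ Q, I.left ≠ p := by
      rintro I hI rfl
      exact hside I hI (hQ.eq_of_left_eq (hkQ.mem_iff.2 hI) hI hpf)
    have hr : ∀ I ∈ Q, I.right ≠ p := by
      rintro I hI rfl
      exact hside I hI (hQ.eq_of_right_eq (hkQ.mem_iff.2 hI) hI hpf)
    rcases h.full Q hQ with ⟨-, hfin⟩ | hcr
    · exfalso
      obtain ⟨I, hI⟩ := hQ.nonempty hL
      obtain ⟨z, hz, hzx, hno⟩ := exists_next hfin (hQ.left_mem hI) (hl I hI)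
      exact hl _ (hQ.mem_of_no_vertex hpv hz hzx.symm fun w hw hwv => hno w hwv hw) rfl
    · exact ⟨Q, hcr, hpv, fun I hI => ⟨hl I hI, hr I hI⟩⟩
  · exfalso
    obtain ⟨z, hz, hz'⟩ := exists_fixed_of_nested hk hn
    have hn' : ((I.opp).map k⁻¹).arc ⊆ I.opp.arc := by
      rw [← GoodInterval.map_arc_subset hk, GoodInterval.map_map_inv, GoodInterval.map_opp]
      exact GoodInterval.opp_subset_opp.2 hn
    obtain ⟨w, hw, hw'⟩ := exists_fixed_of_nested hk.inv hn'
    rw [inv_apply_eq, eq_comm] at hw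
    rw [huniq z hz] at hz'
    rw [huniq w hw, GoodInterval.opp_opp] at hw'
    refine hne (GoodInterval.map_eq_self.2 ?_)
    rcases I.mem_or p with e | e | e | e
    · exact absurd e hw'
    · exact absurd e hz'
    · rw [e] at hpf
      exact ⟨hpf, h.fixed_of_lf hk hkL hpf (Lf.of_mem hI)⟩
    · rw [e] at hpf
      exact ⟨h.fixed_of_lf hk hkL hpf ((Lf.of_mem hI).symm hL), hpf⟩

end Tree

/-! ### Complementary intervals of the fixed point set -/

/-- `(a, b)` is a connected component of the complement of the fixed point set of `k`, with two
distinct ends. -/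
structure IsFixedGap (k : Circle ≃ₜ Circle) (a b : Circle) : Prop where
  ne : a ≠ b
  left : k a = a
  right : k b = b
  free : ∀ z, CCW a z b → k z ≠ z

/-- `k` moves the points of the arc `(a, b)` counter-clockwise as seen from `a`. On a component of
the complement of the fixed point set, this means towards `b`. -/
def MovesForward (k : Circle ≃ₜ Circle) (a b : Circle) : Prop :=
  ∀ z, CCW a z b → CCW a z (k z)

theorem IsFixedGap.inv {k : Circle ≃ₜ Circle} {a b : Circle} (h : IsFixedGap k a b) :
    IsFixedGap k⁻¹ a b where
  ne := h.ne
  left := by rw [inv_apply_eq, h.left]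
  right := by rw [inv_apply_eq, h.right]
  free := fun z hz e => h.free z hz (by rw [inv_apply_eq] at e; exact e.symm)

theorem MovesForward.not_inv {k : Circle ≃ₜ Circle} (hk : OrientationPreserving k) {a b : Circle}
    (hab : IsFixedGap k a b) (h : MovesForward k a b) : ¬ MovesForward k⁻¹ a b := by
  intro h'
  obtain ⟨z, hz⟩ := exists_ccw hab.ne
  have h1 := ccw_base.1 (h z hz)
  have h2 := ccw_base.1 (h' z hz)
  linarith [h1.2, h2.2, (pos_inv_lt hk hab.left (x := z)).2 h1.2]

theorem IsFixedGap.lt_of_fixed {k : Circle ≃ₜ Circle} {a b z : Circle} (h : IsFixedGap k a b)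
    (hz : k z = z) : z = a ∨ pos a b ≤ pos a z := by
  by_cases e : z = a
  · exact Or.inl e
  · right
    by_contra hlt
    exact h.free z (ccw_base.2 ⟨pos_pos e, not_le.1 hlt⟩) hz

theorem IsFixedGap.ccw_map {k : Circle ≃ₜ Circle} (hk : OrientationPreserving k) {a b z : Circle}
    (h : IsFixedGap k a b) (hz : CCW a z b) : CCW a (k z) b := by
  have := hk _ _ _ hz
  rwa [h.left, h.right] at this

/-- On a component of the complement of the fixed point set, either all points move forward or all
points move backward: a point moved forward tends to `b`, and a point moved backward comes from
`b`. -/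
theorem IsFixedGap.forward_of_lt {k : Circle ≃ₜ Circle} (hk : OrientationPreserving k)
    {a b x : Circle} (h : IsFixedGap k a b) (hx : CCW a x b) (hlt : pos a x < pos a (k x)) :
    MovesForward k a b := by
  intro z hz
  have hx' := ccw_base.1 hx
  have hz' := ccw_base.1 hz
  refine ccw_base.2 ⟨hz'.1, ?_⟩
  by_contra hcon
  have hlt2 : pos a (k z) < pos a z :=
    lt_of_le_of_ne (not_lt.1 hcon) fun e => h.free z hz (pos_inj.1 e)
  have hb1 := pos_lt a b
  -- whichever of `x`, `z` comes first, an orbit is trapped between them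
  rcases lt_trichotomy (pos a x) (pos a z) with hxz | hxz | hxz
  · obtain ⟨s, -, -, hs, hst, hsf⟩ := orbit_up hk h.left hlt
    have hb : ∀ n : ℕ, pos a ((k ^ n) x) < pos a z := by
      intro n
      induction n with
      | zero => exact hxz
      | succ n ih =>
        rw [pow_succ_apply]
        exact ((pos_map_lt hk h.left).2 ih).trans hlt2
    have hsz : s ≤ pos a z := le_of_tendsto hst (Eventually.of_forall fun n => (hb n).le)
    have hs0 : pos a x < s := hs 0
    have hp : pos a (lift a s) = s := pos_lift (by linarith) (by linarith)
    exact h.free (lift a s) (ccw_base.2 ⟨by linarith, by linarith⟩) hsf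
  · rw [pos_inj.1 hxz] at hlt
    exact lt_asymm hlt hlt2
  · obtain ⟨s, hs0, -, hs, hst, hsf⟩ := orbit_down hk.inv h.inv.left ((pos_inv_lt hk h.left).2 hlt)
    have hb : ∀ n : ℕ, pos a z < pos a ((k⁻¹ ^ n) x) := by
      intro n
      induction n with
      | zero => exact hxz
      | succ n ih =>
        rw [pow_succ_apply]
        have h1 := (pos_map_lt hk.inv h.inv.left).2 ih
        have h2 := (lt_pos_inv hk h.left).2 hlt2
        exact h2.trans h1
    have hsz : pos a z ≤ s := ge_of_tendsto hst (Eventually.of_forall fun n => (hb n).le)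
    have hsx : s < pos a x := hs 0
    have hp : pos a (lift a s) = s := pos_lift (by linarith) (by linarith)
    exact h.inv.free (lift a s) (ccw_base.2 ⟨by linarith, by linarith⟩) hsf

theorem IsFixedGap.forward_or {k : Circle ≃ₜ Circle} (hk : OrientationPreserving k)
    {a b : Circle} (h : IsFixedGap k a b) : MovesForward k a b ∨ MovesForward k⁻¹ a b := by
  obtain ⟨z, hz⟩ := exists_ccw h.ne
  rcases lt_trichotomy (pos a z) (pos a (k z)) with e | e | e
  · exact Or.inl (h.forward_of_lt hk hz e)
  · exact absurd (pos_inj.1 e).symm (h.free z hz)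
  · exact Or.inr (h.inv.forward_of_lt hk.inv hz ((lt_pos_inv hk h.left).2 e))

section Step

variable {L : Set GoodInterval} {k : Circle ≃ₜ Circle} {a b : Circle}

/-- Some leaf has exactly one end in a given component of the complement of the fixed point set, and
the other end beyond the closure. Otherwise the intervals on either side, where those inside are
disjoint from their images, form a selection; the resulting gap is preserved with two fixed
vertices, but has a moved side. -/
theorem IsTame.exists_crossing (h : IsTame L) (hk : OrientationPreserving k) (hkL : Preserves k L)
    (hab : IsFixedGap k a b) : ∃ x y, Lf L x y ∧ CCW a x b ∧ CCW b y a := by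
  have hL := h.lam
  by_contra hcon
  push Not at hcon
  -- a leaf with one end in `(a, b)` has both ends there
  have hin : ∀ x y, Lf L x y → CCW a x b → CCW a y b := by
    intro x y hxy hx
    have n1 := hcon x y hxy hx
    have n2 : y ≠ a := by
      rintro rfl
      exact hab.free x hx (h.fixed_of_lf hk hkL hab.left (hxy.symm hL))
    have n3 : y ≠ b := by
      rintro rfl
      exact hab.free x hx (h.fixed_of_lf hk hkL hab.right (hxy.symm hL))
    exact (CCW.of_ne n2.symm n3 hab.ne.symm).resolve_right n1
  set A : GoodInterval := ⟨a, b, hab.ne⟩ with hA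
  have hmapA : A.map k = A := GoodInterval.map_eq_self.2 ⟨hab.left, hab.right⟩
  set S : Set GoodInterval :=
    {J | J ∈ L ∧ (J.arc ⊆ A.opp.arc ∨ (J.arc ⊆ A.arc ∧ Disjoint J.arc (J.map k).arc))} with hS
  -- intervals strictly inside are moved off themselves
  have hmove : ∀ I ∈ L, CCW a I.left b → I.arc ⊆ A.arc → Disjoint I.arc (I.map k).arc := by
    intro I hI hl hIA
    have hr := hin _ _ (Lf.of_mem hI) hl
    have hl' := ccw_base.1 hl
    have hr' := ccw_base.1 hr
    have hlr := (GoodInterval.arc_subset_iff.1 hIA).1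
    have hkl := ccw_base.1 (hab.ccw_map hk hl)
    have hkr := ccw_base.1 (hab.ccw_map hk hr)
    have hklr := (pos_map_lt hk hab.left).2 hlr
    have n1 : ¬ (CCW I.left (k I.left) I.right ∧ CCW I.right (k I.right) I.left) := fun e =>
      hL.not_linked (Lf.of_mem (hkL.mem_iff.2 hI)) (Lf.of_mem hI) e.1 e.2
    have n2 : ¬ (CCW I.left (k I.right) I.right ∧ CCW I.right (k I.left) I.left) := fun e =>
      hL.not_linked ((Lf.of_mem (hkL.mem_iff.2 hI)).symm hL) (Lf.of_mem hI) e.1 e.2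
    have n3 : ¬ (pos a I.left < pos a (k I.left) ∧ pos a (k I.right) ≤ pos a I.right) := by
      rintro ⟨e1, e2⟩
      have := (ccw_base.1 (hab.forward_of_lt hk hl e1 _ hr)).2
      linarith
    have n4 : ¬ (pos a (k I.left) < pos a I.left ∧ pos a I.right ≤ pos a (k I.right)) := by
      rintro ⟨e1, e2⟩
      have e3 := hab.inv.forward_of_lt hk.inv hl ((lt_pos_inv hk hab.left).2 e1)
      have := (lt_pos_inv hk hab.left).1 (ccw_base.1 (e3 _ hr)).2
      linarith
    have n5 : pos a (k I.left) ≠ pos a I.left := fun e => hab.free _ hl (pos_inj.1 e)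
    have n6 : pos a (k I.right) ≠ pos a I.right := fun e => hab.free _ hr (pos_inj.1 e)
    rw [Set.disjoint_left]
    intro z hz hz'
    simp only [GoodInterval.mem_arc, GoodInterval.map, ccw_iff a] at hz hz' n1 n2
    have hc : pos a (k I.left) < pos a I.right ∧ pos a I.left < pos a (k I.right) := by grind
    grind
  have hnotopp : ∀ J : GoodInterval, J.arc ⊆ A.arc ∨ J.arc ⊆ A.opp.arc → a ∉ J.arc ∧ b ∉ J.arc := by
    rintro J (e | e)
    · exact ⟨fun h => A.left_notMem (e h), fun h => A.right_notMem (e h)⟩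
    · exact ⟨fun h => A.opp.right_notMem (e h), fun h => A.opp.left_notMem (e h)⟩
  have hSsub : ∀ J ∈ S, J.arc ⊆ A.arc ∨ J.arc ⊆ A.opp.arc := fun J hJ =>
    hJ.2.elim Or.inr fun e => Or.inl e.1
  have hsel : IsSelection L S := by
    refine ⟨fun I hI => hI.1, fun I hI => ?_, ?_, ?_, ?_⟩
    · have hIo := hL.opp_mem I hI
      by_cases hl : I.left ∈ A.arc
      · have hr := hin _ _ (Lf.of_mem hI) hl
        have hl' := ccw_base.1 hl
        have hr' := ccw_base.1 hr
        rcases lt_or_gt_of_ne (fun e => I.ne (pos_injective a e)) with e | e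
        · have hs : I.arc ⊆ A.arc := GoodInterval.arc_subset_iff.2 ⟨e, hr'.2.le⟩
          exact Or.inl ⟨hI, Or.inr ⟨hs, hmove I hI hl hs⟩⟩
        · have hs : I.opp.arc ⊆ A.arc := GoodInterval.arc_subset_iff.2 ⟨e, hl'.2.le⟩
          exact Or.inr ⟨hIo, Or.inr ⟨hs, hmove _ hIo hr hs⟩⟩
      · have hr : I.right ∉ A.arc := fun e => hl (hin _ _ ((Lf.of_mem hI).symm hL) e)
        rcases GoodInterval.subset_or_of_notMem hl hr with e | e
        · exact Or.inr ⟨hIo, Or.inl (GoodInterval.opp_subset_opp.2 e)⟩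
        · exact Or.inl ⟨hI, Or.inl (GoodInterval.subset_opp_comm.1 e)⟩
    · intro I hI J hJ hIJ
      have h1 := hnotopp I (hSsub I hI)
      have h2 := hnotopp J (hSsub J hJ)
      have h3 : a ∉ I.opp.arc := fun e => h2.1 (hIJ e)
      have h4 : b ∉ I.opp.arc := fun e => h2.2 (hIJ e)
      have h5 : a = I.left ∨ a = I.right := by
        rcases I.mem_or a with e | e | e
        exacts [absurd e h1.1, absurd e h3, e]
      have h6 : b = I.left ∨ b = I.right := by
        rcases I.mem_or b with e | e | e
        exacts [absurd e h1.2, absurd e h4, e]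
      -- a selected interval with ends `a` and `b` is `(b, a)`, and its opposite is not selected
      have hAn : ∀ K : GoodInterval, A.arc ⊆ K.arc → K ∉ S := by
        intro K hK hKS
        obtain ⟨z, hz⟩ := A.nonempty_arc
        rcases hKS.2 with e | ⟨e, e'⟩
        · exact Set.disjoint_left.1 A.disjoint_opp hz (e (hK hz))
        · have : K = A := GoodInterval.eq_of_arc_eq (subset_antisymm e hK)
          rw [this, hmapA, disjoint_self] at e'
          exact A.nonempty_arc.ne_empty e'
      have hcase : I = A ∨ I = A.opp := by
        rcases h5 with e5 | e5 <;> rcases h6 with e6 | e6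
        · exact absurd (e5.trans e6.symm) hab.ne
        · exact Or.inl (GoodInterval.ext e5.symm e6.symm)
        · exact Or.inr (GoodInterval.ext e6.symm e5.symm)
        · exact absurd (e5.trans e6.symm) hab.ne
      rcases hcase with rfl | rfl
      · exact absurd hI (hAn _ subset_rfl)
      · exact absurd hJ (hAn _ hIJ)
    · intro I J hI hJ hm hU
      refine ⟨hJ, ?_⟩
      obtain ⟨z, hz⟩ := (I 0).nonempty_arc
      rcases (hI 0).2 with e0 | ⟨e0, -⟩
      · left
        rw [hU]
        refine iUnion_subset fun n => ?_
        rcases (hI n).2 with e | ⟨e, -⟩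
        · exact e
        · exact absurd (e0 hz) (Set.disjoint_left.1 A.disjoint_opp (e (hm (Nat.zero_le n) hz)))
      · right
        have hall : ∀ n, (I n).arc ⊆ A.arc ∧ Disjoint (I n).arc ((I n).map k).arc := by
          intro n
          rcases (hI n).2 with e | e
          · exact absurd (e (hm (Nat.zero_le n) hz)) (Set.disjoint_left.1 A.disjoint_opp (e0 hz))
          · exact e
        refine ⟨hU ▸ iUnion_subset fun n => (hall n).1, ?_⟩
        rw [Set.disjoint_left]
        intro z hz hz'
        rw [GoodInterval.arc_map hk] at hz'
        obtain ⟨w, hw, rfl⟩ := hz'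
        rw [hU] at hz hw
        obtain ⟨m, hm'⟩ := mem_iUnion.1 hz
        obtain ⟨n, hn'⟩ := mem_iUnion.1 hw
        refine Set.disjoint_left.1 (hall (max m n)).2 (hm (le_max_left m n) hm') ?_
        exact (GoodInterval.mem_map_arc hk).2 (hm (le_max_right m n) hn')
    · exact fun I _ => ⟨a, b, hab.ne, fun J hJ _ => hnotopp J (hSsub J hJ)⟩
  have hgap := hsel.isGap hL
  set Q := maximalIntervals S with hQ
  have hkS : Preserves k S := by
    rw [preserves_iff]
    intro I
    have h1 : (I.map k).arc ⊆ A.arc ↔ I.arc ⊆ A.arc := by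
      conv_lhs => rw [← hmapA]
      exact GoodInterval.map_arc_subset hk
    have h2 : (I.map k).arc ⊆ A.opp.arc ↔ I.arc ⊆ A.opp.arc := by
      conv_lhs => rw [← hmapA, ← GoodInterval.map_opp]
      exact GoodInterval.map_arc_subset hk
    simp only [hS, mem_ofPred_eq, hkL.mem_iff, h1, h2]
    rw [GoodInterval.disjoint_iff_subset_opp, GoodInterval.disjoint_iff_subset_opp,
      ← GoodInterval.map_opp, GoodInterval.map_arc_subset hk]
  have hkQ := preserves_maximalIntervals hk hkS
  have hav : a ∈ vertexSet Q := mem_vertexSet.2 fun I hI => (hnotopp I (hSsub I hI.1)).1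
  have hfix : ∀ x ∈ vertexSet Q, k x = x := fun x hx =>
    hgap.vertex_fixed hL h.full hk hkQ hab.ne hab.left hab.right hx
  obtain ⟨z, hz⟩ := A.nonempty_arc
  have hzv : z ∉ vertexSet Q := fun e => hab.free z hz (hfix z e)
  rw [mem_vertexSet] at hzv
  push Not at hzv
  obtain ⟨J, hJ, hzJ⟩ := hzv
  have hJfix : J.map k = J :=
    GoodInterval.map_eq_self.2 ⟨hfix _ (hgap.left_mem hJ), hfix _ (hgap.right_mem hJ)⟩
  rcases hJ.1.2 with e | ⟨-, e⟩
  · exact Set.disjoint_left.1 A.disjoint_opp hz (e hzJ)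
  · rw [hJfix, disjoint_self] at e
    exact J.nonempty_arc.ne_empty e

/-- The dynamics seen by one lamination next to a component `(a, b)` of the complement of the fixed
point set, with points of `(a, b)` moved forward. A leaf `(x, y)` that crosses `(a, b)` is pushed
towards `b`; positions are measured from `a`. Between the limits `s` and `t` of the outer ends of
its forward and backward images there is no fixed point, and a limit that is not an end of `(a, b)`
is joined to one by a leaf. -/
theorem IsTame.crossing_limits (h : IsTame L) (hk : OrientationPreserving k) (hkL : Preserves k L)
    (hab : IsFixedGap k a b) (hf : MovesForward k a b) :
    ∃ (x y : Circle) (s t : ℝ), CCW a x b ∧ CCW b y a ∧ pos a b ≤ s ∧ s < pos a y ∧ pos a y < t ∧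
      t ≤ 2 * Real.pi ∧ k (lift a s) = lift a s ∧ k (lift a t) = lift a t ∧
      (s = pos a b ∨ Lf L b (lift a s)) ∧ (t = 2 * Real.pi ∨ Lf L a (lift a t)) ∧
      (∀ z, k z = z → ¬ (s < pos a z ∧ pos a z < t)) ∧
      pos a x < pos a (k x) ∧ pos a (k y) < pos a y := by
  have hL := h.lam
  obtain ⟨x, y, hxy, hx, hy⟩ := h.exists_crossing hk hkL hab
  have hx' := ccw_base.1 hx
  have hy' := ccw_base.1 hy.rotate.rotate
  have hkx := ccw_base.1 (hab.ccw_map hk hx)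
  have hxk := (ccw_base.1 (hf x hx)).2
  have hylt := pos_lt a y
  have hkylt := pos_lt a (k y)
  have hky0 : pos a b < pos a (k y) := by
    have := (pos_map_lt hk hab.left).2 hy'.2
    rwa [hab.right] at this
  have hky : pos a (k y) < pos a y := by
    refine lt_of_le_of_ne ?_ fun e => ?_
    · by_contra hcon
      refine hL.not_linked ((Lf.map_iff hkL).2 hxy) hxy (u := x) (v := y) ?_ ?_
      · rw [ccw_iff a]; exact Or.inl ⟨hxk, by linarith⟩
      · rw [ccw_iff a]; exact Or.inr (Or.inr ⟨by linarith, by linarith⟩)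
    · exact hab.free x hx (h.fixed_of_lf hk hkL (pos_inj.1 e) (hxy.symm hL))
  have ha' := hab.inv.left
  obtain ⟨u, hu, hum, hult, hut, huf⟩ := orbit_up hk hab.left hxk
  obtain ⟨u', hu', hum', hult', hut', huf'⟩ :=
    orbit_down hk.inv ha' ((pos_inv_lt hk hab.left).2 hxk)
  obtain ⟨s, hs, hsm, hslt, hst, hsf⟩ := orbit_down hk hab.left hky
  obtain ⟨t, ht, htm, htlt, htt, htf⟩ := orbit_up hk.inv ha' ((lt_pos_inv hk hab.left).2 hky)
  rw [inv_apply_eq, eq_comm] at huf' htf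
  have hblt := pos_lt a b
  -- the inner ends converge to `b` and `a`
  have hub : u = pos a b := by
    have h1 : u ≤ pos a b := le_of_tendsto hut (Eventually.of_forall fun n => by
      have := (pos_map_lt (hk.pow n) (pow_fix hab.left n)).2 hx'.2
      rw [pow_fix hab.right n] at this
      exact this.le)
    have h0 : pos a x < u := hult 0
    have hp : pos a (lift a u) = u := pos_lift (by linarith) (by linarith)
    rcases hab.lt_of_fixed huf with e | e
    · rw [e, pos_self] at hp; linarith
    · rw [hp] at e; linarith
  have hua : u' = 0 := by
    have h0 : u' < pos a x := hult' 0
    have hp : pos a (lift a u') = u' := pos_lift (by linarith) (by linarith)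
    rcases hab.lt_of_fixed huf' with e | e
    · rw [e, pos_self] at hp; exact hp.symm
    · rw [hp] at e; linarith
  have hsb : pos a b ≤ s := ge_of_tendsto hst (Eventually.of_forall fun n => by
      have := (pos_map_lt (hk.pow n) (pow_fix hab.left n)).2 hy'.2
      rw [pow_fix hab.right n] at this
      exact this.le)
  have hs0 : s < pos a y := hslt 0
  have ht0 : pos a y < t := htlt 0
  have hlf : ∀ n : ℕ, Lf L ((k ^ n) x) ((k ^ n) y) := fun n => by
    induction n with
    | zero => exact hxy
    | succ n ih => rw [pow_succ_apply, pow_succ_apply]; exact (Lf.map_iff hkL).2 ih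
  have hlf' : ∀ n : ℕ, Lf L ((k⁻¹ ^ n) x) ((k⁻¹ ^ n) y) := fun n => by
    induction n with
    | zero => exact hxy
    | succ n ih => rw [pow_succ_apply, pow_succ_apply]; exact (Lf.map_iff hkL.inv).2 ih
  refine ⟨x, y, s, t, hx, hy, hsb, hs0, ht0, ht, hsf, htf, ?_, ?_, ?_, hxk, hky⟩
  · by_cases e : s = pos a b
    · exact Or.inl e
    · right
      have hlt : pos a b < s := lt_of_le_of_ne hsb (Ne.symm e)
      -- the complementary arcs increase, from the outer end to the inner end one turn later
      have := hL.lf_limit (p := a) (s := fun n => pos a ((k ^ n) y))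
        (t := fun n => pos a ((k ^ n) x) + 2 * Real.pi) (S := s) (T := u + 2 * Real.pi)
        hsm.antitone (hum.monotone.add_const _) hst (hut.add_const _)
        (fun n => by have := pos_lt a ((k ^ n) y); have := pos_nonneg a ((k ^ n) x); linarith)
        (by linarith) (fun n => by
          have : lift a (pos a ((k ^ n) x) + 2 * Real.pi) = (k ^ n) x := by
            rw [← lift_lift, lift_two_pi, lift_pos]
          rw [this, lift_pos]
          exact (hlf n).symm hL)
      rw [← lift_lift, lift_two_pi, hub, lift_pos] at this
      exact this.symm hL
  · by_cases e : t = 2 * Real.pi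
    · exact Or.inl e
    · right
      have hlt : t < 2 * Real.pi := lt_of_le_of_ne ht e
      have hxyn : ∀ n : ℕ, pos a ((k⁻¹ ^ n) x) < pos a ((k⁻¹ ^ n) y) := fun n =>
        (pos_map_lt (hk.inv.pow n) (pow_fix ha' n)).2 (hx'.2.trans hy'.2)
      have := hL.lf_limit (p := a) (s := fun n => pos a ((k⁻¹ ^ n) x))
        (t := fun n => pos a ((k⁻¹ ^ n) y)) (S := u') (T := t)
        hum'.antitone htm.monotone hut' htt hxyn (by linarith)
        (fun n => by rw [lift_pos, lift_pos]; exact hlf' n)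
      rwa [hua, lift_zero] at this
  · rintro z hz ⟨h1, h2⟩
    -- `z` is trapped between two consecutive images of `y`
    rcases lt_trichotomy (pos a z) (pos a y) with e | e | e
    · obtain ⟨n, hn⟩ := (hst.eventually (gt_mem_nhds h1)).exists
      have := (pos_map_lt (hk.pow n) (pow_fix hab.left n)).2 e
      rw [pow_fix hz n] at this
      linarith
    · rw [← pos_inj.1 e, hz] at hky
      exact lt_irrefl _ hky
    · obtain ⟨n, hn⟩ := (htt.eventually (lt_mem_nhds h2)).exists
      have := (pos_map_lt (hk.inv.pow n) (pow_fix ha' n)).2 e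
      rw [pow_fix (show k⁻¹ z = z by rw [inv_apply_eq, hz]) n] at this
      linarith

end Step

theorem ccw_lift_iff {a z : Circle} {s t : ℝ} (hs : 0 ≤ s) (hst : s < t) (ht : t ≤ 2 * Real.pi)
    (hlt : t < s + 2 * Real.pi) : CCW (lift a s) z (lift a t) ↔ s < pos a z ∧ pos a z < t := by
  have h1 := arc_lift (p := a) hst hlt (lift_ne hst hlt)
  have h2 : CCW (lift a s) z (lift a t) ↔ z ∈ lift a '' Ioo s t := by rw [← h1]; rfl
  rw [h2]
  constructor
  · rintro ⟨u, hu, rfl⟩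
    rw [pos_lift (hs.trans hu.1.le) (hu.2.trans_le ht)]
    exact hu
  · exact fun h => ⟨pos a z, h, lift_pos _ _⟩

theorem image_closure_subset {k : Circle ≃ₜ Circle} (hk : OrientationPreserving k)
    {I : GoodInterval} (h : (I.map k).arc ⊆ I.arc) (hl : k I.left ∈ I.arc) (hr : k I.right ∈ I.arc) :
    k '' closure I.arc ⊆ I.arc := by
  rintro _ ⟨z, hz, rfl⟩
  rcases I.closure_arc_subset hz with e | e | e
  · rwa [e]
  · rwa [e]
  · exact h ((GoodInterval.mem_map_arc hk).2 e)

theorem IsRepelling_iff {k : Circle ≃ₜ Circle} {p : Circle} :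
    IsRepelling k p ↔ IsAttracting k⁻¹ p := by
  refine exists_congr fun I => ?_
  rw [Fix_inv]
  refine and_congr_right fun _ => ?_
  constructor
  · rintro h _ ⟨z, hz, rfl⟩
    obtain ⟨w, hw, rfl⟩ := h hz
    rwa [inv_apply_self]
  · intro h z hz
    exact ⟨k⁻¹ z, h (mem_image_of_mem _ hz), apply_inv_self _ _⟩

section Sides

variable {k : Circle ≃ₜ Circle} {a b x y : Circle} {s t : ℝ}

/-- If the images of the outer end `y` converge to `b`, then `b` attracts from both sides. -/
theorem IsFixedGap.attracting_side (hk : OrientationPreserving k) (hab : IsFixedGap k a b)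
    (hx : CCW a x b) (hy : CCW b y a) (hyt : pos a y < t) (ht : t ≤ 2 * Real.pi)
    (htf : k (lift a t) = lift a t) (hfree : ∀ z, k z = z → ¬ (pos a b < pos a z ∧ pos a z < t))
    (hxk : pos a x < pos a (k x)) (hky : pos a (k y) < pos a y) :
    IsFixedGap k b (lift a t) ∧ MovesForward k⁻¹ b (lift a t) ∧ IsAttracting k b := by
  have hx' := ccw_base.1 hx
  have hy' := ccw_base.1 hy.rotate.rotate
  have hb0 := pos_pos hab.ne.symm
  have hblt := pos_lt a b
  have hin : ∀ z, CCW b z (lift a t) ↔ pos a b < pos a z ∧ pos a z < t := fun z => by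
    have := ccw_lift_iff (a := a) (z := z) (s := pos a b) (t := t) hb0.le (by linarith) ht
      (by linarith)
    rwa [lift_pos] at this
  have hne : b ≠ lift a t := by
    have := lift_ne (p := a) (s := pos a b) (t := t) (by linarith) (by linarith)
    rwa [lift_pos] at this
  have hgap : IsFixedGap k b (lift a t) :=
    ⟨hne, hab.right, htf, fun z hz e => hfree z e ((hin z).1 hz)⟩
  have hkyb : pos a b < pos a (k y) := by
    have := (pos_map_lt hk hab.left).2 hy'.2
    rwa [hab.right] at this
  have hkxb : pos a (k x) < pos a b := by
    have := (pos_map_lt hk hab.left).2 hx'.2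
    rwa [hab.right] at this
  have hne' : x ≠ y := by rintro rfl; linarith
  refine ⟨hgap, ?_, ⟨x, y, hne'⟩, ?_, ?_⟩
  · refine hgap.inv.forward_of_lt hk.inv ((hin y).2 ⟨hy'.2, hyt⟩) ?_
    have h1 : CCW b (k y) y := by rw [ccw_iff a]; exact Or.inl ⟨hkyb, hky⟩
    have h2 := hk.inv _ _ _ h1
    rw [hgap.inv.left, inv_apply_self] at h2
    exact (ccw_base.1 h2).2
  · ext z
    simp only [mem_inter_iff, mem_singleton_iff, GoodInterval.mem_arc, mem_Fix]
    constructor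
    · rintro ⟨h1, h2⟩
      rw [ccw_iff a] at h1
      have h3 : pos a x < pos a z ∧ pos a z < pos a y := by
        rcases h1 with h1 | h1 | h1
        · exact h1
        · linarith [h1.1, h1.2]
        · linarith [h1.1, h1.2]
      rcases hab.lt_of_fixed h2 with e | e
      · rw [e, pos_self] at h3; linarith [h3.1]
      · rcases e.lt_or_eq with e | e
        · exact absurd ⟨e, by linarith⟩ (hfree z h2)
        · exact (pos_inj.1 e).symm
    · rintro rfl
      exact ⟨by rw [ccw_iff a]; exact Or.inl ⟨hx'.2, hy'.2⟩, hab.right⟩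
  · refine image_closure_subset hk ?_ ?_ ?_
    · intro z hz
      simp only [GoodInterval.mem_arc, GoodInterval.map, ccw_iff a] at hz ⊢
      left
      rcases hz with hz | hz | hz <;> constructor <;> linarith [hz.1, hz.2]
    · rw [GoodInterval.mem_arc, ccw_iff a]
      exact Or.inl ⟨hxk, by simp only; linarith⟩
    · rw [GoodInterval.mem_arc, ccw_iff a]
      exact Or.inl ⟨by simp only; linarith, hky⟩

/-- If the backward images of the outer end `y` converge to `a`, then `a` repels to both sides. -/
theorem IsFixedGap.repelling_side (hk : OrientationPreserving k) (hab : IsFixedGap k a b)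
    (hx : CCW a x b) (hy : CCW b y a) (hbs : pos a b ≤ s) (hys : s < pos a y)
    (hsf : k (lift a s) = lift a s) (hfree : ∀ z, k z = z → ¬ (s < pos a z))
    (hxk : pos a x < pos a (k x)) (hky : pos a (k y) < pos a y) :
    IsFixedGap k (lift a s) a ∧ MovesForward k⁻¹ (lift a s) a ∧ IsRepelling k a := by
  have hx' := ccw_base.1 hx
  have hy' := ccw_base.1 hy.rotate.rotate
  have hb0 := pos_pos hab.ne.symm
  have hylt := pos_lt a y
  have hps : pos a (lift a s) = s := pos_lift (by linarith) (by linarith)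
  have hin : ∀ z, CCW (lift a s) z a ↔ s < pos a z := fun z => by
    have h1 := ccw_base_right (p := z) (x := lift a s) (y := a)
    have h2 : CCW (lift a s) z a ↔ CCW a (lift a s) z := ⟨fun h => h.rotate.rotate, fun h => h.rotate⟩
    rw [h2, ccw_base, hps]
    exact ⟨fun h => h.2, fun h => ⟨by linarith, h⟩⟩
  have hne : lift a s ≠ a := fun e => by rw [e, pos_self] at hps; linarith
  have hgap : IsFixedGap k (lift a s) a :=
    ⟨hne, hsf, hab.left, fun z hz e => hfree z e ((hin z).1 hz)⟩
  have hkys : s < pos a (k y) := by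
    have := (pos_map_lt hk hab.left (x := lift a s) (y := y)).2 (by rwa [hps])
    rwa [hsf, hps] at this
  have hkx0 : 0 < pos a (k x) := by linarith
  have hne' : x ≠ y := by rintro rfl; linarith
  refine ⟨hgap, ?_, IsRepelling_iff.2 ⟨⟨y, x, hne'.symm⟩, ?_, ?_⟩⟩
  · refine hgap.inv.forward_of_lt hk.inv ((hin y).2 hys) ?_
    have h1 : CCW (lift a s) (k y) y := by
      rw [ccw_iff a, hps]; exact Or.inl ⟨hkys, hky⟩
    have h2 := hk.inv _ _ _ h1
    rw [hgap.inv.left, inv_apply_self] at h2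
    exact (ccw_base.1 h2).2
  · rw [Fix_inv]
    ext z
    simp only [mem_inter_iff, mem_singleton_iff, GoodInterval.mem_arc, mem_Fix]
    constructor
    · rintro ⟨h1, h2⟩
      rw [ccw_iff a] at h1
      by_contra hza
      have h3 := hfree z h2
      rcases hab.lt_of_fixed h2 with e | e
      · exact hza e
      · rcases h1 with h1 | h1 | h1 <;> linarith [h1.1, h1.2]
    · rintro rfl
      exact ⟨by rw [ccw_base_right]; exact ⟨hx'.1, by linarith⟩, hab.left⟩
  · have hxi : pos a (k⁻¹ x) < pos a x := (pos_inv_lt hk hab.left).2 hxk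
    have hyi : pos a y < pos a (k⁻¹ y) := (lt_pos_inv hk hab.left).2 hky
    refine image_closure_subset hk.inv ?_ ?_ ?_
    · intro z hz
      have hz0 := pos_nonneg a z
      simp only [GoodInterval.mem_arc, GoodInterval.map, ccw_iff a] at hz ⊢
      right
      rcases hz with hz | hz | hz
      · linarith [hz.1, hz.2]
      · exact Or.inl ⟨by linarith [hz.1], by linarith⟩
      · exact Or.inr ⟨by linarith, by linarith [hz.2]⟩
    · rw [GoodInterval.mem_arc, ccw_iff a]
      exact Or.inr (Or.inr ⟨by simp only; linarith, hyi⟩)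
    · rw [GoodInterval.mem_arc, ccw_iff a]
      exact Or.inr (Or.inl ⟨hxi, by simp only; linarith⟩)

end Sides

/-- The local structure at a component `(a, b)` of the complement of the fixed point set of an
automorphism of a pseudo-fibered pair, when points of `(a, b)` move forward. Either `a` and `b` are
the only fixed points, or the adjacent components `(a', a)` and `(b, b')` exist and the arcs
`(a, b')` and `(a', b)` are intervals of the two different laminations. -/
theorem IsPseudoFibered.step {L₁ L₂ : Set GoodInterval} (hC : IsPseudoFibered L₁ L₂)
    {k : Circle ≃ₜ Circle} (hk : OrientationPreserving k) (hk₁ : Preserves k L₁)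
    (hk₂ : Preserves k L₂) {a b : Circle} (hab : IsFixedGap k a b) (hf : MovesForward k a b) :
    ∃ a' b', IsFixedGap k a' a ∧ IsFixedGap k b b' ∧ MovesForward k⁻¹ a' a ∧
      MovesForward k⁻¹ b b' ∧ IsAttracting k b ∧ IsRepelling k a ∧
      ((Fix k = {a, b} ∧ a' = b ∧ b' = a) ∨ (Lf L₁ a b' ∧ Lf L₂ a' b) ∨
        (Lf L₂ a b' ∧ Lf L₁ a' b)) := by
  obtain ⟨x, y, s, t, hx, hy, hbs, hsy, hyt, ht, hsf, htf, hs, htl, hfree, hxk, hky⟩ :=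
    hC.isTame_left.crossing_limits hk hk₁ hab hf
  obtain ⟨x', y', s', t', hx', hy', hbs', hsy', hyt', ht', hsf', htf', hs', htl', hfree', hxk',
    hky'⟩ := hC.isTame_right.crossing_limits hk hk₂ hab hf
  -- the two laminations have no common endpoint
  have hb : s = pos a b ∨ s' = pos a b := by
    rcases hs with e | e
    · exact Or.inl e
    · rcases hs' with e' | e'
      · exact Or.inr e'
      · exact (hC.disjoint_endpoints e e').elim
  have ha : t = 2 * Real.pi ∨ t' = 2 * Real.pi := by
    rcases htl with e | e
    · exact Or.inl e
    · rcases htl' with e' | e'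
      · exact Or.inr e'
      · exact (hC.disjoint_endpoints e e').elim
  have hyper : ∀ z, (∀ z, k z = z → ¬ (pos a b < pos a z ∧ pos a z < 2 * Real.pi)) → k z = z →
      z = a ∨ z = b := by
    intro z h hz
    rcases hab.lt_of_fixed hz with e | e
    · exact Or.inl e
    · rcases e.lt_or_eq with e | e
      · exact absurd ⟨e, pos_lt _ _⟩ (h z hz)
      · exact Or.inr (pos_inj.1 e).symm
  have hyperF : (∀ z, k z = z → ¬ (pos a b < pos a z ∧ pos a z < 2 * Real.pi)) →
      Fix k = {a, b} := by
    intro h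
    ext z
    refine ⟨fun hz => hyper z h hz, ?_⟩
    rintro (rfl | rfl)
    exacts [hab.left, hab.right]
  rcases hb with hb | hb <;> rcases ha with ha | ha
  · subst hb ha
    obtain ⟨h1, h2, h3⟩ := hab.attracting_side hk hx hy hyt ht htf hfree hxk hky
    obtain ⟨h4, h5, h6⟩ := hab.repelling_side hk hx hy hbs hsy hsf
      (fun z hz e => hfree z hz ⟨e, pos_lt _ _⟩) hxk hky
    rw [lift_two_pi] at h1 h2
    rw [lift_pos] at h4 h5
    exact ⟨b, a, h4, h1, h5, h2, h3, h6, Or.inl ⟨hyperF hfree, rfl, rfl⟩⟩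
  · subst hb ha
    obtain ⟨h1, h2, h3⟩ := hab.attracting_side hk hx hy hyt ht htf hfree hxk hky
    obtain ⟨h4, h5, h6⟩ := hab.repelling_side hk hx' hy' hbs' hsy' hsf'
      (fun z hz e => hfree' z hz ⟨e, pos_lt _ _⟩) hxk' hky'
    by_cases e : t = 2 * Real.pi
    · subst e
      rw [lift_two_pi] at h1 h2
      have hF := hyperF hfree
      have e' : s' = pos a b := by
        have h : lift a s' ∈ Fix k := hsf'
        have hp : pos a (lift a s') = s' :=
          pos_lift ((pos_nonneg _ _).trans hbs') (hsy'.trans (pos_lt _ _))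
        rw [hF] at h
        rcases h with h | h
        · rw [h, pos_self] at hp
          have := pos_pos hab.ne.symm
          linarith
        · rw [h] at hp; exact hp.symm
      rw [e', lift_pos] at h4 h5
      exact ⟨b, a, h4, h1, h5, h2, h3, h6, Or.inl ⟨hF, rfl, rfl⟩⟩
    · by_cases e' : s' = pos a b
      · have hF : Fix k = {a, b} := hyperF (e' ▸ hfree')
        exfalso
        have h : lift a t ∈ Fix k := htf
        have hp : pos a (lift a t) = t := pos_lift (by linarith [pos_nonneg a y])
          (lt_of_le_of_ne ht e)
        have := pos_nonneg a b
        rw [hF] at h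
        rcases h with h | h
        · rw [h, pos_self] at hp; linarith [pos_nonneg a y]
        · rw [h] at hp; linarith
      · exact ⟨lift a s', lift a t, h4, h1, h5, h2, h3, h6, Or.inr (Or.inl
          ⟨htl.resolve_left e, (hs'.resolve_left e').symm hC.lamination_right⟩)⟩
  · subst hb ha
    obtain ⟨h1, h2, h3⟩ := hab.attracting_side hk hx' hy' hyt' ht' htf' hfree' hxk' hky'
    obtain ⟨h4, h5, h6⟩ := hab.repelling_side hk hx hy hbs hsy hsf
      (fun z hz e => hfree z hz ⟨e, pos_lt _ _⟩) hxk hky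
    by_cases e : t' = 2 * Real.pi
    · subst e
      rw [lift_two_pi] at h1 h2
      have hF := hyperF hfree'
      have e' : s = pos a b := by
        have h : lift a s ∈ Fix k := hsf
        have hp : pos a (lift a s) = s :=
          pos_lift ((pos_nonneg _ _).trans hbs) (hsy.trans (pos_lt _ _))
        rw [hF] at h
        rcases h with h | h
        · rw [h, pos_self] at hp
          have := pos_pos hab.ne.symm
          linarith
        · rw [h] at hp; exact hp.symm
      rw [e', lift_pos] at h4 h5
      exact ⟨b, a, h4, h1, h5, h2, h3, h6, Or.inl ⟨hF, rfl, rfl⟩⟩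
    · by_cases e' : s = pos a b
      · have hF : Fix k = {a, b} := hyperF (e' ▸ hfree)
        exfalso
        have h : lift a t' ∈ Fix k := htf'
        have hp : pos a (lift a t') = t' := pos_lift (by linarith [pos_nonneg a y'])
          (lt_of_le_of_ne ht' e)
        have := pos_nonneg a b
        rw [hF] at h
        rcases h with h | h
        · rw [h, pos_self] at hp; linarith [pos_nonneg a y']
        · rw [h] at hp; linarith
      · exact ⟨lift a s, lift a t', h4, h1, h5, h2, h3, h6, Or.inr (Or.inr
          ⟨htl'.resolve_left e, (hs.resolve_left e').symm hC.lamination_left⟩)⟩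
  · subst hb ha
    obtain ⟨h1, h2, h3⟩ := hab.attracting_side hk hx' hy' hyt' ht' htf' hfree' hxk' hky'
    obtain ⟨h4, h5, h6⟩ := hab.repelling_side hk hx' hy' hbs' hsy' hsf'
      (fun z hz e => hfree' z hz ⟨e, pos_lt _ _⟩) hxk' hky'
    rw [lift_two_pi] at h1 h2
    rw [lift_pos] at h4 h5
    exact ⟨b, a, h4, h1, h5, h2, h3, h6, Or.inl ⟨hyperF hfree', rfl, rfl⟩⟩

/-! ### Chains of leaves with fixed endpoints -/

theorem IsFixedGap.right_unique {k : Circle ≃ₜ Circle} {a b b' : Circle} (h : IsFixedGap k a b)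
    (h' : IsFixedGap k a b') : b = b' := by
  have h1 := (h.lt_of_fixed h'.right).resolve_left h'.ne.symm
  have h2 := (h'.lt_of_fixed h.right).resolve_left h.ne.symm
  exact pos_inj.1 (le_antisymm h1 h2)

theorem IsFixedGap.left_unique {k : Circle ≃ₜ Circle} {a a' b : Circle} (h : IsFixedGap k a b)
    (h' : IsFixedGap k a' b) : a = a' := by
  by_contra hne
  rcases CCW.of_ne hne h'.ne h.ne.symm with e | e
  · exact h.free _ e h'.left
  · exact h'.free _ e.rotate h.left

theorem IsFixedGap.eq_of_mem {k : Circle ≃ₜ Circle} {a b a' b' z : Circle} (h : IsFixedGap k a b)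
    (h' : IsFixedGap k a' b') (hz : CCW a z b) (hz' : CCW a' z b') : a = a' ∧ b = b' := by
  have h1 : ¬ CCW a a' b := fun e => h.free _ e h'.left
  have h2 : ¬ CCW a b' b := fun e => h.free _ e h'.right
  have h3 : ¬ CCW a' a b' := fun e => h'.free _ e h.left
  have h4 : ¬ CCW a' b b' := fun e => h'.free _ e h.right
  simp only [ccw_iff a, pos_self] at hz hz' h1 h2 h3 h4
  have g1 := pos_nonneg a a'
  have g2 := pos_nonneg a b'
  have g3 := pos_nonneg a z
  have g4 := pos_nonneg a b
  have e1 : pos a a' = 0 := by grind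
  have e2 : a' = a := by rw [← pos_inj (p := a), e1, pos_self]
  subst e2
  exact ⟨rfl, h.right_unique h'⟩

/-- A sequence of fixed points joined consecutively by leaves of `L`, such that the arcs in between
contain no fixed endpoint of `L`. -/
structure IsFixedChain (L : Set GoodInterval) (k : Circle ≃ₜ Circle) (c : ℤ → Circle) : Prop where
  lf : ∀ i, Lf L (c i) (c (i + 1))
  fixed : ∀ i, k (c i) = c i
  free : ∀ i z, CCW (c i) z (c (i + 1)) → k z = z → ∀ y, ¬ Lf L z y

/-- The set of the intervals `(c i, c (i + 1))`. -/
def chainSides (c : ℤ → Circle) : Set GoodInterval :=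
  {I | ∃ i, I.left = c i ∧ I.right = c (i + 1)}

/-- The exceptional points of the sequence `c`: those that are neither terms nor between consecutive
terms. -/
def ends (c : ℤ → Circle) : Set Circle := {z | ∀ i, z ≠ c i ∧ ¬ CCW (c i) z (c (i + 1))}

theorem strictMono_of_mem_ends {c : ℤ → Circle} (hne : ∀ i, c i ≠ c (i + 1)) {w : Circle}
    (hw : w ∈ ends c) : StrictMono fun i => pos w (c i) := by
  refine strictMono_int_of_lt_succ fun i => ?_
  have h1 := (hw i).2
  have h2 := pos_pos (hw (i + 1)).1.symm
  rw [ccw_base_right, not_and, not_lt] at h1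
  exact lt_of_le_of_ne (h1 h2) fun e => hne i (pos_inj.1 e)

theorem injective_of_mem_ends {c : ℤ → Circle} (hne : ∀ i, c i ≠ c (i + 1)) {w : Circle}
    (hw : w ∈ ends c) : Function.Injective c := fun i j e =>
  (strictMono_of_mem_ends hne hw).injective (by simp only [e])

/-- At an exceptional point, the sequence increases to some limit and decreases to some limit. -/
theorem limits_of_mem_ends {c : ℤ → Circle} (hne : ∀ i, c i ≠ c (i + 1)) {w : Circle}
    (hw : w ∈ ends c) : ∃ s s', s' < s ∧ 0 ≤ s' ∧ s ≤ 2 * Real.pi ∧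
      (∀ n : ℕ, pos w (c n) < s) ∧ (∀ n : ℕ, s' < pos w (c (-n))) ∧
      Tendsto (fun n : ℕ => pos w (c n)) atTop (𝓝 s) ∧
      Tendsto (fun n : ℕ => pos w (c (-n))) atTop (𝓝 s') := by
  have hm := strictMono_of_mem_ends hne hw
  have hu : StrictMono fun n : ℕ => pos w (c n) := fun m n h => hm (by exact_mod_cast h)
  have hd : StrictAnti fun n : ℕ => pos w (c (-n)) := fun m n h => hm (by omega)
  have hbu : BddAbove (range fun n : ℕ => pos w (c n)) :=
    ⟨2 * Real.pi, by rintro _ ⟨n, rfl⟩; exact (pos_lt _ _).le⟩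
  have hbd : BddBelow (range fun n : ℕ => pos w (c (-n))) :=
    ⟨0, by rintro _ ⟨n, rfl⟩; exact pos_nonneg _ _⟩
  have h1 : ∀ n : ℕ, pos w (c n) < ⨆ n : ℕ, pos w (c n) := fun n =>
    (hu (Nat.lt_succ_self n)).trans_le (le_ciSup hbu (n + 1))
  have h2 : ∀ n : ℕ, ⨅ n : ℕ, pos w (c (-n)) < pos w (c (-n)) := fun n =>
    (ciInf_le hbd (n + 1)).trans_lt (hd (Nat.lt_succ_self n))
  have h10 := h1 0
  have h20 := h2 0
  simp only [Nat.cast_zero, neg_zero] at h10 h20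
  exact ⟨_, _, h20.trans h10, le_ciInf fun n => pos_nonneg _ _, ciSup_le fun n => (pos_lt _ _).le,
    h1, h2, tendsto_atTop_ciSup hu.monotone hbu, tendsto_atTop_ciInf hd.antitone hbd⟩

theorem left_mem_of_subset {I J : GoodInterval} (h : I.arc ⊆ J.arc) :
    I.left = J.left ∨ I.left ∈ J.arc := by
  have h1 := GoodInterval.arc_subset_iff.1 h
  by_cases e : I.left = J.left
  · exact Or.inl e
  · exact Or.inr (ccw_base.2 ⟨pos_pos e, h1.1.trans_le h1.2⟩)

theorem right_mem_of_subset {I J : GoodInterval} (h : I.arc ⊆ J.arc) :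
    I.right = J.right ∨ I.right ∈ J.arc := by
  have h1 := GoodInterval.arc_subset_iff.1 h
  have h0 := pos_nonneg J.left I.left
  rcases h1.2.lt_or_eq with e | e
  · exact Or.inr (ccw_base.2 ⟨h0.trans_lt h1.1, e⟩)
  · exact Or.inl (pos_inj.1 e)

section Chain

variable {L : Set GoodInterval} {k : Circle ≃ₜ Circle} {c : ℤ → Circle}

theorem IsFixedChain.ne (h : IsFixedChain L k c) (i : ℤ) : c i ≠ c (i + 1) := (h.lf i).1

theorem IsFixedChain.notMem (h : IsFixedChain L k c) (i j : ℤ) : ¬ CCW (c i) (c j) (c (i + 1)) :=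
  fun e => h.free i _ e (h.fixed j) _ (h.lf j)

/-- A leaf at a term of a chain ends at a neighbouring term. -/
theorem IsFixedChain.eq_of_lf (hL : IsTame L) (hk : OrientationPreserving k)
    (hkL : Preserves k L) (h : IsFixedChain L k c) {i : ℤ} {y : Circle} (hy : Lf L (c i) y) :
    y = c (i + 1) ∨ y = c (i - 1) := by
  by_contra hcon
  rw [not_or] at hcon
  have hyf := hL.fixed_of_lf hk hkL (h.fixed i) hy
  have hp := h.lf (i - 1)
  have hpn := h.notMem (i - 1) (i + 1)
  have n2 := h.free (i - 1) y
  rw [sub_add_cancel] at hp hpn n2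
  have n1 : ¬ CCW (c i) y (c (i + 1)) := fun e => h.free i y e hyf _ (hy.symm hL.lam)
  replace n2 : ¬ CCW (c (i - 1)) y (c i) := fun e => n2 e hyf _ (hy.symm hL.lam)
  have h1 : CCW (c i) (c (i + 1)) y :=
    ((CCW.of_ne (h.ne i) (Ne.symm hcon.1) hy.1.symm).resolve_right
      fun e => n1 e.rotate.rotate)
  have h2 : CCW (c i) y (c (i - 1)) :=
    ((CCW.of_ne hy.1 hcon.2 hp.1).resolve_right fun e => n2 e)
  exact hL.no_three (h.lf i) hy (hp.symm hL.lam) h1 h2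

/-- No leaf separates two terms of a chain. -/
theorem IsFixedChain.half (hL : IsTame L) (hk : OrientationPreserving k)
    (hkL : Preserves k L) (h : IsFixedChain L k c) {I : GoodInterval} (hI : I ∈ L) :
    Disjoint I.arc (range c) ∨ Disjoint I.opp.arc (range c) := by
  have key : ∀ i, ∀ J : GoodInterval, J.left = c i → J.right = c (i + 1) →
      Disjoint J.arc (range c) := by
    intro i J hl hr
    rw [Set.disjoint_right]
    rintro _ ⟨j, rfl⟩ e
    rw [GoodInterval.mem_arc, hl, hr] at e
    exact h.notMem i j e
  by_cases hend : ∃ i, c i = I.left ∨ c i = I.right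
  · obtain ⟨i, hi | hi⟩ := hend
    · have := h.eq_of_lf hL hk hkL (hi ▸ Lf.of_mem hI)
      rcases this with e | e
      · exact Or.inl (key i I hi.symm e)
      · exact Or.inr (key (i - 1) I.opp e (by rw [sub_add_cancel]; exact hi.symm))
    · have := h.eq_of_lf hL hk hkL (hi ▸ (Lf.of_mem hI).symm hL.lam)
      rcases this with e | e
      · exact Or.inr (key i I.opp hi.symm e)
      · exact Or.inl (key (i - 1) I e (by rw [sub_add_cancel]; exact hi.symm))
  · push Not at hend
    have hor : ∀ i, c i ∈ I.arc ∨ c i ∈ I.opp.arc := fun i => by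
      rcases I.mem_or (c i) with e | e | e | e
      · exact Or.inl e
      · exact Or.inr e
      · exact absurd e (hend i).1
      · exact absurd e (hend i).2
    have hstep : ∀ i, c i ∈ I.arc ↔ c (i + 1) ∈ I.arc := by
      intro i
      constructor
      · intro e
        refine (hor (i + 1)).resolve_right fun e' => ?_
        exact hL.lam.not_linked (h.lf i) (Lf.of_mem hI) e e'
      · intro e
        refine (hor i).resolve_right fun e' => ?_
        exact hL.lam.not_linked ((h.lf i).symm hL.lam) (Lf.of_mem hI) e e'
    have hall : ∀ i, c i ∈ I.arc ↔ c 0 ∈ I.arc := by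
      intro i
      induction i with
      | zero => rfl
      | succ n ih => rw [← hstep, ih]
      | pred n ih => rw [← ih, hstep, sub_add_cancel]
    by_cases h0 : c 0 ∈ I.arc
    · right
      rw [Set.disjoint_right]
      rintro _ ⟨i, rfl⟩ e
      exact Set.disjoint_left.1 I.disjoint_opp ((hall i).2 h0) e
    · left
      rw [Set.disjoint_right]
      rintro _ ⟨i, rfl⟩ e
      exact h0 ((hall i).1 e)

/-- The intervals of a chain of leaves form a gap, and at most one point is neither a term of the
chain nor inside one of the intervals. Indeed the intervals avoiding the chain select a gap that
contains them, and at a further point outside them the terms of the chain accumulate from both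
sides. -/
theorem IsFixedChain.isGap (hL : IsTame L) (hk : OrientationPreserving k)
    (hkL : Preserves k L) (h : IsFixedChain L k c) :
    IsGap L (chainSides c) ∧ (ends c).Subsingleton ∧ ∀ w ∈ ends c, k w = w := by
  have hS := isSelection_avoiding (P := range c) (h.ne 0) (mem_range_self _) (mem_range_self _)
    (fun I hI => h.half hL hk hkL hI) hL.lam.opp_mem
  have hgap := hS.isGap hL.lam
  have hPv := subset_vertexSet_avoiding (L := L) (P := range c)
  set Q := maximalIntervals {I | I ∈ L ∧ Disjoint I.arc (range c)} with hQ
  have hcv : ∀ i, c i ∈ vertexSet Q := fun i => hPv (mem_range_self i)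
  have hside : ∀ i, (⟨c i, c (i + 1), h.ne i⟩ : GoodInterval) ∈ Q := by
    intro i
    refine ⟨⟨(h.lf i).2, ?_⟩, fun J hJ hIJ => GoodInterval.eq_of_arc_eq (subset_antisymm ?_ hIJ)⟩
    · rw [Set.disjoint_right]
      rintro _ ⟨j, rfl⟩ e
      exact h.notMem i j e
    · rcases GoodInterval.subset_or_of_notMem (A := J) (I := ⟨c i, c (i + 1), h.ne i⟩)
        (fun e => Set.disjoint_left.1 hJ.2 e (mem_range_self _))
        (fun e => Set.disjoint_left.1 hJ.2 e (mem_range_self _)) with e | e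
      · exact e
      · obtain ⟨z, hz⟩ := (⟨c i, c (i + 1), h.ne i⟩ : GoodInterval).nonempty_arc
        exact absurd (e (hIJ hz)) (Set.disjoint_left.1 (GoodInterval.disjoint_opp _) hz)
  obtain ⟨P, hP, hsides⟩ := hL.full.exists_sides hL.lam hgap
  have hends : ∀ w ∈ ends c, w ∈ P ∧ k w = w := by
    intro w hw
    obtain ⟨s, s', hss, hs', hs, hlt, hlt', ht, ht'⟩ := limits_of_mem_ends h.ne hw
    have hlim : lift w s ∈ vertexSet Q :=
      (isClosed_vertexSet Q).mem_of_tendsto (((continuous_lift w).tendsto s).comp ht)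
        (Eventually.of_forall fun n => by rw [Function.comp, lift_pos]; exact hcv n)
    have hlim' : lift w s' ∈ vertexSet Q :=
      (isClosed_vertexSet Q).mem_of_tendsto (((continuous_lift w).tendsto s').comp ht')
        (Eventually.of_forall fun n => by rw [Function.comp, lift_pos]; exact hcv _)
    have hPs : lift w s ∈ P := by
      by_contra hn
      obtain ⟨-, I, hI, hIr⟩ := hsides _ hlim hn
      exact no_limit_left ht hlt (fun n => by rw [lift_pos]; exact hcv n) hI hIr
    have hPs' : lift w s' ∈ P := by
      by_contra hn
      obtain ⟨⟨I, hI, hIl⟩, -⟩ := hsides _ hlim' hn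
      exact no_limit_right ht' hlt' (fun n => by rw [lift_pos]; exact hcv _) hI hIl
    have hs2 : s = 2 * Real.pi := by
      by_contra hne
      exact lift_ne hss (by linarith [lt_of_le_of_ne hs hne]) (hP hPs' hPs)
    subst hs2
    rw [lift_two_pi] at hPs
    refine ⟨hPs, ?_⟩
    have hcl : IsClosed (Fix k) := isClosed_fixedPoints k.continuous
    have : lift w (2 * Real.pi) ∈ Fix k :=
      hcl.mem_of_tendsto (((continuous_lift w).tendsto _).comp ht)
        (Eventually.of_forall fun n => by rw [Function.comp, lift_pos]; exact h.fixed n)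
    rwa [lift_two_pi] at this
  have hQc : Q = chainSides c := by
    ext J
    constructor
    · intro hJ
      obtain ⟨u, v, huv, hu, hv⟩ := J.exists_two
      obtain ⟨z, hz, hzP⟩ : ∃ z ∈ J.arc, z ∉ P := by
        by_cases e : u ∈ P
        · exact ⟨v, hv, fun e' => huv (hP e e')⟩
        · exact ⟨u, hu, e⟩
      have hzc : z ∉ ends c := fun e => hzP (hends z e).1
      simp only [ends, mem_ofPred_eq, not_forall] at hzc
      obtain ⟨i, hi⟩ := hzc
      by_cases e : z = c i
      · exact absurd (e ▸ hz) (mem_vertexSet.1 (hcv i) J hJ)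
      · have : CCW (c i) z (c (i + 1)) := by
          by_contra e'; exact hi ⟨e, e'⟩
        have := hgap.eq_of_mem hJ (hside i) hz this
        exact ⟨i, by rw [this], by rw [this]⟩
    · rintro ⟨i, hl, hr⟩
      have : J = ⟨c i, c (i + 1), h.ne i⟩ := GoodInterval.ext hl hr
      rw [this]
      exact hside i
  rw [hQc] at hgap
  exact ⟨hgap, fun x hx y hy => hP (hends x hx).1 (hends y hy).1, fun w hw => (hends w hw).2⟩

theorem mem_vertexSet_chainSides (hne : ∀ i, c i ≠ c (i + 1))
    (hc : ∀ i j, ¬ CCW (c i) (c j) (c (i + 1))) {z : Circle} :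
    z ∈ vertexSet (chainSides c) ↔ z ∈ range c ∨ z ∈ ends c := by
  rw [mem_vertexSet]
  constructor
  · intro hz
    by_cases e : z ∈ range c
    · exact Or.inl e
    · exact Or.inr fun i => ⟨fun e' => e ⟨i, e'.symm⟩, fun e' => hz ⟨c i, c (i + 1), hne i⟩
        ⟨i, rfl, rfl⟩ e'⟩
  · rintro (⟨j, rfl⟩ | hz) I ⟨i, hl, hr⟩ e
    · rw [GoodInterval.mem_arc, hl, hr] at e; exact hc i j e
    · rw [GoodInterval.mem_arc, hl, hr] at e; exact (hz i).2 e

/-- No leaf ends at an exceptional point of a chain. -/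
theorem IsFixedChain.not_lf_of_mem_ends (hL : IsTame L) (hk : OrientationPreserving k)
    (hkL : Preserves k L) (h : IsFixedChain L k c) {w : Circle} (hw : w ∈ ends c) (y : Circle) :
    ¬ Lf L w y := by
  intro hwy
  obtain ⟨J, ⟨i, hl, hr⟩, e⟩ := (h.isGap hL hk hkL).1.lies _ hwy.2
  have hJ : w = J.left ∨ w = J.right ∨ w ∈ J.arc := by
    rcases e with e | e
    · exact (left_mem_of_subset e).imp id Or.inr
    · exact Or.inr (right_mem_of_subset e)
  rcases hJ with e | e | e
  · exact (hw i).1 (e.trans hl)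
  · exact (hw (i + 1)).1 (e.trans hr)
  · rw [GoodInterval.mem_arc, hl, hr] at e
    exact (hw i).2 e

/-- The gap of a chain is a crown if the chain has an exceptional point, and an ideal polygon
otherwise. -/
theorem IsFixedChain.crown_or_polygon (hL : IsTame L) (hk : OrientationPreserving k)
    (hkL : Preserves k L) (h : IsFixedChain L k c) :
    ((ends c).Nonempty → IsCrown L (chainSides c)) ∧
      (ends c = ∅ → IsIdealPolygon L (chainSides c)) := by
  have hgap := (h.isGap hL hk hkL).1
  have hv : ∀ z, z ∈ vertexSet (chainSides c) ↔ z ∈ range c ∨ z ∈ ends c := fun z =>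
    mem_vertexSet_chainSides h.ne h.notMem
  constructor
  · rintro ⟨w, hw⟩
    refine (hL.full _ hgap).resolve_left fun hp => ?_
    have hinj := injective_of_mem_ends h.ne hw
    exact (infinite_range_of_injective hinj) (hp.2.subset fun z hz => (hv z).2 (Or.inl hz))
  · intro he
    refine (hL.full _ hgap).resolve_right fun hcr => ?_
    obtain ⟨p, hp, hp', -⟩ := hcr.exists_pivot
    rw [hv, he] at hp
    rcases hp with ⟨i, rfl⟩ | hp
    · exact (hp' ⟨c i, c (i + 1), h.ne i⟩ ⟨i, rfl, rfl⟩).1 rfl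
    · exact hp

end Chain

/-! ### Zigzags: the fixed point set of a pseudo-Anosov-like automorphism -/

/-- The fixed points of `k` listed counter-clockwise, up to accumulation points, when those of even
index are joined consecutively by leaves of `L₁` and those of odd index by leaves of `L₂`. The
sequence is periodic if there are finitely many fixed points. -/
structure IsZigzag (L₁ L₂ : Set GoodInterval) (k : Circle ≃ₜ Circle) (P : ℤ → Circle) : Prop where
  gap : ∀ i, IsFixedGap k (P i) (P (i + 1))
  even : ∀ i, Lf L₁ (P (2 * i)) (P (2 * i + 2))
  odd : ∀ i, Lf L₂ (P (2 * i + 1)) (P (2 * i + 3))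

section Zigzag

variable {L₁ L₂ : Set GoodInterval} {k : Circle ≃ₜ Circle} {P : ℤ → Circle}

/-- Shifting the index by one exchanges the two laminations. -/
theorem IsZigzag.shift (h : IsZigzag L₁ L₂ k P) : IsZigzag L₂ L₁ k (fun i => P (i + 1)) where
  gap := fun i => h.gap (i + 1)
  even := fun i => by
    have := h.odd i
    convert this using 2
    ring
  odd := fun i => by
    have := h.even (i + 1)
    convert this using 2 <;> ring

theorem IsZigzag.inv (h : IsZigzag L₁ L₂ k P) : IsZigzag L₁ L₂ k⁻¹ P :=
  ⟨fun i => (h.gap i).inv, h.even, h.odd⟩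

theorem IsZigzag.eq_succ (h : IsZigzag L₁ L₂ k P) {i j : ℤ} (e : P i = P j) :
    P (i + 1) = P (j + 1) := by
  have := h.gap j
  rw [← e] at this
  exact (h.gap i).right_unique this

theorem IsZigzag.eq_pred (h : IsZigzag L₁ L₂ k P) {i j : ℤ} (e : P i = P j) :
    P (i - 1) = P (j - 1) := by
  have h1 := h.gap (i - 1)
  have h2 := h.gap (j - 1)
  rw [sub_add_cancel] at h1 h2
  rw [← e] at h2
  exact h1.left_unique h2

theorem IsZigzag.ne_add_two (h : IsZigzag L₁ L₂ k P) (i : ℤ) : P i ≠ P (i + 2) := by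
  obtain ⟨j, rfl | rfl⟩ := Int.even_or_odd' i
  · exact (h.even j).1
  · have := (h.odd j).1
    rwa [show 2 * j + 3 = 2 * j + 1 + 2 by ring] at this

theorem IsZigzag.ccw (h : IsZigzag L₁ L₂ k P) (i : ℤ) : CCW (P i) (P (i + 1)) (P (i + 2)) := by
  have h1 := h.gap (i + 1)
  rw [show i + 1 + 1 = i + 2 by ring] at h1
  rcases CCW.of_ne (h.gap i).ne h1.ne (h.ne_add_two i).symm with e | e
  · exact e
  · exact absurd (h.gap i).left (h1.free _ e.rotate)

/-- The arc between terms two steps apart contains a single fixed point. -/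
theorem IsZigzag.eq_of_fixed (h : IsZigzag L₁ L₂ k P) {i : ℤ} {z : Circle}
    (hz : CCW (P i) z (P (i + 2))) (hf : k z = z) : z = P (i + 1) := by
  by_contra e
  have h0 := h.ccw i
  have h1 := h.gap i
  have h2 := h.gap (i + 1)
  rw [show i + 1 + 1 = i + 2 by ring] at h2
  have n1 : ¬ CCW (P i) z (P (i + 1)) := fun e => h1.free z e hf
  have n2 : ¬ CCW (P (i + 1)) z (P (i + 2)) := fun e => h2.free z e hf
  rw [← pos_inj (p := P i)] at e
  simp only [ccw_iff (P i), pos_self] at h0 hz n1 n2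
  have := pos_nonneg (P i) z
  have := pos_nonneg (P i) (P (i + 1))
  grind

theorem IsZigzag.chain_even (hC : IsPseudoFibered L₁ L₂) (h : IsZigzag L₁ L₂ k P) :
    IsFixedChain L₁ k (fun i => P (2 * i)) where
  lf := fun i => by
    have := h.even i
    convert this using 2
    ring
  fixed := fun i => (h.gap _).left
  free := fun i z hz hf y hy => by
    rw [show 2 * (i + 1) = 2 * i + 2 by ring] at hz
    have := h.eq_of_fixed hz hf
    rw [this] at hy
    exact hC.disjoint_endpoints hy (h.odd i)

theorem IsZigzag.chain_odd (hC : IsPseudoFibered L₁ L₂) (h : IsZigzag L₁ L₂ k P) :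
    IsFixedChain L₂ k (fun i => P (2 * i + 1)) :=
  h.shift.chain_even hC.symm

/-- The exceptional points of the sequence and of its even part agree. -/
theorem IsZigzag.ends_even (h : IsZigzag L₁ L₂ k P) : ends (fun i => P (2 * i)) = ends P := by
  ext z
  constructor
  · intro hz i
    obtain ⟨j, rfl | rfl⟩ := Int.even_or_odd' i
    · refine ⟨(hz j).1, fun e => (hz j).2 ?_⟩
      have h0 := h.ccw (2 * j)
      change CCW (P (2 * j)) z (P (2 * (j + 1)))
      rw [show 2 * (j + 1) = 2 * j + 2 by ring]
      rw [ccw_base] at e h0 ⊢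
      exact ⟨e.1, e.2.trans h0.2⟩
    · have h0 := h.ccw (2 * j)
      have h1 : ¬ CCW (P (2 * j)) z (P (2 * (j + 1))) := (hz j).2
      rw [show 2 * (j + 1) = 2 * j + 2 by ring] at h1
      refine ⟨fun e => h1 (e ▸ h0), fun e => h1 ?_⟩
      rw [show 2 * j + 1 + 1 = 2 * j + 2 by ring] at e
      simp only [ccw_iff (P (2 * j)), pos_self] at h0 e ⊢
      have := pos_nonneg (P (2 * j)) z
      have := pos_nonneg (P (2 * j)) (P (2 * j + 1))
      grind
  · intro hz i
    refine ⟨(hz (2 * i)).1, fun e => ?_⟩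
    change CCW (P (2 * i)) z (P (2 * (i + 1))) at e
    rw [show 2 * (i + 1) = 2 * i + 2 by ring] at e
    have h0 := h.ccw (2 * i)
    have h1 := (hz (2 * i)).2
    have h2 := (hz (2 * i + 1))
    rw [show 2 * i + 1 + 1 = 2 * i + 2 by ring, ne_eq, ← pos_inj (p := P (2 * i))] at h2
    simp only [ccw_iff (P (2 * i)), pos_self] at h0 h1 h2 e
    have := pos_nonneg (P (2 * i)) z
    have := pos_nonneg (P (2 * i)) (P (2 * i + 1))
    grind

theorem ends_shift (P : ℤ → Circle) : ends (fun i => P (i + 1)) = ends P := by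
  ext z
  constructor
  · intro hz i
    have := hz (i - 1)
    simp only [sub_add_cancel] at this
    exact this
  · exact fun hz i => hz (i + 1)

theorem IsZigzag.ends_odd (h : IsZigzag L₁ L₂ k P) : ends (fun i => P (2 * i + 1)) = ends P := by
  rw [← ends_shift P]
  exact h.shift.ends_even

end Zigzag

/-! ### Existence of zigzags -/

/-- A point that is moved by a homeomorphism with at least two fixed points lies in a component of
the complement of the fixed point set. -/
theorem exists_isFixedGap {k : Circle ≃ₜ Circle} {p q z : Circle} (hp : k p = p) (hq : k q = q)
    (hpq : p ≠ q) (hz : k z ≠ z) : ∃ a b, IsFixedGap k a b ∧ CCW a z b := by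
  have hcl : IsClosed {s : ℝ | k (lift p s) = lift p s} :=
    isClosed_eq (k.continuous.comp (continuous_lift p)) (continuous_lift p)
  have hz0 := pos_nonneg p z
  have hz1 := pos_lt p z
  obtain ⟨s, ⟨⟨hs0, hs1⟩, hs⟩, hsm⟩ := ((isCompact_Icc (a := 0) (b := pos p z)).inter_right
    hcl).exists_isGreatest ⟨0, ⟨le_rfl, hz0⟩, by simp only [mem_ofPred_eq, lift_zero, hp]⟩
  obtain ⟨t, ⟨⟨ht0, ht1⟩, ht⟩, htm⟩ := ((isCompact_Icc (a := pos p z) (b := 2 * Real.pi)).inter_right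
    hcl).exists_isLeast ⟨2 * Real.pi, ⟨hz1.le, le_rfl⟩, by simp only [mem_ofPred_eq, lift_two_pi, hp]⟩
  have hs2 : s < pos p z := lt_of_le_of_ne hs1 fun e => hz (by
    have : k (lift p s) = lift p s := hs
    rwa [e, lift_pos] at this)
  have ht2 : pos p z < t := lt_of_le_of_ne ht0 fun e => hz (by
    have : k (lift p t) = lift p t := ht
    rwa [← e, lift_pos] at this)
  have hq' : k (lift p (pos p q)) = lift p (pos p q) := by rw [lift_pos, hq]
  have hq0 := pos_pos hpq.symm
  have hlt : t < s + 2 * Real.pi := by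
    rcases lt_or_ge (pos p z) (pos p q) with e | e
    · have := htm ⟨⟨e.le, (pos_lt _ _).le⟩, hq'⟩
      linarith [pos_lt p q]
    · have := hsm ⟨⟨hq0.le, e⟩, hq'⟩
      linarith
  have hc := fun w => ccw_lift_iff (z := w) (a := p) hs0 (hs2.trans ht2) ht1 hlt
  refine ⟨lift p s, lift p t, ⟨lift_ne (hs2.trans ht2) hlt, hs, ht, fun w hw hf => ?_⟩,
    (hc z).2 ⟨hs2, ht2⟩⟩
  rw [hc] at hw
  have hf' : k (lift p (pos p w)) = lift p (pos p w) := by rw [lift_pos, hf]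
  rcases le_total (pos p w) (pos p z) with e | e
  · exact absurd (hsm ⟨⟨pos_nonneg _ _, e⟩, hf'⟩) (not_le.2 hw.1)
  · exact absurd (htm ⟨⟨e, (pos_lt _ _).le⟩, hf'⟩) (not_le.2 hw.2)

/-- Membership in `autPair L₁ L₂`, as a structure. -/
structure IsAut (L₁ L₂ : Set GoodInterval) (k : Circle ≃ₜ Circle) : Prop where
  orient : OrientationPreserving k
  left : Preserves k L₁
  right : Preserves k L₂

theorem mem_autPair {L₁ L₂ : Set GoodInterval} {k : Circle ≃ₜ Circle} :
    k ∈ autPair L₁ L₂ ↔ IsAut L₁ L₂ k :=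
  ⟨fun h => ⟨h.1.1, h.1.2, h.2.2⟩, fun h => ⟨⟨h.1, h.2⟩, h.1, h.3⟩⟩

theorem IsAut.inv {L₁ L₂ : Set GoodInterval} {k : Circle ≃ₜ Circle} (h : IsAut L₁ L₂ k) :
    IsAut L₁ L₂ k⁻¹ := ⟨h.1.inv, h.2.inv, h.3.inv⟩

theorem IsAut.symm {L₁ L₂ : Set GoodInterval} {k : Circle ≃ₜ Circle} (h : IsAut L₁ L₂ k) :
    IsAut L₂ L₁ k := ⟨h.1, h.3, h.2⟩

section

variable {L₁ L₂ : Set GoodInterval} {k : Circle ≃ₜ Circle} {a b : Circle}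

/-- The components next to a given one move the other way, and, unless there are just two fixed
points, leaves of the two laminations span the unions of the component with its two neighbours. -/
theorem IsPseudoFibered.neighbours (hC : IsPseudoFibered L₁ L₂) (hk : IsAut L₁ L₂ k)
    (hab : IsFixedGap k a b) :
    ∃ a' b', IsFixedGap k a' a ∧ IsFixedGap k b b' ∧
      (MovesForward k a b → MovesForward k⁻¹ a' a ∧ MovesForward k⁻¹ b b') ∧
      (Fix k ≠ {a, b} → (Lf L₁ a b' ∧ Lf L₂ a' b) ∨ (Lf L₂ a b' ∧ Lf L₁ a' b)) := by
  rcases hab.forward_or hk.1 with hf | hf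
  · obtain ⟨a', b', h1, h2, h3, h4, -, -, h5⟩ := hC.step hk.1 hk.2 hk.3 hab hf
    exact ⟨a', b', h1, h2, fun _ => ⟨h3, h4⟩, fun hne => h5.resolve_left fun e => hne e.1⟩
  · obtain ⟨a', b', h1, h2, h3, h4, -, -, h5⟩ := hC.step hk.inv.1 hk.inv.2 hk.inv.3 hab.inv hf
    refine ⟨a', b', by simpa using h1.inv, by simpa using h2.inv,
      fun e => absurd hf (e.not_inv hk.1 hab), fun hne => h5.resolve_left fun e => hne ?_⟩
    rw [← Fix_inv]; exact e.1

/-- With exactly two fixed points, a laminar automorphism is hyperbolic. -/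
theorem IsPseudoFibered.isHyperbolic (hC : IsPseudoFibered L₁ L₂) (hk : IsAut L₁ L₂ k)
    (hab : IsFixedGap k a b) (hF : Fix k = {a, b}) : IsHyperbolic k := by
  rcases hab.forward_or hk.1 with hf | hf
  · obtain ⟨a', b', -, -, -, -, h1, h2, -⟩ := hC.step hk.1 hk.2 hk.3 hab hf
    exact ⟨b, a, hab.ne.symm, by rw [hF, pair_comm], h1, h2⟩
  · obtain ⟨a', b', -, -, -, -, h1, h2, -⟩ := hC.step hk.inv.1 hk.inv.2 hk.inv.3 hab.inv hf
    refine ⟨a, b, hab.ne, hF, ?_, IsRepelling_iff.2 h1⟩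
    have := IsRepelling_iff.1 h2
    rwa [inv_inv] at this

/-- If `k` has more than two fixed points then they form a zigzag. The successor map on the
components of the complement of the fixed point set is a permutation, and the two kinds of leaves
alternate because no point is an endpoint of both laminations. -/
theorem IsPseudoFibered.exists_zigzag (hC : IsPseudoFibered L₁ L₂) (hk : IsAut L₁ L₂ k)
    (hab : IsFixedGap k a b) (hne : ∀ a b, IsFixedGap k a b → Fix k ≠ {a, b}) :
    ∃ P, IsZigzag L₁ L₂ k P := by
  have hst : ∀ c : {c : Circle × Circle // IsFixedGap k c.1 c.2},
      ∃ d : {c : Circle × Circle // IsFixedGap k c.1 c.2}, d.1.1 = c.1.2 := by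
    rintro ⟨⟨a, b⟩, h⟩
    obtain ⟨-, b', -, h2, -⟩ := hC.neighbours hk h
    exact ⟨⟨⟨b, b'⟩, h2⟩, rfl⟩
  choose nx hnx using hst
  have hbij : Function.Bijective nx := by
    constructor
    · rintro ⟨⟨a, b⟩, h⟩ ⟨⟨c, d⟩, h'⟩ e
      have e1 := hnx ⟨⟨a, b⟩, h⟩
      rw [e, hnx ⟨⟨c, d⟩, h'⟩] at e1
      simp only at e1
      subst e1
      have := h.left_unique h'
      subst this
      rfl
    · rintro ⟨⟨a, b⟩, h⟩
      obtain ⟨a', -, h2, -⟩ := hC.neighbours hk h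
      refine ⟨⟨⟨a', a⟩, h2⟩, ?_⟩
      have e1 := hnx ⟨⟨a', a⟩, h2⟩
      rcases hx : nx ⟨⟨a', a⟩, h2⟩ with ⟨⟨c, d⟩, h'⟩
      rw [hx] at e1
      simp only at e1
      subst e1
      have := h.right_unique h'
      subst this
      rfl
  let σ : Equiv.Perm {c : Circle × Circle // IsFixedGap k c.1 c.2} := Equiv.ofBijective nx hbij
  let P : ℤ → Circle := fun i => ((σ ^ i) ⟨⟨a, b⟩, hab⟩).1.1
  have hP : ∀ i, IsFixedGap k (P i) (P (i + 1)) := by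
    intro i
    have : P (i + 1) = ((σ ^ i) ⟨⟨a, b⟩, hab⟩).1.2 := by
      change ((σ ^ (i + 1)) _).1.1 = _
      rw [add_comm, zpow_add, zpow_one]
      exact hnx _
    rw [this]
    exact ((σ ^ i) ⟨⟨a, b⟩, hab⟩).2
  have halt : ∀ i, (Lf L₁ (P i) (P (i + 2)) ∧ Lf L₂ (P (i - 1)) (P (i + 1))) ∨
      (Lf L₂ (P i) (P (i + 2)) ∧ Lf L₁ (P (i - 1)) (P (i + 1))) := by
    intro i
    obtain ⟨a', b', h1, h2, -, h3⟩ := hC.neighbours hk (hP i)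
    have h4 := hP (i - 1)
    have h5 := hP (i + 1)
    rw [sub_add_cancel] at h4
    rw [show i + 1 + 1 = i + 2 by ring] at h5
    rw [h4.left_unique h1, h5.right_unique h2]
    exact h3 (hne _ _ (hP i))
  have main : ∀ P : ℤ → Circle, (∀ i, IsFixedGap k (P i) (P (i + 1))) →
      (∀ i, (Lf L₁ (P i) (P (i + 2)) ∧ Lf L₂ (P (i - 1)) (P (i + 1))) ∨
        (Lf L₂ (P i) (P (i + 2)) ∧ Lf L₁ (P (i - 1)) (P (i + 1)))) →
      Lf L₁ (P 0) (P 2) → IsZigzag L₁ L₂ k P := by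
    intro P hP halt h0
    have key : ∀ j : ℤ, Lf L₁ (P (2 * j)) (P (2 * j + 2)) ∧ Lf L₂ (P (2 * j + 1)) (P (2 * j + 3)) := by
      have h1 : ∀ j : ℤ, Lf L₁ (P (2 * j)) (P (2 * j + 2)) →
          Lf L₂ (P (2 * j + 1)) (P (2 * j + 3)) := by
        intro j hj
        rcases halt (2 * j + 1) with ⟨-, e⟩ | ⟨e, -⟩
        · rw [show 2 * j + 1 - 1 = 2 * j by ring] at e
          exact (hC.disjoint_endpoints hj e).elim
        · rwa [show 2 * j + 1 + 2 = 2 * j + 3 by ring] at e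
      have h2 : ∀ j : ℤ, Lf L₁ (P (2 * j)) (P (2 * j + 2)) →
          Lf L₁ (P (2 * (j + 1))) (P (2 * (j + 1) + 2)) := by
        intro j hj
        rcases halt (2 * (j + 1)) with ⟨e, -⟩ | ⟨-, e⟩
        · exact e
        · rw [show 2 * (j + 1) - 1 = 2 * j + 1 by ring] at e
          exact (hC.disjoint_endpoints e (h1 j hj)).elim
      have h3 : ∀ j : ℤ, Lf L₁ (P (2 * j)) (P (2 * j + 2)) →
          Lf L₁ (P (2 * (j - 1))) (P (2 * (j - 1) + 2)) := by
        intro j hj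
        rcases halt (2 * j) with ⟨-, e⟩ | ⟨e, -⟩
        · rcases halt (2 * j - 1) with ⟨e', -⟩ | ⟨-, e'⟩
          · rw [show 2 * j - 1 + 2 = 2 * j + 1 by ring] at e'
            exact (hC.disjoint_endpoints e' e).elim
          · rw [show 2 * (j - 1) = 2 * j - 1 - 1 by ring,
              show 2 * j - 1 - 1 + 2 = 2 * j - 1 + 1 by ring]
            exact e'
        · exact (hC.disjoint_endpoints hj e).elim
      intro j
      refine ⟨?_, h1 j ?_⟩ <;>
      · induction j with
        | zero => simpa using h0
        | succ n ih => exact h2 _ ih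
        | pred n ih => exact h3 _ ih
    exact ⟨hP, fun i => (key i).1, fun i => (key i).2⟩
  rcases halt 0 with ⟨e, -⟩ | ⟨-, e⟩
  · exact ⟨P, main P hP halt (by simpa using e)⟩
  · refine ⟨fun i => P (i - 1), main _ (fun i => ?_) (fun i => ?_) ?_⟩
    · rw [show i + 1 - 1 = i - 1 + 1 by ring]; exact hP _
    · have := halt (i - 1)
      rwa [show i - 1 + 2 = i + 2 - 1 by ring, show i - 1 + 1 = i + 1 - 1 by ring] at this
    · exact e

/-- The endpoints of the complementary component of an automorphism with two fixed points are not
endpoints of the laminations. -/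
theorem IsTame.not_lf_of_fix_pair {L : Set GoodInterval} (hL : IsTame L)
    (hk : OrientationPreserving k) (hkL : Preserves k L) (hab : a ≠ b) (hF : Fix k = {a, b})
    (y : Circle) : ¬ Lf L a y := by
  intro hy
  have ha : k a = a := by rw [← mem_Fix, hF]; simp
  have hb : k b = b := by rw [← mem_Fix, hF]; simp
  have hyf := hL.fixed_of_lf hk hkL ha hy
  rw [← mem_Fix, hF] at hyf
  rcases hyf with rfl | rfl
  · exact hy.1 rfl
  · have hg : IsFixedGap k a y := ⟨hab, ha, hb, fun z hz hf => by
      rw [← mem_Fix, hF] at hf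
      have := hz.ne
      rcases hf with rfl | rfl
      · exact this.1 rfl
      · exact this.2.1 rfl⟩
    obtain ⟨u, v, huv, hu, hv⟩ := hL.exists_crossing hk hkL hg
    exact hL.lam.not_linked huv hy hu hv

end

/-! ### Shifts of a sequence of points -/

/-- The homeomorphism `f` shifts the sequence `c` by `j` steps. -/
def Shifts (f : Circle ≃ₜ Circle) (c : ℤ → Circle) (j : ℤ) : Prop := ∀ i, f (c i) = c (i + j)

/-- A homeomorphism that maps consecutive terms of a sequence to consecutive terms is a shift,
provided that a term determines its two neighbours. -/
theorem exists_shifts {f : Circle ≃ₜ Circle} {c : ℤ → Circle}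
    (hf : ∀ i, ∃ m, f (c i) = c m ∧ f (c (i + 1)) = c (m + 1))
    (hs : ∀ i j, c i = c j → c (i + 1) = c (j + 1))
    (hp : ∀ i j, c i = c j → c (i - 1) = c (j - 1)) : ∃ m, Shifts f c m := by
  obtain ⟨m, hm, -⟩ := hf 0
  refine ⟨m, fun i => ?_⟩
  induction i with
  | zero => rw [hm, zero_add]
  | succ n ih =>
    obtain ⟨j, h1, h2⟩ := hf n
    rw [h2, show (n : ℤ) + 1 + m = n + m + 1 by ring]
    exact hs _ _ (h1.symm.trans ih)
  | pred n ih =>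
    obtain ⟨j, h1, h2⟩ := hf (-n - 1)
    rw [sub_add_cancel, ih] at h2
    have := hp _ _ h2
    rw [h1, show -(n : ℤ) - 1 + m = -n + m - 1 by ring, this, add_sub_cancel_right]

/-! ### The shape of a zigzag -/

section Zigzag

variable {L₁ L₂ : Set GoodInterval} {k : Circle ≃ₜ Circle} {P : ℤ → Circle}
  (hC : IsPseudoFibered L₁ L₂) (hk : IsAut L₁ L₂ k) (h : IsZigzag L₁ L₂ k P)

include hC hk h

theorem IsZigzag.fixed_iff {z : Circle} : k z = z ↔ z ∈ range P ∨ z ∈ ends P := by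
  constructor
  · intro hz
    by_cases e : z ∈ range P
    · exact Or.inl e
    · exact Or.inr fun i => ⟨fun e' => e ⟨i, e'.symm⟩, fun e' => (h.gap i).free z e' hz⟩
  · rintro (⟨i, rfl⟩ | hz)
    · exact (h.gap i).left
    · rw [← h.ends_even] at hz
      exact ((h.chain_even hC).isGap hC.isTame_left hk.1 hk.2).2.2 z hz

theorem IsZigzag.exists_eq {a b : Circle} (hab : IsFixedGap k a b) :
    ∃ i, a = P i ∧ b = P (i + 1) := by
  obtain ⟨z, hz⟩ := exists_ccw hab.ne
  have hzf := hab.free z hz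
  have h1 : z ∉ range P ∧ z ∉ ends P := by
    rw [Ne, h.fixed_iff hC hk, not_or] at hzf
    exact hzf
  have h2 := h1.2
  simp only [ends, mem_ofPred_eq, not_forall] at h2
  obtain ⟨i, hi⟩ := h2
  have h3 : CCW (P i) z (P (i + 1)) := by
    by_contra e
    exact hi ⟨fun e' => h1.1 ⟨i, e'.symm⟩, e⟩
  obtain ⟨e1, e2⟩ := hab.eq_of_mem (h.gap i) hz h3
  exact ⟨i, e1, e2⟩

theorem IsZigzag.ends_subsingleton : (ends P).Subsingleton := by
  rw [← h.ends_even]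
  exact ((h.chain_even hC).isGap hC.isTame_left hk.1 hk.2).2.1

theorem IsZigzag.not_lf_ends {w : Circle} (hw : w ∈ ends P) (y : Circle) :
    ¬ Lf L₁ w y ∧ ¬ Lf L₂ w y := by
  constructor
  · rw [← h.ends_even] at hw
    exact (h.chain_even hC).not_lf_of_mem_ends hC.isTame_left hk.1 hk.2 hw y
  · rw [← h.ends_odd] at hw
    exact (h.chain_odd hC).not_lf_of_mem_ends hC.isTame_right hk.1 hk.3 hw y

omit hk in
theorem IsZigzag.mem_vertexSet_even {z : Circle} :
    z ∈ vertexSet (chainSides fun i => P (2 * i)) ↔ z ∈ range (fun i => P (2 * i)) ∨ z ∈ ends P := by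
  rw [← h.ends_even]
  exact mem_vertexSet_chainSides (h.chain_even hC).ne (h.chain_even hC).notMem

omit hk in
theorem IsZigzag.mem_vertexSet_odd {z : Circle} :
    z ∈ vertexSet (chainSides fun i => P (2 * i + 1)) ↔
      z ∈ range (fun i => P (2 * i + 1)) ∨ z ∈ ends P := by
  rw [← ends_shift P]
  exact h.shift.mem_vertexSet_even hC.symm

/-- Each interval of the gap formed by the even terms contains exactly one vertex of the gap formed
by the odd terms. -/
theorem IsZigzag.interleave_aux {I : GoodInterval} (hI : I ∈ chainSides fun i => P (2 * i)) :
    ∃ x, I.arc ∩ vertexSet (chainSides fun i => P (2 * i + 1)) = {x} := by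
  obtain ⟨i, hl, hr⟩ := hI
  have harc : I.arc = {z | CCW (P (2 * i)) z (P (2 * i + 2))} := by
    ext z
    rw [GoodInterval.mem_arc, hl, hr]
    simp only [mem_ofPred_eq, mul_add, mul_one]
  refine ⟨P (2 * i + 1), Subset.antisymm ?_ ?_⟩
  · rintro z ⟨hz, hv⟩
    rw [harc] at hz
    rw [h.mem_vertexSet_odd hC] at hv
    refine h.eq_of_fixed hz ((h.fixed_iff hC hk).2 (hv.imp_left ?_))
    rintro ⟨j, rfl⟩
    exact ⟨_, rfl⟩
  · rintro z rfl
    refine ⟨?_, (h.mem_vertexSet_odd hC).2 (Or.inl ⟨i, rfl⟩)⟩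
    rw [harc]
    exact h.ccw _

omit hC hk h in
theorem chainSides_shift (c : ℤ → Circle) : chainSides (fun i => c (i + 1)) = chainSides c := by
  ext I
  constructor
  · rintro ⟨i, hl, hr⟩; exact ⟨i + 1, hl, hr⟩
  · rintro ⟨i, hl, hr⟩
    exact ⟨i - 1, by simpa using hl, by simpa using hr⟩

theorem IsZigzag.isInterleavingPair :
    IsInterleavingPair L₁ L₂ (chainSides fun i => P (2 * i)) (chainSides fun i => P (2 * i + 1)) := by
  refine ⟨((h.chain_even hC).isGap hC.isTame_left hk.1 hk.2).1,
    ((h.chain_odd hC).isGap hC.isTame_right hk.1 hk.3).1, fun I hI => h.interleave_aux hC hk hI,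
    fun I hI => ?_⟩
  obtain ⟨x, hx⟩ := h.shift.interleave_aux hC.symm hk.symm hI
  refine ⟨x, ?_⟩
  rw [← hx, ← chainSides_shift fun i => P (2 * i)]
  congr! 5 with i
  ring

theorem IsZigzag.isCrown (he : (ends P).Nonempty) :
    IsCrown L₁ (chainSides fun i => P (2 * i)) ∧ IsCrown L₂ (chainSides fun i => P (2 * i + 1)) :=
  ⟨((h.chain_even hC).crown_or_polygon hC.isTame_left hk.1 hk.2).1 (h.ends_even ▸ he),
    ((h.chain_odd hC).crown_or_polygon hC.isTame_right hk.1 hk.3).1 (h.ends_odd ▸ he)⟩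

theorem IsZigzag.isIdealPolygon (he : ends P = ∅) : IsIdealPolygon L₁ (chainSides fun i => P (2 * i)) ∧
    IsIdealPolygon L₂ (chainSides fun i => P (2 * i + 1)) :=
  ⟨((h.chain_even hC).crown_or_polygon hC.isTame_left hk.1 hk.2).2 (h.ends_even.trans he),
    ((h.chain_odd hC).crown_or_polygon hC.isTame_right hk.1 hk.3).2 (h.ends_odd.trans he)⟩

/-- An automorphism that preserves the fixed point set of `k` shifts the zigzag by an even number of
steps. -/
theorem IsZigzag.exists_shift {f : Circle ≃ₜ Circle} (hf : IsAut L₁ L₂ f)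
    (hfk : ∀ z, k (f z) = f z ↔ k z = z) : ∃ j, Shifts f P (2 * j) := by
  have hgap : ∀ i, IsFixedGap k (f (P i)) (f (P (i + 1))) := by
    intro i
    have hi := h.gap i
    refine ⟨fun e => hi.ne (f.injective e), (hfk _).2 hi.left, (hfk _).2 hi.right, fun z hz => ?_⟩
    obtain ⟨w, rfl⟩ := f.surjective z
    rw [hf.1.ccw_iff] at hz
    exact fun e => hi.free w hz ((hfk w).1 e)
  obtain ⟨m, hm'⟩ := exists_shifts (fun i => h.exists_eq hC hk (hgap i)) (fun i j e => h.eq_succ e)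
    fun i j e => h.eq_pred e
  obtain ⟨j, rfl | rfl⟩ := Int.even_or_odd' m
  · exact ⟨j, hm'⟩
  · have h1 := (Lf.map_iff hf.2).2 (h.even 0)
    have h2 := h.odd j
    rw [hm', mul_zero, zero_add] at h1
    exact (hC.disjoint_endpoints h1 h2).elim

omit hC hk h in
theorem preserves_chainSides {c : ℤ → Circle} {f : Circle ≃ₜ Circle} {j : ℤ}
    (hf : Shifts f c j) : Preserves f (chainSides c) := by
  rw [preserves_iff]
  intro I
  constructor
  · rintro ⟨i, hl, hr⟩
    refine ⟨i - j, f.injective ?_, f.injective ?_⟩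
    · rw [hf, sub_add_cancel]; exact hl
    · rw [hf, show i - j + 1 + j = i + 1 by ring]; exact hr
  · rintro ⟨i, hl, hr⟩
    refine ⟨i + j, ?_, ?_⟩
    · change f I.left = _
      rw [hl, hf]
    · change f I.right = _
      rw [hr, hf, show i + 1 + j = i + j + 1 by ring]

omit hC hk h in
theorem preserves_of_shift {f : Circle ≃ₜ Circle} {j : ℤ} (hf : Shifts f P (2 * j)) :
    Preserves f (chainSides fun i => P (2 * i)) ∧ Preserves f (chainSides fun i => P (2 * i + 1)) := by
  constructor
  · refine preserves_chainSides (j := j) fun i => ?_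
    rw [hf, show 2 * i + 2 * j = 2 * (i + j) by ring]
  · refine preserves_chainSides (j := j) fun i => ?_
    rw [hf, show 2 * i + 1 + 2 * j = 2 * (i + j) + 1 by ring]

/-- The direction of motion alternates along a zigzag, hence is the same two steps apart. -/
theorem IsZigzag.forward_two (i : ℤ) (hf : MovesForward k (P i) (P (i + 1))) (j : ℤ) :
    MovesForward k (P (i + 2 * j)) (P (i + 2 * j + 1)) := by
  have key : ∀ i (k : Circle ≃ₜ Circle), IsAut L₁ L₂ k → IsZigzag L₁ L₂ k P →
      MovesForward k (P i) (P (i + 1)) → MovesForward k⁻¹ (P (i + 1)) (P (i + 2)) ∧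
      MovesForward k⁻¹ (P (i - 1)) (P i) := by
    intro i k hk h hf
    obtain ⟨a', b', h1, h2, h3, -⟩ := hC.neighbours hk (h.gap i)
    have h4 := h.gap (i - 1)
    have h5 := h.gap (i + 1)
    rw [sub_add_cancel] at h4
    rw [show i + 1 + 1 = i + 2 by ring] at h5
    rw [h4.left_unique h1, h5.right_unique h2]
    exact (h3 hf).symm
  induction j with
  | zero => simpa using hf
  | succ n ih =>
    have h1 := (key _ k hk h ih).1
    rw [show i + 2 * (n : ℤ) + 2 = i + 2 * n + 1 + 1 by ring] at h1
    have h2 := (key _ _ hk.inv h.inv h1).1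
    rw [inv_inv] at h2
    convert h2 using 2 <;> ring
  | pred n ih =>
    have h1 := (key _ k hk h ih).2
    have h2 := (key (i + 2 * (-n) - 1) _ hk.inv h.inv (by rwa [sub_add_cancel])).2
    rw [inv_inv] at h2
    convert h2 using 2 <;> ring

/-- A non-trivial automorphism `f` that fixes three consecutive terms has no fixed point between the
first two. Its own fixed points form a zigzag with `P 0` among the terms. The other end of the leaf
that leads from `P 0` to the term after next of this zigzag is fixed by `k`, hence lies beyond `P
1`, and so `P 1` is the next term. -/
theorem IsZigzag.isFixedGap_of_fixed {f : Circle ≃ₜ Circle} (hf : IsAut L₁ L₂ f) (h1 : f ≠ 1)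
    (h0 : f (P 0) = P 0) (hf1 : f (P 1) = P 1) (hf2 : f (P 2) = P 2) :
    IsFixedGap f (P 0) (P 1) := by
  have hne01 : P 0 ≠ P 1 := by simpa using (h.gap 0).ne
  have hne12 : P 1 ≠ P 2 := by simpa using (h.gap 1).ne
  have hne02 : P 0 ≠ P 2 := h.ne_add_two 0
  have hz : ∃ z, f z ≠ z := by
    by_contra! e
    exact h1 (by ext z; rw [e z]; rfl)
  obtain ⟨z, hz⟩ := hz
  obtain ⟨a, b, hab, -⟩ := exists_isFixedGap h0 hf1 hne01 hz
  have h3 : ∀ a b, IsFixedGap f a b → Fix f ≠ {a, b} := by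
    intro a b _ e
    have m0 : P 0 ∈ Fix f := h0
    have m1 : P 1 ∈ Fix f := hf1
    have m2 : P 2 ∈ Fix f := hf2
    rw [e, mem_insert_iff, mem_singleton_iff] at m0 m1 m2
    grind
  obtain ⟨P', hP'⟩ := hC.exists_zigzag hf hab h3
  have he := h.even 0
  rw [mul_zero, zero_add] at he
  rcases (hP'.fixed_iff hC hf).1 h0 with ⟨j, hj⟩ | e
  · obtain ⟨j, rfl | rfl⟩ := Int.even_or_odd' j
    · have hy := hP'.even j
      have hyf := hC.isTame_left.fixed_of_lf hk.1 hk.2 (hj ▸ (by simpa using (h.gap 0).left)) hy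
      have hy1 : P' (2 * j + 2) ≠ P 1 := fun e => by
        have h4 := hy.symm hC.lamination_left
        have h5 := h.odd 0
        rw [e] at h4
        exact hC.disjoint_endpoints h4 h5
      have hc : CCW (P' (2 * j)) (P 1) (P' (2 * j + 2)) := by
        rw [hj] at hy ⊢
        refine (CCW.of_ne hne01 hy1.symm hy.1.symm).resolve_right fun e => ?_
        have := (h.gap 0).free _ e.rotate.rotate
        exact this hyf
      have := hP'.eq_of_fixed hc hf1
      rw [← hj, this]
      exact hP'.gap _
    · exact (hC.disjoint_endpoints he (hj ▸ hP'.odd j)).elim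
  · exact ((hP'.not_lf_ends hC hf e _).1 he).elim

end Zigzag

/-! ### Groups acting freely on a component -/

/-- The points of the arc `(a, b)` at which a leaf of `L` starts that leaves the arc. -/
def crossingEnds (L : Set GoodInterval) (a b : Circle) : Set Circle :=
  {x | CCW a x b ∧ ∃ y, Lf L x y ∧ ¬ CCW a y b}

/-- The set of crossing ends contains the infima of its subsets in the chart at `a`, except for `a`
itself: the leaves at a decreasing sequence of crossing ends widen, and converge to a leaf. -/
theorem lift_sInf_mem_crossingEnds {L : Set GoodInterval} (hL : IsLaminationSystem L) {a b : Circle}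
    {S : Set Circle} (hS : S ⊆ crossingEnds L a b) (hne : S.Nonempty)
    (h0 : 0 < sInf (pos a '' S)) : lift a (sInf (pos a '' S)) ∈ crossingEnds L a b := by
  have hbdd : BddBelow (pos a '' S) := ⟨0, by rintro _ ⟨x, -, rfl⟩; exact pos_nonneg _ _⟩
  obtain ⟨u, hu, hut, hus⟩ := exists_seq_tendsto_sInf (hne.image (pos a)) hbdd
  set s := sInf (pos a '' S) with hs
  -- the other end of the leaf is measured in `(0, 2π]`, so that the point `a` comes last
  have hy : ∀ x : ℝ, ∃ t : ℝ, x ∈ pos a '' S →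
      0 < x ∧ x < pos a b ∧ pos a b ≤ t ∧ t ≤ 2 * Real.pi ∧ Lf L (lift a x) (lift a t) := by
    intro x
    by_cases hx : x ∈ pos a '' S
    · obtain ⟨z, hz, rfl⟩ := hx
      obtain ⟨h1, y, hy, hyab⟩ := hS hz
      rw [ccw_base] at h1 hyab
      by_cases hya : y = a
      · exact ⟨2 * Real.pi, fun _ => ⟨h1.1, h1.2, (pos_lt _ _).le, le_rfl, by
          rwa [lift_pos, lift_two_pi, ← hya]⟩⟩
      · refine ⟨pos a y, fun _ => ⟨h1.1, h1.2, ?_, (pos_lt _ _).le, by rwa [lift_pos, lift_pos]⟩⟩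
        by_contra! e
        exact hyab ⟨pos_pos hya, e⟩
    · exact ⟨0, fun e => absurd e hx⟩
  choose t ht using hy
  have hmono : Monotone fun n => t (u n) := by
    intro m n hmn
    by_contra! hlt
    rcases (hu hmn).lt_or_eq with e | e
    · obtain ⟨m0, m1, m2, m3, m4⟩ := ht _ (hus m)
      obtain ⟨n0, n1, n2, n3, n4⟩ := ht _ (hus n)
      have hm := pos_lift (p := a) m0.le (m1.trans (pos_lt a b))
      have htn := pos_lift (p := a) (s := t (u n)) (by linarith) (by linarith)
      -- the ends of the leaf from `u m` would be separated by the leaf from `u n`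
      refine hL.not_linked m4 n4 ?_ (CCW.rotate ?_)
      · rw [ccw_lift_iff n0.le (by linarith) n3 (by linarith), hm]
        exact ⟨e, by linarith⟩
      · rw [ccw_lift_iff n0.le (by linarith) m3 (by linarith), htn]
        exact ⟨by linarith, hlt⟩
    · rw [e] at hlt
      exact lt_irrefl _ hlt
  have hbt : BddAbove (range fun n => t (u n)) :=
    ⟨2 * Real.pi, by rintro _ ⟨n, rfl⟩; exact (ht _ (hus n)).2.2.2.1⟩
  have htT := tendsto_atTop_ciSup hmono hbt
  set T := ⨆ n, t (u n) with hT
  have hT1 : pos a b ≤ T := (ht _ (hus 0)).2.2.1.trans (le_ciSup hbt 0)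
  have hT2 : T ≤ 2 * Real.pi := ciSup_le fun n => (ht _ (hus n)).2.2.2.1
  have hsu : s ≤ u 0 := csInf_le hbdd (hus 0)
  obtain ⟨-, e1, -⟩ := ht _ (hus 0)
  refine ⟨ccw_base.2 ?_, lift a T, hL.lf_limit hu hmono hut htT (fun n => ?_) (by linarith)
    (fun n => (ht _ (hus n)).2.2.2.2), fun e => ?_⟩
  · rw [pos_lift h0.le (by linarith [pos_lt a b])]
    exact ⟨h0, by linarith⟩
  · obtain ⟨-, n1, n2, -⟩ := ht _ (hus n)
    linarith
  · rw [ccw_base] at e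
    rcases hT2.lt_or_eq with e' | e'
    · rw [pos_lift ((pos_nonneg _ _).trans hT1) e'] at e
      linarith
    · rw [e', lift_two_pi, pos_self] at e
      exact lt_irrefl _ e.1

section Free

variable {a b : Circle}

theorem MovesForward.exists_pow_lt {h : Circle ≃ₜ Circle} (hh : OrientationPreserving h)
    (hab : IsFixedGap h a b) (hf : MovesForward h a b) {x y : Circle} (hx : CCW a x b)
    (hy : CCW a y b) : ∃ n : ℕ, pos a y < pos a ((h ^ n) x) := by
  have h1 := ccw_base.1 (hf x hx)
  obtain ⟨s, hs2, hm, hlt, ht, hfix⟩ := orbit_up hh hab.left h1.2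
  have hxs : pos a x < s := by simpa using hlt 0
  have hLs : pos a b ≤ s := by
    rcases hs2.lt_or_eq with e | e
    · rcases hab.lt_of_fixed hfix with e' | e'
      · have := pos_lift (p := a) (by linarith) e
        rw [e', pos_self] at this
        linarith
      · rwa [pos_lift (by linarith) e] at e'
    · rw [e]; exact (pos_lt _ _).le
  have hy' := ccw_base.1 hy
  exact (ht.eventually (lt_mem_nhds (hy'.2.trans_le hLs))).exists

variable {K : Subgroup (Circle ≃ₜ Circle)} (hK : ∀ k ∈ K, OrientationPreserving k)
  (hgap : ∀ k ∈ K, k ≠ 1 → IsFixedGap k a b)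

include hK hgap

/-- A group acting freely on an arc is generated by its least positive element, if there is one. -/
theorem exists_zpowers_of_least {h : Circle ≃ₜ Circle} {x : Circle} (hx : CCW a x b) (hh : h ∈ K)
    (hpos : pos a x < pos a (h x))
    (hmin : ∀ k ∈ K, pos a x < pos a (k x) → pos a (h x) ≤ pos a (k x)) :
    K = Subgroup.zpowers h := by
  have h1 : h ≠ 1 := by rintro rfl; exact lt_irrefl _ hpos
  have hg := hgap h hh h1
  have hf := hg.forward_of_lt (hK h hh) hx hpos
  have key : ∀ k ∈ K, pos a x ≤ pos a (k x) → k ∈ Subgroup.zpowers h := by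
    intro k hk hkx
    have hkab : CCW a (k x) b := by
      by_cases e : k = 1
      · rw [e]; exact hx
      · exact (hgap k hk e).ccw_map (hK k hk) hx
    have hex := hf.exists_pow_lt (hK h hh) hg hx hkab
    classical
    obtain ⟨m, hm⟩ : ∃ m, Nat.find hex = m + 1 := by
      refine Nat.exists_eq_succ_of_ne_zero fun e => ?_
      have := Nat.find_spec hex
      rw [e, pow_zero] at this
      exact absurd hkx (not_le.2 this)
    have hm1 := Nat.find_spec hex
    have hm2 := Nat.find_min hex (m := m) (by omega)
    rw [hm] at hm1
    rw [not_lt] at hm2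
    have hmK : h ^ m ∈ K := K.pow_mem hh m
    have hma : (h ^ m) a = a := pow_fix hg.left m
    set l := (h ^ m)⁻¹ * k with hl
    have hlK : l ∈ K := K.mul_mem (K.inv_mem hmK) hk
    have hlx : (h ^ m) (l x) = k x := apply_inv_self _ _
    have h2 : pos a x ≤ pos a (l x) := by
      rw [← pos_map_le (hK _ hmK) hma, hlx]; exact hm2
    have h3 : pos a (l x) < pos a (h x) := by
      rw [← pos_map_lt (hK _ hmK) hma, hlx, ← pow_succ_apply']; exact hm1
    have h4 : l = 1 := by
      by_contra hl1
      rcases h2.lt_or_eq with e | e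
      · exact absurd (hmin l hlK e) (not_le.2 h3)
      · exact (hgap l hlK hl1).free x hx (pos_inj.1 e).symm
    have : k = h ^ m := by rw [← mul_one (h ^ m), ← h4, hl, mul_inv_cancel_left]
    rw [this]
    exact Subgroup.npow_mem_zpowers h m
  refine le_antisymm (fun k hk => ?_) ((Subgroup.zpowers_le).2 hh)
  rcases le_total (pos a x) (pos a (k x)) with e | e
  · exact key k hk e
  · have ha : k a = a := by
      by_cases e : k = 1
      · rw [e]; rfl
      · exact (hgap k hk e).left
    have := key k⁻¹ (K.inv_mem hk) (by
      rw [← pos_map_le (hK k hk) ha, apply_inv_self]; exact e)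
    simpa using this

/-- A group of laminar automorphisms that fix `a` and `b` and act freely on the arc `(a, b)` is
cyclic. Otherwise orbits would accumulate, and the two disjoint invariant sets of endpoints of
leaves crossing out of the arc, which contain the infima of their subsets, would interleave: a
small enough element of the group would move an endpoint of one kind past the least one above an
accumulation point of the other kind. -/
theorem IsPseudoFibered.exists_zpowers {L₁ L₂ : Set GoodInterval} (hC : IsPseudoFibered L₁ L₂)
    (hK₁ : ∀ k ∈ K, Preserves k L₁) (hK₂ : ∀ k ∈ K, Preserves k L₂) :
    ∃ h, K = Subgroup.zpowers h := by
  by_cases htriv : K = ⊥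
  · exact ⟨1, by rw [htriv, Subgroup.zpowers_one_eq_bot]⟩
  obtain ⟨k₀, hk₀, hk₀1⟩ := K.bot_or_exists_ne_one.resolve_left htriv
  have hka : ∀ k ∈ K, k a = a := fun k hk => by
    by_cases e : k = 1
    · rw [e]; rfl
    · exact (hgap k hk e).left
  have hkb : ∀ k ∈ K, k b = b := fun k hk => by
    by_cases e : k = 1
    · rw [e]; rfl
    · exact (hgap k hk e).right
  have hcross : ∀ L, (∀ k ∈ K, Preserves k L) → ∀ k ∈ K, ∀ x ∈ crossingEnds L a b,
      k x ∈ crossingEnds L a b := by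
    rintro L hKL k hk x ⟨hx, y, hy, hy'⟩
    refine ⟨?_, k y, (Lf.map_iff (hKL k hk)).2 hy, fun e => hy' ?_⟩
    · have := hK k hk _ _ _ hx
      rwa [hka k hk, hkb k hk] at this
    · rw [← hka k hk, ← hkb k hk, (hK k hk).ccw_iff] at e
      exact e
  have hmovelt : ∀ k ∈ K, ∀ x y, pos a (k x) < pos a (k y) ↔ pos a x < pos a y :=
    fun k hk x y => pos_map_lt (hK k hk) (hka k hk)
  obtain ⟨x, y, hxy, hx, hy⟩ := hC.isTame_left.exists_crossing (hK k₀ hk₀) (hK₁ k₀ hk₀)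
    (hgap k₀ hk₀ hk₀1)
  obtain ⟨u, v, huv, hu, hv⟩ := hC.isTame_right.exists_crossing (hK k₀ hk₀) (hK₂ k₀ hk₀)
    (hgap k₀ hk₀ hk₀1)
  have hxα : x ∈ crossingEnds L₁ a b := ⟨hx, y, hxy, fun e => e.rotate.rotate.asymm hy.rotate⟩
  have huβ : u ∈ crossingEnds L₂ a b := ⟨hu, v, huv, fun e => e.rotate.rotate.asymm hv.rotate⟩
  obtain ⟨k₁, hk₁, hk₁x⟩ : ∃ k ∈ K, pos a x < pos a (k x) := by
    rcases lt_trichotomy (pos a x) (pos a (k₀ x)) with e | e | e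
    · exact ⟨k₀, hk₀, e⟩
    · exact absurd (pos_inj.1 e).symm ((hgap k₀ hk₀ hk₀1).free x hx)
    · exact ⟨k₀⁻¹, K.inv_mem hk₀, (lt_pos_inv (hK _ hk₀) (hka _ hk₀)).2 e⟩
  have hk₁1 : k₁ ≠ 1 := by rintro rfl; exact lt_irrefl _ hk₁x
  set A : Set Circle := {z | ∃ k ∈ K, z = k x ∧ pos a x < pos a (k x)} with hA
  have hAα : A ⊆ crossingEnds L₁ a b := by
    rintro _ ⟨k, hk, rfl, -⟩
    exact hcross L₁ hK₁ k hk x hxα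
  have hAne : A.Nonempty := ⟨k₁ x, k₁, hk₁, rfl, hk₁x⟩
  have hbd : ∀ S : Set Circle, BddBelow (pos a '' S) := fun S =>
    ⟨0, by rintro _ ⟨x, -, rfl⟩; exact pos_nonneg _ _⟩
  have hx0 := (ccw_base.1 hx).1
  set s := sInf (pos a '' A) with hs
  have hxs : pos a x ≤ s := le_csInf (hAne.image _) (by
    rintro _ ⟨_, ⟨k, hk, rfl, e⟩, rfl⟩; exact e.le)
  have hzα := lift_sInf_mem_crossingEnds hC.lamination_left hAα hAne (hx0.trans_le hxs)
  by_cases hmem : s ∈ pos a '' A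
  · obtain ⟨_, ⟨k, hk, rfl, e⟩, e'⟩ := hmem
    exact ⟨k, exists_zpowers_of_least hK hgap hx hk e fun l hl hlx => by
      rw [e']; exact csInf_le (hbd _) ⟨_, ⟨l, hl, rfl, hlx⟩, rfl⟩⟩
  exfalso
  have hsb : s < pos a b := by
    have h1 : s ≤ pos a (k₁ x) := csInf_le (hbd A) ⟨_, ⟨k₁, hk₁, rfl, hk₁x⟩, rfl⟩
    have := (ccw_base.1 hzα.1).2
    rwa [pos_lift (hx0.trans_le hxs).le (h1.trans_lt (pos_lt _ _))] at this
  set B : Set Circle := {z | ∃ k ∈ K, z = k u ∧ s ≤ pos a (k u)} with hB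
  have hBβ : B ⊆ crossingEnds L₂ a b := by
    rintro _ ⟨k, hk, rfl, -⟩
    exact hcross L₂ hK₂ k hk u huβ
  have hBne : B.Nonempty := by
    obtain ⟨n, hn⟩ := ((hgap k₁ hk₁ hk₁1).forward_of_lt (hK _ hk₁) hx hk₁x).exists_pow_lt
      (hK _ hk₁) (hgap k₁ hk₁ hk₁1) hu hzα.1
    rw [pos_lift (hx0.trans_le hxs).le (hsb.trans (pos_lt _ _))] at hn
    exact ⟨_, k₁ ^ n, K.pow_mem hk₁ n, rfl, hn.le⟩
  set t := sInf (pos a '' B) with ht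
  have hst : s ≤ t := le_csInf (hBne.image _) (by
    rintro _ ⟨_, ⟨k, hk, rfl, e⟩, rfl⟩; exact e)
  have ht0 : 0 < t := (hx0.trans_le hxs).trans_le hst
  have hwβ := lift_sInf_mem_crossingEnds hC.lamination_right hBβ hBne ht0
  have hne : s ≠ t := by
    intro e
    rw [← ht, ← e] at hwβ
    obtain ⟨-, y1, hy1, -⟩ := hzα
    obtain ⟨-, y2, hy2, -⟩ := hwβ
    exact hC.disjoint_endpoints hy1 hy2
  have hlt : s < t := lt_of_le_of_ne hst hne
  -- two elements of `A` between `s` and `t`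
  have hbetween : ∀ r, s < r → ∃ k ∈ K, s < pos a (k x) ∧ pos a (k x) < r := by
    intro r hr
    obtain ⟨_, ⟨_, ⟨k, hk, rfl, e⟩, rfl⟩, hkr⟩ := exists_lt_of_csInf_lt (hAne.image (pos a)) hr
    have hle : s ≤ pos a (k x) := csInf_le (hbd _) ⟨_, ⟨k, hk, rfl, e⟩, rfl⟩
    exact ⟨k, hk, lt_of_le_of_ne hle fun e' => hmem ⟨_, ⟨k, hk, rfl, e⟩, e'.symm⟩, hkr⟩
  obtain ⟨l₁, hl₁, h1, h2⟩ := hbetween t hlt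
  obtain ⟨l₂, hl₂, h3, h4⟩ := hbetween _ h1
  set k := l₂ * l₁⁻¹ with hk
  have hkK : k ∈ K := K.mul_mem hl₂ (K.inv_mem hl₁)
  have hkl : k (l₁ x) = l₂ x := by
    change l₂ (l₁⁻¹ (l₁ x)) = _
    rw [inv_apply_self]
  set w := lift a t with hw
  have hwab := hwβ.1
  have hwt : pos a w = t := pos_lift ht0.le (by
    obtain ⟨z, hz⟩ := hBne
    exact (csInf_le (hbd _) ⟨z, hz, rfl⟩).trans_lt (pos_lt _ _))
  have hk1 : k ≠ 1 := by
    intro e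
    rw [e] at hkl
    have : l₁ x = l₂ x := hkl
    rw [this] at h4
    exact lt_irrefl _ h4
  have hl₁ab : CCW a (l₁ x) b := (hcross L₁ hK₁ l₁ hl₁ x hxα).1
  -- `k` moves backwards, but keeps `w` above `s`
  have hkinv : MovesForward k⁻¹ a b := (hgap k hkK hk1).inv.forward_of_lt (hK k hkK).inv hl₁ab
    ((lt_pos_inv (hK k hkK) (hka k hkK)).2 (by rwa [hkl]))
  have h5 : pos a w < pos a (k⁻¹ w) := (ccw_base.1 (hkinv w hwab)).2
  have h6 : s < pos a (k w) := by
    have := (hmovelt k hkK (l₁ x) w).2 (by rwa [hwt])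
    rw [hkl] at this
    exact h3.trans this
  rw [hwt] at h5
  obtain ⟨_, ⟨_, ⟨m, hm, rfl, e⟩, rfl⟩, hmr⟩ := exists_lt_of_csInf_lt (hBne.image (pos a)) h5
  have h7 : t ≤ pos a (m u) := csInf_le (hbd _) ⟨_, ⟨m, hm, rfl, e⟩, rfl⟩
  have h8 : pos a (k (m u)) < t := by
    have := (hmovelt k hkK (m u) (k⁻¹ w)).2 hmr
    rwa [apply_inv_self, hwt] at this
  have h9 : s < pos a (k (m u)) := by
    refine h6.trans_le ?_
    rw [pos_map_le (hK k hkK) (hka k hkK), hwt]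
    exact h7
  have h10 : t ≤ pos a ((k * m) u) := csInf_le (hbd _) ⟨_, ⟨k * m, K.mul_mem hkK hm, rfl, h9.le⟩, rfl⟩
  exact absurd h8 (not_lt.2 h10)

end Free

/-! ### Cyclic, dihedral and product groups -/

section Group

variable {Γ : Type*} [Group Γ]

/-- An element that normalizes an infinite cyclic group acts on it by a sign. -/
theorem conj_eq_or_eq_inv {h f : Γ} (hh : ¬ IsOfFinOrder h)
    (h1 : f * h * f⁻¹ ∈ Subgroup.zpowers h) (h2 : f⁻¹ * h * f ∈ Subgroup.zpowers h) :
    f * h * f⁻¹ = h ∨ f * h * f⁻¹ = h⁻¹ := by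
  obtain ⟨m, hm⟩ := Subgroup.mem_zpowers_iff.1 h1
  obtain ⟨l, hl⟩ := Subgroup.mem_zpowers_iff.1 h2
  have h3 : h ^ (m * l) = h ^ (1 : ℤ) := by
    rw [zpow_mul, hm, conj_zpow, hl, zpow_one]
    group
  have h4 := injective_zpow_iff_not_isOfFinOrder.2 hh h3
  rcases Int.eq_one_or_neg_one_of_mul_eq_one h4 with rfl | rfl
  · left; rw [← hm, zpow_one]
  · right; rw [← hm, zpow_neg_one]

/-- A generator of an infinite cyclic normal subgroup, with the action of the group on it. -/
theorem exists_generator_of_normal {G : Subgroup Γ}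
    (hN : ∃ N : Subgroup G, N.Normal ∧ IsCyclic N ∧ Infinite N) :
    ∃ g ∈ G, ¬ IsOfFinOrder g ∧ ∀ f ∈ G, f * g * f⁻¹ = g ∨ f * g * f⁻¹ = g⁻¹ := by
  obtain ⟨N, hn, hc, hi⟩ := hN
  obtain ⟨g, hg⟩ := (Subgroup.isCyclic_iff_exists_zpowers_eq_top N).1 hc
  have hgo : ¬ IsOfFinOrder g := by
    intro e
    have : Finite (Subgroup.zpowers g) := e.finite_zpowers
    rw [hg] at this
    exact not_finite N
  have hgN : g ∈ N := hg ▸ Subgroup.mem_zpowers g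
  refine ⟨g, g.2, fun e => hgo (Submonoid.isOfFinOrder_coe.1 e), fun f hf => ?_⟩
  have h1 := hn.conj_mem g hgN ⟨f, hf⟩
  have h2 := hn.conj_mem g hgN ⟨f, hf⟩⁻¹
  rw [inv_inv] at h2
  rw [← hg] at h1 h2
  rcases conj_eq_or_eq_inv hgo h1 h2 with e | e
  · exact Or.inl (congrArg Subtype.val e)
  · exact Or.inr (congrArg Subtype.val e)

/-- The type of an internal direct product of two cyclic groups. Infinite order is encoded by
`orderOf = 0`, in accordance with `ZMod 0 = ℤ`. -/
theorem IsInternalProduct.nonempty_mulEquiv {G : Subgroup Γ} {g e : Γ}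
    (h : IsInternalProduct G g e) :
    Nonempty (G ≃* Multiplicative (ZMod (orderOf g)) × Multiplicative (ZMod (orderOf e))) := by
  obtain ⟨hG, hc, hd⟩ := h
  have comm : ∀ (x : Subgroup.zpowers g) (y : Subgroup.zpowers e),
      Commute ((Subgroup.zpowers g).subtype x) ((Subgroup.zpowers e).subtype y) := by
    rintro ⟨_, m, rfl⟩ ⟨_, n, rfl⟩
    exact hc.zpow_zpow m n
  have hinj := (MonoidHom.noncommCoprod_injective _ _ comm).2
    ⟨Subgroup.subtype_injective _, Subgroup.subtype_injective _, by
      rw [Subgroup.range_subtype, Subgroup.range_subtype]; exact hd⟩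
  have hrange := MonoidHom.noncommCoprod_range _ _ comm
  rw [Subgroup.range_subtype, Subgroup.range_subtype, ← hG] at hrange
  have e1 := (MonoidHom.ofInjective hinj).trans (MulEquiv.subgroupCongr hrange)
  have e2 := zmodCyclicMulEquiv (G := Subgroup.zpowers g) inferInstance
  have e3 := zmodCyclicMulEquiv (G := Subgroup.zpowers e) inferInstance
  rw [Nat.card_zpowers] at e2 e3
  exact ⟨e1.symm.trans (MulEquiv.prodCongr e2.symm e3.symm)⟩

theorem nonempty_mulEquiv_of_zpowers {G : Subgroup Γ} {g : Γ} (h : G = Subgroup.zpowers g)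
    (hg : ¬ IsOfFinOrder g) : Nonempty (G ≃* Multiplicative ℤ) := by
  have e2 := zmodCyclicMulEquiv (G := Subgroup.zpowers g) inferInstance
  rw [Nat.card_zpowers, orderOf_eq_zero_iff.2 hg] at e2
  rw [h]
  exact ⟨e2.symm⟩

/-- If `f` and `h` commute, `h` has infinite order and a proper power of `f` is a power of `h`,
then the group they generate is the product of an infinite cyclic group and a finite cyclic one. -/
theorem exists_isInternalProduct {f h : Γ} (hc : Commute f h) (hh : ¬ IsOfFinOrder h) {m r : ℤ}
    (hm : m ≠ 0) (hfh : f ^ m = h ^ r) :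
    ∃ g e, ¬ IsOfFinOrder g ∧ IsOfFinOrder e ∧
      IsInternalProduct (Subgroup.zpowers f ⊔ Subgroup.zpowers h) g e := by
  obtain ⟨n, m', r', hn, hm', hr', hcop⟩ : ∃ n m' r' : ℤ, n ≠ 0 ∧ m = n * m' ∧ r = n * r' ∧
      IsCoprime m' r' := by
    obtain ⟨m', r', hcop, h1, h2⟩ := Int.exists_gcd_one (Int.gcd_pos_of_ne_zero_left r hm)
    refine ⟨Int.gcd m r, m', r', ?_, by rw [mul_comm]; exact h1, by rw [mul_comm]; exact h2,
      Int.isCoprime_iff_gcd_eq_one.2 hcop⟩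
    exact_mod_cast (Int.gcd_pos_of_ne_zero_left r hm).ne'
  obtain ⟨x, y, hxy⟩ := hcop
  have hcz := fun a b => hc.zpow_zpow a b
  -- `(h ^ x * f ^ y, f ^ m' * h ^ (-r'))` arises from `(h, f)` by an integer matrix of
  -- determinant one
  set g := h ^ x * f ^ y with hg
  set e := f ^ m' * h ^ (-r') with he
  have hgz : ∀ k : ℤ, g ^ k = h ^ (x * k) * f ^ (y * k) := fun k => by
    rw [hg, (hcz y x).symm.mul_zpow, ← zpow_mul, ← zpow_mul]
  have hez : ∀ k : ℤ, e ^ k = f ^ (m' * k) * h ^ (-r' * k) := fun k => by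
    rw [he, (hcz m' (-r')).mul_zpow, ← zpow_mul, ← zpow_mul]
  have hh' : g ^ m' * e ^ (-y) = h := by
    rw [hgz, hez, mul_assoc, ← mul_assoc (f ^ _), ← zpow_add,
      show y * m' + m' * -y = 0 by ring, zpow_zero, one_mul, ← zpow_add,
      show x * m' + -r' * -y = 1 by linarith, zpow_one]
  have hf' : g ^ r' * e ^ x = f := by
    rw [hgz, hez, mul_assoc, ← mul_assoc (f ^ _), ← zpow_add,
      (hcz _ _).eq, ← mul_assoc, ← zpow_add,
      show x * r' + -r' * x = 0 by ring, zpow_zero, one_mul,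
      show y * r' + m' * x = 1 by linarith, zpow_one]
  have hen : e ^ n = 1 := by
    rw [hez, mul_comm m', ← hm', hfh, ← zpow_add, hr', show n * r' + -r' * n = 0 by ring, zpow_zero]
  have hef : IsOfFinOrder e := isOfFinOrder_iff_zpow_eq_one.2 ⟨n, hn, hen⟩
  have hcge : Commute g e := by
    have h1 : Commute f e := ((Commute.refl f).zpow_right m').mul_right (hc.zpow_right _)
    have h2 : Commute h e := (hc.symm.zpow_right m').mul_right ((Commute.refl h).zpow_right _)
    exact (h2.zpow_left x).mul_left (h1.zpow_left y)
  have hgf : ¬ IsOfFinOrder g := by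
    intro e'
    refine hh ?_
    rw [← hh']
    exact (hcge.zpow_zpow _ _).isOfFinOrder_mul e'.zpow hef.zpow
  refine ⟨g, e, hgf, hef, le_antisymm ?_ ?_, hcge, ?_⟩
  · have hg' := Subgroup.mem_zpowers g
    have he' := Subgroup.mem_zpowers e
    rw [sup_le_iff, Subgroup.zpowers_le, Subgroup.zpowers_le]
    constructor
    · nth_rw 1 [← hf']
      exact mul_mem (zpow_mem (Subgroup.mem_sup_left hg') _) (zpow_mem (Subgroup.mem_sup_right he') _)
    · nth_rw 1 [← hh']
      exact mul_mem (zpow_mem (Subgroup.mem_sup_left hg') _) (zpow_mem (Subgroup.mem_sup_right he') _)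
  · have hf' := Subgroup.mem_sup_left (T := Subgroup.zpowers h) (Subgroup.mem_zpowers f)
    have hh' := Subgroup.mem_sup_right (S := Subgroup.zpowers f) (Subgroup.mem_zpowers h)
    rw [sup_le_iff, Subgroup.zpowers_le, Subgroup.zpowers_le]
    exact ⟨mul_mem (zpow_mem hh' _) (zpow_mem hf' _), mul_mem (zpow_mem hf' _) (zpow_mem hh' _)⟩
  · rw [Subgroup.disjoint_def]
    rintro _ ⟨k, rfl⟩ hk
    obtain ⟨l, hl⟩ := Subgroup.mem_zpowers_iff.1 hk
    by_contra hne
    refine hgf (isOfFinOrder_iff_zpow_eq_one.2 ?_)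
    have : IsOfFinOrder (g ^ k) := by
      change IsOfFinOrder ((fun k => g ^ k) k)
      rw [← hl]; exact hef.zpow
    obtain ⟨N, hN, hN'⟩ := isOfFinOrder_iff_zpow_eq_one.1 this
    refine ⟨k * N, mul_ne_zero ?_ hN, by rw [zpow_mul]; exact hN'⟩
    rintro rfl
    exact hne (zpow_zero g)

/-- The homomorphism from the infinite dihedral group given by an element `g` and an involution `e`
that inverts it. -/
noncomputable def dihedralHom (g e : Γ) (he : e * e = 1) (hge : e * g * e = g⁻¹) :
    DihedralGroup 0 →* Γ where
  toFun
    | .r i => g ^ (show ℤ from i)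
    | .sr i => e * g ^ (show ℤ from i)
  map_one' := zpow_zero g
  map_mul' := by
    have key : ∀ k : ℤ, g ^ k * e = e * g ^ (-k) := by
      intro k
      have h1 : e = e⁻¹ := eq_inv_of_mul_eq_one_left he
      have h2 : e * g * e⁻¹ = g⁻¹ := by rw [← h1]; exact hge
      have h3 : e * g ^ (-k) * e⁻¹ = g ^ k := by rw [← conj_zpow, h2, inv_zpow, zpow_neg, inv_inv]
      rw [← h3, inv_mul_cancel_right]
    rintro (i | i) (j | j)
    · exact zpow_add g _ _
    · change e * g ^ ((show ℤ from j) - (show ℤ from i)) = g ^ (show ℤ from i) * (e * g ^ (show ℤ from j))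
      rw [← mul_assoc, key, mul_assoc, ← zpow_add]
      congr 2
      ring
    · change e * g ^ ((show ℤ from i) + (show ℤ from j)) = e * g ^ (show ℤ from i) * g ^ (show ℤ from j)
      rw [mul_assoc, zpow_add]
    · change g ^ ((show ℤ from j) - (show ℤ from i)) =
        e * g ^ (show ℤ from i) * (e * g ^ (show ℤ from j))
      rw [mul_assoc, ← mul_assoc (g ^ _), key, mul_assoc, ← mul_assoc, he, one_mul, ← zpow_add]
      congr 1
      ring

theorem dihedralHom_injective {g e : Γ} (he : e * e = 1) (hge : e * g * e = g⁻¹)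
    (hg : ¬ IsOfFinOrder g) : Function.Injective (dihedralHom g e he hge) := by
  have hinj := injective_zpow_iff_not_isOfFinOrder.2 hg
  rw [injective_iff_map_eq_one]
  rintro (i | i) h
  · have : g ^ (show ℤ from i) = g ^ (0 : ℤ) := by rw [zpow_zero]; exact h
    have h0 : i = (0 : ZMod 0) := hinj this
    rw [h0]; rfl
  · have h1 : e * g ^ (show ℤ from i) = 1 := h
    have h2 : e = g ^ (-(show ℤ from i)) := by rw [zpow_neg]; exact eq_inv_of_mul_eq_one_left h1
    have h3 : e * g * e = g := by
      have : Commute e g := by rw [h2]; exact (Commute.refl g).zpow_left _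
      rw [this.eq, mul_assoc, he, mul_one]
    have h4 : g ^ (1 : ℤ) = g ^ (-1 : ℤ) := by rw [zpow_one, zpow_neg_one, ← hge, h3]
    have := hinj h4
    norm_num at this

theorem dihedralHom_range {g e : Γ} (he : e * e = 1) (hge : e * g * e = g⁻¹) :
    (dihedralHom g e he hge).range = Subgroup.closure {g, e} := by
  apply le_antisymm
  · have hg' : g ∈ Subgroup.closure {g, e} := Subgroup.subset_closure (by simp)
    have he' : e ∈ Subgroup.closure {g, e} := Subgroup.subset_closure (by simp)
    rintro _ ⟨i | i, rfl⟩
    · exact zpow_mem hg' _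
    · exact mul_mem he' (zpow_mem hg' _)
  · rw [Subgroup.closure_le]
    rintro x (hx | hx)
    · rw [hx]; exact ⟨.r 1, zpow_one g⟩
    · rw [hx]
      refine ⟨.sr 0, ?_⟩
      change e * g ^ (0 : ℤ) = e
      rw [zpow_zero, mul_one]

theorem nonempty_mulEquiv_dihedral {G : Subgroup Γ} {g e : Γ} (he : e * e = 1)
    (hge : e * g * e = g⁻¹) (hg : ¬ IsOfFinOrder g) (hG : G = Subgroup.closure {g, e}) :
    Nonempty (G ≃* DihedralGroup 0) := by
  rw [hG, ← dihedralHom_range he hge]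
  exact ⟨(MonoidHom.ofInjective (dihedralHom_injective he hge hg)).symm⟩

/-- The presented group is a quotient of the infinite dihedral group, so the latter being faithfully
represented by `g` and `e` makes the presentation faithful. -/
theorem hasDihedralPresentation {G : Subgroup Γ} {g e : Γ} (he : e * e = 1)
    (hge : e * g * e = g⁻¹) (hg : ¬ IsOfFinOrder g) (hG : G = Subgroup.closure {g, e}) :
    HasDihedralPresentation G g e := by
  have hrel : ∀ r ∈ dihedralRelators, FreeGroup.lift ![g, e] r = 1 := by
    rintro _ (rfl | rfl)
    · simp [pow_two, he]
    · simp [hge]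
  let φ := PresentedGroup.toGroup hrel
  have hφ0 : φ (PresentedGroup.of 0) = g := by simp [φ]
  have hφ1 : φ (PresentedGroup.of 1) = e := by simp [φ]
  let a : PresentedGroup dihedralRelators := PresentedGroup.of 0
  let b : PresentedGroup dihedralRelators := PresentedGroup.of 1
  have hb : b * b = 1 := by
    have : (PresentedGroup.mk dihedralRelators) (FreeGroup.of 1 ^ 2) = 1 :=
      PresentedGroup.one_of_mem (by simp [dihedralRelators])
    rwa [map_pow, pow_two] at this
  have hab : b * a * b = a⁻¹ := by
    have : (PresentedGroup.mk dihedralRelators) (FreeGroup.of 1 * FreeGroup.of 0 * FreeGroup.of 1 *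
        ((FreeGroup.of 0)⁻¹)⁻¹) = 1 :=
      PresentedGroup.one_of_mem (by simp [dihedralRelators])
    rw [inv_inv, map_mul, map_mul, map_mul] at this
    exact eq_inv_of_mul_eq_one_left this
  have hsurj : Function.Surjective (dihedralHom a b hb hab) := by
    rw [← MonoidHom.range_eq_top, dihedralHom_range, eq_top_iff,
      ← PresentedGroup.closure_range_of dihedralRelators, Subgroup.closure_le]
    rintro _ ⟨i, rfl⟩
    refine Subgroup.subset_closure ?_
    fin_cases i
    · exact Or.inl rfl
    · exact Or.inr rfl
  have hcomp : φ.comp (dihedralHom a b hb hab) = dihedralHom g e he hge := by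
    refine MonoidHom.ext ?_
    rintro (i | i)
    · change φ (a ^ (show ℤ from i)) = g ^ (show ℤ from i)
      rw [map_zpow, hφ0]
    · change φ (b * a ^ (show ℤ from i)) = e * g ^ (show ℤ from i)
      rw [map_mul, map_zpow, hφ0, hφ1]
  have hinj : Function.Injective φ := by
    intro x y hxy
    obtain ⟨x, rfl⟩ := hsurj x
    obtain ⟨y, rfl⟩ := hsurj y
    have : (φ.comp (dihedralHom a b hb hab)) x = (φ.comp (dihedralHom a b hb hab)) y := hxy
    rw [hcomp] at this
    rw [dihedralHom_injective he hge hg this]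
  have hrange : φ.range = G := by
    rw [hG, ← dihedralHom_range he hge, ← hcomp, MonoidHom.range_comp,
      MonoidHom.range_eq_top.2 hsurj, ← MonoidHom.range_eq_map]
  exact ⟨(MonoidHom.ofInjective hinj).trans (MulEquiv.subgroupCongr hrange), hφ0, hφ1⟩

end Group

/-! ### Telling the four groups apart -/

/-- The number of torsion elements, with the value `0` if there are infinitely many. -/
noncomputable def torsionCard (A : Type*) [Group A] : ℕ := Nat.card {x : A // IsOfFinOrder x}

theorem torsionCard_congr {A B : Type*} [Group A] [Group B] (e : A ≃* B) :
    torsionCard A = torsionCard B :=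
  Nat.card_congr (e.toEquiv.subtypeEquiv fun _ => (e.injective.isOfFinOrder_iff (f := e.toMonoidHom)).symm)

theorem isOfFinOrder_int {x : Multiplicative ℤ} : IsOfFinOrder x ↔ x = 1 := by
  refine ⟨fun h => ?_, fun h => h ▸ IsOfFinOrder.one⟩
  obtain ⟨n, hn, h⟩ := isOfFinOrder_iff_pow_eq_one.1 h
  have h' : n • x.toAdd = 0 := congrArg Multiplicative.toAdd h
  rcases smul_eq_zero.1 h' with e | e
  · omega
  · exact congrArg Multiplicative.ofAdd e

theorem torsionCard_int : torsionCard (Multiplicative ℤ) = 1 := by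
  rw [torsionCard, Nat.card_eq_one_iff_unique]
  exact ⟨⟨fun x y => Subtype.ext ((isOfFinOrder_int.1 x.2).trans (isOfFinOrder_int.1 y.2).symm)⟩,
    ⟨1, IsOfFinOrder.one⟩⟩

theorem torsionCard_int_prod {B : Type*} [Group B] :
    torsionCard (Multiplicative ℤ × B) = torsionCard B := by
  refine Nat.card_congr ⟨fun x => ⟨x.1.2, (IsOfFinOrder.prod_iff.1 x.2).2⟩,
    fun y => ⟨(1, y.1), IsOfFinOrder.prod_iff.2 ⟨IsOfFinOrder.one, y.2⟩⟩, fun x => ?_, fun y => rfl⟩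
  exact Subtype.ext (Prod.ext (isOfFinOrder_int.1 (IsOfFinOrder.prod_iff.1 x.2).1).symm rfl)

theorem torsionCard_of_finite {B : Type*} [Group B] [Finite B] : torsionCard B = Nat.card B :=
  Nat.card_congr (Equiv.subtypeUnivEquiv fun x => isOfFinOrder_of_finite x)

theorem torsionCard_int_prod_zmod {n : ℕ} (hn : 1 < n) :
    torsionCard (Multiplicative ℤ × Multiplicative (ZMod n)) = n := by
  have : NeZero n := ⟨by omega⟩
  rw [torsionCard_int_prod, torsionCard_of_finite]
  exact Nat.card_zmod n

theorem not_commutative_dihedral : ¬ ∀ x y : DihedralGroup 0, x * y = y * x := by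
  intro h
  have h1 := h (.r 1) (.sr 0)
  rw [DihedralGroup.r_mul_sr, DihedralGroup.sr_mul_r] at h1
  have h2 := DihedralGroup.sr.inj h1
  have h3 : (0 - 1 : ℤ) = 0 + 1 := h2
  norm_num at h3

theorem not_commutative_of_mulEquiv {A : Type*} [Group A] (φ : A ≃* DihedralGroup 0) :
    ¬ ∀ x y : A, x * y = y * x := fun h => not_commutative_dihedral fun x y => by
  rw [← φ.apply_symm_apply x, ← φ.apply_symm_apply y, ← map_mul, h, map_mul]

theorem not_isCyclic_int_prod_int : ¬ IsCyclic (Multiplicative ℤ × Multiplicative ℤ) :=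
  not_isCyclic_prod_of_infinite_nontrivial _ _

/-! ### Elements with fixed points -/

/-- A homeomorphism of finite order with a fixed point is trivial. -/
theorem eq_one_of_isOfFinOrder {k : Circle ≃ₜ Circle} (hk : OrientationPreserving k)
    (h : IsOfFinOrder k) {p : Circle} (hp : k p = p) : k = 1 := by
  have key : ∀ k : Circle ≃ₜ Circle, OrientationPreserving k → IsOfFinOrder k → k p = p → ∀ z,
      ¬ pos p z < pos p (k z) := by
    intro k hk h hp z hz
    obtain ⟨n, hn, hkn⟩ := isOfFinOrder_iff_pow_eq_one.1 h
    obtain ⟨s, -, hm, -⟩ := orbit_up hk hp hz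
    have := hm hn
    simp only [hkn, pow_zero] at this
    exact lt_irrefl _ this
  refine Homeomorph.ext fun z => ?_
  rw [← pos_inj (p := p)]
  refine le_antisymm (not_lt.1 (key k hk h hp z)) (not_lt.1 fun e => ?_)
  exact key k⁻¹ hk.inv h.inv (inv_apply_eq.2 hp.symm) z ((lt_pos_inv hk hp).2 e)

theorem Fix_subset_Fix_zpow (k : Circle ≃ₜ Circle) (n : ℤ) : Fix k ⊆ Fix (k ^ n) := by
  intro z hz
  rw [mem_Fix] at hz ⊢
  have hz' : k⁻¹ z = z := inv_apply_eq.2 hz.symm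
  obtain ⟨m, rfl | rfl⟩ := n.eq_nat_or_neg
  · rw [zpow_natCast]; exact pow_fix hz m
  · rw [zpow_neg, zpow_natCast, ← inv_pow]; exact pow_fix hz' m

/-- The subgroup of the homeomorphisms that fix each point of `S`. -/
noncomputable def fixer (S : Set Circle) : Subgroup (Circle ≃ₜ Circle) where
  carrier := {f | ∀ x ∈ S, f x = x}
  mul_mem' := fun {f g} hf hg x hx => by
    change f (g x) = x
    rw [hg x hx, hf x hx]
  one_mem' := fun _ _ => rfl
  inv_mem' := fun {f} hf x hx => inv_apply_eq.2 (hf x hx).symm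

theorem exists_ne_of_ne_one {f : Circle ≃ₜ Circle} (h : f ≠ 1) : ∃ z, f z ≠ z := by
  by_contra! e
  exact h (by ext z; rw [e z]; rfl)

section

variable {L₁ L₂ : Set GoodInterval}

/-- The three possible fixed point sets of a non-trivial laminar automorphism with a fixed point. -/
theorem IsPseudoFibered.fix_trichotomy (hC : IsPseudoFibered L₁ L₂) {k : Circle ≃ₜ Circle}
    (hk : IsAut L₁ L₂ k) (h1 : k ≠ 1) {p : Circle} (hp : k p = p) :
    Fix k = {p} ∨ (∃ a b, IsFixedGap k a b ∧ Fix k = {a, b}) ∨ ∃ P, IsZigzag L₁ L₂ k P := by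
  by_cases e : Fix k = {p}
  · exact Or.inl e
  obtain ⟨q, hq, hqp⟩ : ∃ q, k q = q ∧ p ≠ q := by
    by_contra! e'
    exact e (Subset.antisymm (fun q hq => (e' q hq).symm) (by rintro _ rfl; exact hp))
  obtain ⟨z, hz⟩ := exists_ne_of_ne_one h1
  obtain ⟨a, b, hab, -⟩ := exists_isFixedGap hp hq hqp hz
  by_cases hpair : ∃ a b, IsFixedGap k a b ∧ Fix k = {a, b}
  · exact Or.inr (Or.inl hpair)
  · push Not at hpair
    exact Or.inr (Or.inr (hC.exists_zigzag hk hab hpair))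

theorem IsZigzag.not_isParabolic {k f : Circle ≃ₜ Circle} {P : ℤ → Circle}
    (h : IsZigzag L₁ L₂ k P) (h0 : f (P 0) = P 0) (h1 : f (P 1) = P 1) : ¬ IsParabolic f := by
  rintro ⟨p, hp⟩
  have e0 : P 0 ∈ Fix f := h0
  have e1 : P 1 ∈ Fix f := h1
  rw [hp] at e0 e1
  refine (h.gap 0).ne ?_
  rw [zero_add]
  exact e0.trans e1.symm

/-- An automorphism that fixes the terms of a zigzag has a zigzag with the same terms. -/
theorem IsZigzag.of_fixed (hC : IsPseudoFibered L₁ L₂) {k f : Circle ≃ₜ Circle} {P : ℤ → Circle}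
    (hk : IsAut L₁ L₂ k) (h : IsZigzag L₁ L₂ k P) (hf : IsAut L₁ L₂ f) (h1 : f ≠ 1)
    (hfP : ∀ i, f (P i) = P i) : IsZigzag L₁ L₂ f P := by
  refine ⟨fun i => ?_, h.even, h.odd⟩
  have key : ∀ (L₁ L₂ : Set GoodInterval) (P : ℤ → Circle) (j : ℤ), IsPseudoFibered L₁ L₂ →
      IsAut L₁ L₂ k → IsAut L₁ L₂ f → IsZigzag L₁ L₂ k P → (∀ i, f (P i) = P i) →
      IsFixedGap f (P (2 * j)) (P (2 * j + 1)) := by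
    intro L₁ L₂ P j hC hk hf h hfP
    have hs : IsZigzag L₁ L₂ k fun i => P (i + 2 * j) := by
      refine ⟨fun i => ?_, fun i => ?_, fun i => ?_⟩
      · rw [show i + 1 + 2 * j = i + 2 * j + 1 by ring]; exact h.gap _
      · have := h.even (i + j)
        rwa [show 2 * (i + j) + 2 = 2 * i + 2 + 2 * j by ring, mul_add] at this
      · have := h.odd (i + j)
        rwa [show 2 * (i + j) + 3 = 2 * i + 3 + 2 * j by ring,
          show 2 * (i + j) + 1 = 2 * i + 1 + 2 * j by ring] at this
    have := hs.isFixedGap_of_fixed hC hk hf h1 (hfP _) (hfP _) (hfP _)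
    rwa [zero_add, add_comm] at this
  obtain ⟨j, rfl | rfl⟩ := Int.even_or_odd' i
  · exact key L₁ L₂ P j hC hk hf h hfP
  · exact key L₂ L₁ (fun i => P (i + 1)) j hC.symm hk.symm hf.symm h.shift fun i => hfP _

end

/-! ### Groups acting on sequences by shifts -/

section Shifts

variable {f f' : Circle ≃ₜ Circle} {c : ℤ → Circle} {j j' : ℤ}

theorem Shifts.mul (h : Shifts f c j) (h' : Shifts f' c j') : Shifts (f * f') c (j + j') := by
  intro i
  change f (f' (c i)) = _
  rw [h' i, h, add_assoc, add_comm j' j]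

theorem Shifts.inv (h : Shifts f c j) : Shifts f⁻¹ c (-j) := fun i => by
  rw [inv_apply_eq, h, neg_add_cancel_right]

theorem Shifts.zpow (h : Shifts f c j) (n : ℤ) : Shifts (f ^ n) c (n * j) := by
  induction n with
  | zero => intro i; simp
  | succ n ih => rw [zpow_add_one, add_mul, one_mul]; exact ih.mul h
  | pred n ih => rw [zpow_sub_one, sub_mul, one_mul, sub_eq_add_neg]; exact ih.mul h.inv

/-- Among the elements of a group that shift a given sequence, one shifts by a generator of the
group of all occurring shifts. -/
theorem exists_shift_generator (G : Subgroup (Circle ≃ₜ Circle)) (c : ℤ → Circle) :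
    ∃ f ∈ G, ∃ d, Shifts f c d ∧ ∀ f' ∈ G, ∀ j, Shifts f' c j → ∃ n, j = n * d := by
  let S : AddSubgroup ℤ :=
    { carrier := {j | ∃ f ∈ G, Shifts f c j}
      add_mem' := by
        rintro i j ⟨f, hf, h⟩ ⟨f', hf', h'⟩
        exact ⟨f * f', G.mul_mem hf hf', h.mul h'⟩
      zero_mem' := ⟨1, G.one_mem, fun i => by rw [add_zero]; rfl⟩
      neg_mem' := by
        rintro j ⟨f, hf, h⟩
        exact ⟨f⁻¹, G.inv_mem hf, h.inv⟩ }
  obtain ⟨d, hd⟩ := Int.subgroup_cyclic S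
  rw [← AddSubgroup.zmultiples_eq_closure] at hd
  obtain ⟨f, hf, hfd⟩ : d ∈ S := hd ▸ AddSubgroup.mem_zmultiples d
  refine ⟨f, hf, d, hfd, fun f' hf' j hj => ?_⟩
  have : j ∈ S := ⟨f', hf', hj⟩
  rw [hd, Int.mem_zmultiples_iff] at this
  obtain ⟨n, rfl⟩ := this
  exact ⟨n, mul_comm _ _⟩

end Shifts

/-! ### Groups preserving the fixed points of a zigzag -/

/-- All elements of `G` preserve both `F₁` and `F₂`. -/
def GroupPreserves (G : Subgroup (Circle ≃ₜ Circle)) (F₁ F₂ : Set GoodInterval) : Prop :=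
  ∀ f ∈ G, Preserves f F₁ ∧ Preserves f F₂

/-- The possible structures of `G`, with the dynamics of the generators and, for the two kinds of
products, an interleaving pair preserved by `G`. -/
inductive Outcome (L₁ L₂ : Set GoodInterval) (G : Subgroup (Circle ≃ₜ Circle)) : Prop
  | cyclic (g : Circle ≃ₜ Circle) (hG : G = Subgroup.zpowers g) (hg : ¬ IsOfFinOrder g)
      (h : IsParabolic g ∨ IsHyperbolic g ∨ IsPALike L₁ L₂ g)
  | dihedral (g e : Circle ≃ₜ Circle) (hG : G = Subgroup.closure {g, e}) (hg : ¬ IsOfFinOrder g)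
      (hyp : IsHyperbolic g) (he1 : e ≠ 1) (he : e * e = 1) (hge : e * g * e = g⁻¹)
  | finite (g e : Circle ≃ₜ Circle) (hG : IsInternalProduct G g e) (hg : ¬ IsOfFinOrder g)
      (hpA : IsPALike L₁ L₂ g) (he : IsElliptic e) (F₁ F₂ : Set GoodInterval)
      (hF : IsInterleavingPair L₁ L₂ F₁ F₂) (hF₁ : IsIdealPolygon L₁ F₁)
      (hF₂ : IsIdealPolygon L₂ F₂) (hGF : GroupPreserves G F₁ F₂)
  | infinite (g f : Circle ≃ₜ Circle) (hG : IsInternalProduct G g f) (hg : ¬ IsOfFinOrder g)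
      (hf : ¬ IsOfFinOrder f) (hpA : IsProperlyPA L₁ L₂ g) (hpar : IsParabolic f)
      (F₁ F₂ : Set GoodInterval) (hF : IsInterleavingPair L₁ L₂ F₁ F₂) (hF₁ : IsCrown L₁ F₁)
      (hF₂ : IsCrown L₂ F₂) (hGF : GroupPreserves G F₁ F₂)

section Zigzag

variable {L₁ L₂ : Set GoodInterval} {k : Circle ≃ₜ Circle} {P : ℤ → Circle}
  (hC : IsPseudoFibered L₁ L₂) (hk : IsAut L₁ L₂ k) (h : IsZigzag L₁ L₂ k P)

theorem IsZigzag.shifts_of_eq (h : IsZigzag L₁ L₂ k P) {m : ℤ} (e : P m = P 0) (i : ℤ) :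
    P (i + m) = P i := by
  induction i with
  | zero => rw [zero_add, e]
  | succ n ih =>
    rw [show (n : ℤ) + 1 + m = n + m + 1 by ring]
    exact h.eq_succ ih
  | pred n ih =>
    rw [show -(n : ℤ) - 1 + m = -n + m - 1 by ring]
    exact h.eq_pred ih

theorem IsZigzag.fixed_of_shifts (h : IsZigzag L₁ L₂ k P) {f : Circle ≃ₜ Circle} {m : ℤ}
    (hf : Shifts f P m) {j : ℤ} (hj : f (P j) = P j) (i : ℤ) : f (P i) = P i := by
  rw [hf] at hj ⊢
  have key : ∀ n : ℤ, P (j + n + m) = P (j + n) := by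
    intro n
    induction n with
    | zero => simpa using hj
    | succ n ih =>
      rw [show j + ((n : ℤ) + 1) + m = j + n + m + 1 by ring, ← add_assoc]
      exact h.eq_succ ih
    | pred n ih =>
      rw [show j + (-(n : ℤ) - 1) + m = j + -n + m - 1 by ring, ← add_sub_assoc]
      exact h.eq_pred ih
  have := key (i - j)
  rwa [add_sub_cancel] at this

include h in
/-- An automorphism that shifts the zigzag and fixes a point that is not exceptional fixes all terms
of the zigzag. -/
theorem IsZigzag.fixed_of_shifts_of_fixed {f : Circle ≃ₜ Circle} (hfo : OrientationPreserving f)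
    {m : ℤ} (hf : Shifts f P m) {z : Circle} (hz : f z = z) (hz' : z ∉ ends P) (i : ℤ) :
    f (P i) = P i := by
  simp only [ends, mem_ofPred_eq, not_forall] at hz'
  obtain ⟨j, hj⟩ := hz'
  by_cases e : z = P j
  · exact h.fixed_of_shifts hf (e ▸ hz) i
  · have h1 : CCW (P j) z (P (j + 1)) := by
      by_contra e'; exact hj ⟨e, e'⟩
    have h2 := hfo _ _ _ h1
    rw [hz, hf, hf, show j + 1 + m = j + m + 1 by ring] at h2
    have h3 := (h.gap j).eq_of_mem (h.gap (j + m)) h1 h2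
    exact h.fixed_of_shifts hf ((hf j).trans h3.1.symm) i

include hC hk h

/-- The automorphisms in a group that fix all terms of the zigzag form a cyclic group, generated by
an element that moves the points forward between `P 0` and `P 1`. -/
theorem IsZigzag.exists_generator {G : Subgroup (Circle ≃ₜ Circle)} (hG : G ≤ autPair L₁ L₂)
    (hkG : k ∈ G) : ∃ l, G ⊓ fixer (range P) = Subgroup.zpowers l ∧ ¬ IsOfFinOrder l ∧
      IsZigzag L₁ L₂ l P ∧ MovesForward l (P 0) (P 1) := by
  have hA : ∀ f ∈ G ⊓ fixer (range P), IsAut L₁ L₂ f := fun f hf => mem_autPair.1 (hG hf.1)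
  have hz : ∀ f ∈ G ⊓ fixer (range P), f ≠ 1 → IsZigzag L₁ L₂ f P := fun f hf h1 =>
    h.of_fixed hC hk (hA f hf) h1 fun i => hf.2 _ ⟨i, rfl⟩
  have hgap : ∀ f ∈ G ⊓ fixer (range P), f ≠ 1 → IsFixedGap f (P 0) (P 1) := fun f hf h1 => by
    simpa using (hz f hf h1).gap 0
  obtain ⟨l, hl⟩ := hC.exists_zpowers (fun f hf => (hA f hf).1) hgap (fun f hf => (hA f hf).2)
    (fun f hf => (hA f hf).3)
  have hkK : k ∈ G ⊓ fixer (range P) := ⟨hkG, by rintro _ ⟨i, rfl⟩; exact (h.gap i).left⟩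
  have hk1 : k ≠ 1 := by
    rintro rfl
    obtain ⟨z, hz⟩ := exists_ccw (h.gap 0).ne
    exact (h.gap 0).free z hz rfl
  have hlK : l ∈ G ⊓ fixer (range P) := hl ▸ Subgroup.mem_zpowers l
  have hl1 : l ≠ 1 := by
    rintro rfl
    rw [hl, Subgroup.zpowers_one_eq_bot, Subgroup.mem_bot] at hkK
    exact hk1 hkK
  have hlo : ¬ IsOfFinOrder l := fun e =>
    hl1 (eq_one_of_isOfFinOrder (hA l hlK).1 e (hlK.2 _ ⟨0, rfl⟩))
  rcases (hgap l hlK hl1).forward_or (hA l hlK).1 with e | e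
  · exact ⟨l, hl, hlo, hz l hlK hl1, e⟩
  · exact ⟨l⁻¹, by rw [hl, Subgroup.zpowers_inv], by rwa [isOfFinOrder_inv_iff],
      hz _ (inv_mem hlK) (inv_ne_one.2 hl1), e⟩

/-- A group of automorphisms that preserve the fixed point set of one of its elements with a zigzag
is abelian. The elements acting trivially on the zigzag form a cyclic group, which is central
because the other elements preserve the direction of motion, and the action on the zigzag is by
shifts. The result is a product of `ℤ` with a cyclic group, which is finite if the zigzag is
periodic. -/
theorem IsZigzag.outcome {G : Subgroup (Circle ≃ₜ Circle)} (hG : G ≤ autPair L₁ L₂) (hkG : k ∈ G)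
    (hfix : ∀ f ∈ G, ∀ z, k (f z) = f z ↔ k z = z) : Outcome L₁ L₂ G := by
  have hA : ∀ f ∈ G, IsAut L₁ L₂ f := fun f hf => mem_autPair.1 (hG hf)
  obtain ⟨l, hl, hlo, hlz, hlf⟩ := h.exists_generator hC hk hG hkG
  have hsh : ∀ f ∈ G, ∃ j, Shifts f P (2 * j) := fun f hf => h.exists_shift hC hk (hA f hf) (hfix f hf)
  have hlK : l ∈ G ⊓ fixer (range P) := hl ▸ Subgroup.mem_zpowers l
  have hlA := hA l hlK.1
  have hK : ∀ f ∈ G, Shifts f P 0 → f ∈ Subgroup.zpowers l := fun f hf h0 => by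
    rw [← hl]
    refine ⟨hf, ?_⟩
    rintro _ ⟨i, rfl⟩
    rw [h0, add_zero]
  have hl0 : Shifts l P 0 := fun i => by rw [add_zero]; exact hlK.2 _ ⟨i, rfl⟩
  have hcomm : ∀ f ∈ G, Commute f l := by
    intro f hf
    obtain ⟨j, hj⟩ := hsh f hf
    have h1 : f * l * f⁻¹ ∈ Subgroup.zpowers l :=
      hK _ (G.mul_mem (G.mul_mem hf hlK.1) (G.inv_mem hf)) (by
        have := (hj.mul hl0).mul hj.inv
        rwa [add_zero, add_neg_cancel] at this)
    have h2 : f⁻¹ * l * f ∈ Subgroup.zpowers l :=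
      hK _ (G.mul_mem (G.mul_mem (G.inv_mem hf) hlK.1) hf) (by
        have := (hj.inv.mul hl0).mul hj
        rwa [add_zero, neg_add_cancel] at this)
    rcases conj_eq_or_eq_inv hlo h1 h2 with e | e
    · exact mul_inv_eq_iff_eq_mul.1 e
    · exfalso
      have h3 : MovesForward l (P (2 * j)) (P (2 * j + 1)) := by
        have := hlz.forward_two hC hlA 0 (by simpa using hlf) j
        simpa using this
      have h4 : MovesForward l⁻¹ (P (2 * j)) (P (2 * j + 1)) := by
        intro z hz
        obtain ⟨w, rfl⟩ := f.surjective z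
        have e0 : P (2 * j) = f (P 0) := by rw [hj, zero_add]
        have e1 : P (2 * j + 1) = f (P 1) := by rw [hj, add_comm]
        have e2 : l⁻¹ (f w) = f (l w) := by
          rw [← e]
          change f (l (f⁻¹ (f w))) = _
          rw [inv_apply_self]
        rw [e0, e1, (hA f hf).1.ccw_iff] at hz
        rw [e0, e2, (hA f hf).1.ccw_iff]
        exact hlf w hz
      exact h3.not_inv hlA.1 (hlz.gap _) h4
  obtain ⟨f, hf, d, hfd, hd⟩ := exists_shift_generator G P
  have hGsup : G = Subgroup.zpowers f ⊔ Subgroup.zpowers l := by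
    refine le_antisymm (fun f' hf' => ?_) ?_
    · obtain ⟨j, hj⟩ := hsh f' hf'
      obtain ⟨n, hn⟩ := hd f' hf' _ hj
      have h1 : (f ^ n)⁻¹ * f' ∈ Subgroup.zpowers l := by
        refine hK _ (G.mul_mem (G.inv_mem (G.zpow_mem hf n)) hf') ?_
        have := (hfd.zpow n).inv.mul hj
        rwa [hn, neg_add_cancel] at this
      rw [← mul_inv_cancel_left (f ^ n) f']
      exact mul_mem (Subgroup.mem_sup_left (Subgroup.zpow_mem_zpowers f n))
        (Subgroup.mem_sup_right h1)
    · rw [sup_le_iff, Subgroup.zpowers_le, Subgroup.zpowers_le]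
      exact ⟨hf, hlK.1⟩
  have hpres : GroupPreserves G (chainSides fun i => P (2 * i)) (chainSides fun i => P (2 * i + 1)) :=
    fun f hf => by
      obtain ⟨j, hj⟩ := hsh f hf
      exact preserves_of_shift hj
  have hpair := h.isInterleavingPair hC hk
  have hl1 : l ≠ 1 := fun e => hlo (e ▸ IsOfFinOrder.one)
  have hlpA : IsPALike L₁ L₂ l := ⟨hG hlK.1, hl1, fun e => hlo e.2,
    h.not_isParabolic (hlK.2 _ ⟨0, rfl⟩) (hlK.2 _ ⟨1, rfl⟩), _, _, hpair, hpres l hlK.1⟩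
  rcases (ends P).eq_empty_or_nonempty with he | he
  · obtain ⟨hp1, hp2⟩ := h.isIdealPolygon hC hk he
    -- a finite vertex set makes the sequence periodic
    obtain ⟨t, ht, htP⟩ : ∃ t, t ≠ 0 ∧ P t = P 0 := by
      have hfin : (range fun i : ℤ => P (2 * i)).Finite := hp1.2.subset fun z hz =>
        (h.mem_vertexSet_even hC).2 (Or.inl hz)
      have hni : ¬ Function.Injective fun i : ℤ => P (2 * i) := fun hi =>
        infinite_range_of_injective hi hfin
      simp only [Function.Injective, not_forall] at hni
      obtain ⟨i, j, e, hij⟩ := hni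
      refine ⟨2 * i - 2 * j, by omega, ?_⟩
      have hs : ∀ n : ℤ, P (2 * i + n) = P (2 * j + n) := by
        intro n
        induction n with
        | zero => simpa using e
        | succ n ih => rw [← add_assoc, ← add_assoc]; exact h.eq_succ ih
        | pred n ih => rw [← add_sub_assoc, ← add_sub_assoc]; exact h.eq_pred ih
      have := hs (-(2 * j))
      rwa [add_neg_cancel, ← sub_eq_add_neg] at this
    have h1t : Shifts 1 P t := fun i => (h.shifts_of_eq htP i).symm
    obtain ⟨m, hm⟩ := hd 1 G.one_mem t h1t
    have hm0 : m ≠ 0 := by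
      rintro rfl
      exact ht (by rw [hm, zero_mul])
    have hfm : f ^ m ∈ Subgroup.zpowers l := by
      refine hK _ (G.zpow_mem hf m) ?_
      have := (hfd.zpow m).mul h1t.inv
      rwa [hm, add_neg_cancel, inv_one, mul_one] at this
    obtain ⟨r, hr⟩ := Subgroup.mem_zpowers_iff.1 hfm
    obtain ⟨g, e, hg, he', hprod⟩ := exists_isInternalProduct (hcomm f hf) hlo hm0 hr.symm
    rw [← hGsup] at hprod
    have hgG : g ∈ G := hprod.1 ▸ Subgroup.mem_sup_left (Subgroup.mem_zpowers g)
    have hgpA : IsPALike L₁ L₂ g := by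
      refine ⟨hG hgG, fun e => hg (e ▸ IsOfFinOrder.one), fun e => hg e.2, ?_, _, _, hpair,
        hpres g hgG⟩
      intro hpar
      obtain ⟨p, hp⟩ := id hpar
      have hgp : g p = p := by rw [← mem_Fix, hp]; rfl
      obtain ⟨j, hj⟩ := hsh g hgG
      have hfx := h.fixed_of_shifts_of_fixed (hA g hgG).1 hj hgp (by rw [he]; exact notMem_empty _)
      exact h.not_isParabolic (hfx 0) (hfx 1) hpar
    by_cases he1 : e = 1
    · refine .cyclic g ?_ hg (Or.inr (Or.inr hgpA))
      rw [hprod.1, he1, Subgroup.zpowers_one_eq_bot, sup_bot_eq]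
    · exact .finite g e hprod hg hgpA ⟨he1, he'⟩ _ _ hpair hp1 hp2 hpres
  · obtain ⟨hc1, hc2⟩ := h.isCrown hC hk he
    by_cases hd0 : d = 0
    · refine .cyclic l ?_ hlo (Or.inr (Or.inr hlpA))
      have : f ∈ Subgroup.zpowers l := hK f hf (hd0 ▸ hfd)
      rw [hGsup, sup_eq_right, Subgroup.zpowers_le]
      exact this
    · obtain ⟨w, hw⟩ := he
      have hinj := injective_of_mem_ends (fun i => (h.gap i).ne) hw
      have hpow : ∀ n : ℤ, Shifts (f ^ n) P 0 → n = 0 := by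
        intro n hn
        have h1 := (hfd.zpow n 0).symm.trans (hn 0)
        have h2 := hinj h1
        rw [zero_add, zero_add] at h2
        exact (mul_eq_zero.1 h2).resolve_right hd0
      have hfo : ¬ IsOfFinOrder f := by
        intro e
        obtain ⟨n, hn, hn'⟩ := isOfFinOrder_iff_zpow_eq_one.1 e
        exact hn (hpow n fun i => by rw [hn', add_zero]; rfl)
      have hdis : Disjoint (Subgroup.zpowers l) (Subgroup.zpowers f) := by
        rw [Subgroup.disjoint_def]
        rintro _ ⟨m, rfl⟩ hm
        obtain ⟨n, hn⟩ := Subgroup.mem_zpowers_iff.1 hm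
        have h1 := hl0.zpow m
        rw [mul_zero] at h1
        have h2 : n = 0 := hpow n (by rw [hn]; exact h1)
        rw [h2, zpow_zero] at hn
        exact hn.symm
      -- `f` fixes the unique exceptional point, and no other point
      have hfw : f w = w := by
        refine h.ends_subsingleton hC hk (fun i => ?_) hw
        have e0 : P i = f (P (i - d)) := by rw [hfd, sub_add_cancel]
        have e1 : P (i + 1) = f (P (i - d + 1)) := by
          rw [hfd, show i - d + 1 + d = i + 1 by ring]
        rw [e0, e1, (hA f hf).1.ccw_iff]
        exact ⟨fun e => (hw (i - d)).1 (f.injective e), (hw (i - d)).2⟩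
      have hpar : Fix f = {w} := by
        refine Subset.antisymm (fun z hz => ?_) (by rintro _ rfl; exact hfw)
        by_contra hzw
        have hz' : z ∉ ends P := fun e => hzw (h.ends_subsingleton hC hk e hw)
        have := h.fixed_of_shifts_of_fixed (hA f hf).1 hfd hz hz' 0
        rw [hfd, zero_add] at this
        exact hd0 (hinj this)
      exact .infinite l f ⟨by rw [hGsup, sup_comm], (hcomm f hf).symm, hdis⟩ hlo hfo
        ⟨hlpA, P 0, hlK.2 _ ⟨0, rfl⟩⟩ ⟨w, hpar⟩ _ _ hpair hc1 hc2 hpres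

end Zigzag

/-! ### Groups preserving a pair of fixed points -/

section

variable {L₁ L₂ : Set GoodInterval} {g : Circle ≃ₜ Circle} {a b p : Circle}

/-- If `g ∈ G` has exactly two fixed points, the stabilizer of these in `G` is infinite cyclic and
generated by a hyperbolic element; any other element of `G` exchanges the two points and inverts
this generator. -/
theorem IsPseudoFibered.outcome_of_fix_pair (hC : IsPseudoFibered L₁ L₂)
    {G : Subgroup (Circle ≃ₜ Circle)} (hG : G ≤ autPair L₁ L₂) (hgG : g ∈ G)
    (hab : IsFixedGap g a b) (hF : Fix g = {a, b})
    (hfix : ∀ f ∈ G, ∀ z, g (f z) = f z ↔ g z = z) : Outcome L₁ L₂ G := by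
  have hA : ∀ f ∈ G, IsAut L₁ L₂ f := fun f hf => mem_autPair.1 (hG hf)
  have hga := hA g hgG
  have hF' : Fix g = {b, a} := by rw [hF, pair_comm]
  have hna : (∀ y, ¬ Lf L₁ a y) ∧ ∀ y, ¬ Lf L₂ a y :=
    ⟨hC.isTame_left.not_lf_of_fix_pair hga.1 hga.2 hab.ne hF,
      hC.isTame_right.not_lf_of_fix_pair hga.1 hga.3 hab.ne hF⟩
  have hnb : (∀ y, ¬ Lf L₁ b y) ∧ ∀ y, ¬ Lf L₂ b y :=
    ⟨hC.isTame_left.not_lf_of_fix_pair hga.1 hga.2 hab.ne.symm hF',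
      hC.isTame_right.not_lf_of_fix_pair hga.1 hga.3 hab.ne.symm hF'⟩
  have hfa : ∀ f ∈ G ⊓ fixer {a, b}, f a = a := fun f hf => hf.2 a (by simp)
  have hfb : ∀ f ∈ G ⊓ fixer {a, b}, f b = b := fun f hf => hf.2 b (by simp)
  have hK : ∀ f ∈ G ⊓ fixer {a, b}, f ≠ 1 → Fix f = {a, b} := by
    intro f hf h1
    have hab' : a ∈ Fix f ∧ b ∈ Fix f := ⟨hfa f hf, hfb f hf⟩
    rcases hC.fix_trichotomy (hA f hf.1) h1 (hfa f hf) with e | ⟨c, d, -, e⟩ | ⟨P, hP⟩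
    · rw [e] at hab'
      exact absurd hab'.2.symm hab.ne
    · rw [e, mem_insert_iff, mem_singleton_iff, mem_insert_iff, mem_singleton_iff] at hab'
      have := hab.ne
      rw [e]
      rcases hab' with ⟨rfl | rfl, rfl | rfl⟩
      · exact absurd rfl this
      · rfl
      · exact pair_comm _ _
      · exact absurd rfl this
    · exfalso
      have key : ∀ x, f x = x → (∀ y, ¬ Lf L₁ x y) ∧ (∀ y, ¬ Lf L₂ x y) → x ∈ ends P := by
        intro x hx hn
        refine ((hP.fixed_iff hC (hA f hf.1)).1 hx).resolve_left ?_
        rintro ⟨i, rfl⟩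
        obtain ⟨j, rfl | rfl⟩ := Int.even_or_odd' i
        · exact hn.1 _ (hP.even j)
        · exact hn.2 _ (hP.odd j)
      exact hab.ne (hP.ends_subsingleton hC (hA f hf.1) (key a (hfa f hf) hna)
        (key b (hfb f hf) hnb))
  have hgapF : ∀ f, Fix f = {a, b} → IsFixedGap f a b ∧ IsFixedGap f b a := by
    intro f e
    have ha : f a = a := by rw [← mem_Fix, e]; simp
    have hb : f b = b := by rw [← mem_Fix, e]; simp
    refine ⟨⟨hab.ne, ha, hb, fun z hz hf => ?_⟩, ⟨hab.ne.symm, hb, ha, fun z hz hf => ?_⟩⟩ <;>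
    · rw [← mem_Fix, e] at hf
      have := hz.ne
      rcases hf with rfl | rfl
      · simp at this
      · simp at this
  have hgap : ∀ f ∈ G ⊓ fixer {a, b}, f ≠ 1 → IsFixedGap f a b := fun f hf h1 =>
    (hgapF f (hK f hf h1)).1
  obtain ⟨l₀, hl₀⟩ := hC.exists_zpowers (K := G ⊓ fixer {a, b})
    (fun f hf => (hA f hf.1).1) hgap (fun f hf => (hA f hf.1).2) (fun f hf => (hA f hf.1).3)
  have hgK : g ∈ G ⊓ fixer {a, b} := ⟨hgG, by
    rintro x (rfl | rfl)
    exacts [hab.left, hab.right]⟩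
  have hg1 : g ≠ 1 := by
    rintro rfl
    obtain ⟨z, hz⟩ := exists_ccw hab.ne
    exact hab.free z hz rfl
  have hl₀K : l₀ ∈ G ⊓ fixer {a, b} := hl₀ ▸ Subgroup.mem_zpowers l₀
  have hl₀1 : l₀ ≠ 1 := by
    rintro rfl
    rw [hl₀, Subgroup.zpowers_one_eq_bot, Subgroup.mem_bot] at hgK
    exact hg1 hgK
  obtain ⟨l, hl, hlf⟩ : ∃ l, G ⊓ fixer {a, b} = Subgroup.zpowers l ∧ MovesForward l a b := by
    rcases (hgap l₀ hl₀K hl₀1).forward_or (hA l₀ hl₀K.1).1 with e | e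
    · exact ⟨l₀, hl₀, e⟩
    · exact ⟨l₀⁻¹, by rw [hl₀, Subgroup.zpowers_inv], e⟩
  have hlK : l ∈ G ⊓ fixer {a, b} := hl ▸ Subgroup.mem_zpowers l
  have hl1 : l ≠ 1 := by
    rintro rfl
    rw [hl, Subgroup.zpowers_one_eq_bot, Subgroup.mem_bot] at hgK
    exact hg1 hgK
  have hlA := hA l hlK.1
  have hlF := hK l hlK hl1
  obtain ⟨hlab, hlba⟩ := hgapF l hlF
  have hlo : ¬ IsOfFinOrder l := fun e => hl1 (eq_one_of_isOfFinOrder hlA.1 e (hfa l hlK))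
  have hhyp : IsHyperbolic l := hC.isHyperbolic hlA hlab hlF
  have hperm : ∀ f ∈ G, (f a = a ∧ f b = b) ∨ (f a = b ∧ f b = a) := by
    intro f hf
    have ha : f a ∈ Fix g := (hfix f hf a).2 hab.left
    have hb : f b ∈ Fix g := (hfix f hf b).2 hab.right
    have hne : f a ≠ f b := fun e => hab.ne (f.injective e)
    rw [hF, mem_insert_iff, mem_singleton_iff] at ha hb
    rcases ha with ha | ha <;> rcases hb with hb | hb
    · exact absurd (ha.trans hb.symm) hne
    · exact Or.inl ⟨ha, hb⟩
    · exact Or.inr ⟨ha, hb⟩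
    · exact absurd (ha.trans hb.symm) hne
  have hmemK : ∀ f ∈ G, f a = a → f b = b → f ∈ Subgroup.zpowers l := fun f hf ha hb => by
    rw [← hl]
    refine ⟨hf, ?_⟩
    rintro x (rfl | rfl)
    exacts [ha, hb]
  by_cases hsw : ∃ e ∈ G, e a = b ∧ e b = a
  · obtain ⟨e, he, hea, heb⟩ := hsw
    have hea' : e⁻¹ a = b := inv_apply_eq.2 heb.symm
    have heb' : e⁻¹ b = a := inv_apply_eq.2 hea.symm
    have hla := hfa l hlK
    have hlb := hfb l hlK
    have hee : e * e ∈ Subgroup.zpowers l := hmemK _ (G.mul_mem he he)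
      (by change e (e a) = a; rw [hea, heb]) (by change e (e b) = b; rw [heb, hea])
    have h1 : e * l * e⁻¹ ∈ Subgroup.zpowers l :=
      hmemK _ (G.mul_mem (G.mul_mem he hlK.1) (G.inv_mem he))
        (by change e (l (e⁻¹ a)) = a; rw [hea', hlb, heb])
        (by change e (l (e⁻¹ b)) = b; rw [heb', hla, hea])
    have h2 : e⁻¹ * l * e ∈ Subgroup.zpowers l :=
      hmemK _ (G.mul_mem (G.mul_mem (G.inv_mem he) hlK.1) he)
        (by change e⁻¹ (l (e a)) = a; rw [hea, hlb, heb'])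
        (by change e⁻¹ (l (e b)) = b; rw [heb, hla, hea'])
    have hinv : e * l * e⁻¹ = l⁻¹ := by
      refine (conj_eq_or_eq_inv hlo h1 h2).resolve_left fun hcon => ?_
      -- `l` would move forward on both components, but it moves backwards on `(b, a)`
      have h3 : MovesForward l b a := by
        intro z hz
        obtain ⟨w, rfl⟩ := e.surjective z
        have e2 : l (e w) = e (l w) := by
          conv_lhs => rw [← hcon]
          change e (l (e⁻¹ (e w))) = _
          rw [inv_apply_self]
        have hz' : CCW (e a) (e w) (e b) := by rwa [hea, heb]
        have : CCW (e a) (e w) (e (l w)) := (hA e he).1 _ _ _ (hlf w ((hA e he).1.ccw_iff.1 hz'))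
        rwa [hea, ← e2] at this
      obtain ⟨a', b', -, hb', h4, -⟩ := hC.neighbours hlA hlab
      have := (h4 hlf).2
      rw [← hlba.right_unique hb'] at this
      exact h3.not_inv hlA.1 hlba this
    have he2 : e * e = 1 := by
      obtain ⟨m, hm⟩ := Subgroup.mem_zpowers_iff.1 hee
      have h3 : e * l ^ m * e⁻¹ = l ^ (-m) := by
        rw [← conj_zpow, hinv, inv_zpow, zpow_neg]
      rw [hm, ← mul_assoc, mul_inv_cancel_right, ← hm] at h3
      have := injective_zpow_iff_not_isOfFinOrder.2 hlo h3
      have hm0 : m = 0 := by omega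
      rw [← hm, hm0, zpow_zero]
    have hei : e⁻¹ = e := inv_eq_of_mul_eq_one_left he2
    refine .dihedral l e (le_antisymm (fun f hf => ?_) ?_) hlo hhyp ?_ he2 ?_
    · have hl' : l ∈ Subgroup.closure {l, e} := Subgroup.subset_closure (by simp)
      have he' : e ∈ Subgroup.closure {l, e} := Subgroup.subset_closure (by simp)
      have hle : Subgroup.zpowers l ≤ Subgroup.closure {l, e} := (Subgroup.zpowers_le).2 hl'
      rcases hperm f hf with ⟨ha, hb⟩ | ⟨ha, hb⟩
      · exact hle (hmemK f hf ha hb)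
      · have := hmemK (e * f) (G.mul_mem he hf) (by change e (f a) = a; rw [ha, heb])
          (by change e (f b) = b; rw [hb, hea])
        rw [← inv_mul_cancel_left e f]
        exact mul_mem (inv_mem he') (hle this)
    · rw [Subgroup.closure_le]
      rintro _ (rfl | rfl)
      exacts [hlK.1, he]
    · rintro rfl
      exact hab.ne hea
    · rwa [hei] at hinv
  · push Not at hsw
    refine .cyclic l (le_antisymm (fun f hf => ?_) (by rw [Subgroup.zpowers_le]; exact hlK.1)) hlo
      (Or.inr (Or.inl hhyp))
    rcases hperm f hf with ⟨ha, hb⟩ | ⟨ha, hb⟩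
    · exact hmemK f hf ha hb
    · exact absurd hb (hsw f hf ha)

/-! ### Groups fixing a point -/

theorem IsGap.image_map {L Q : Set GoodInterval} (hQ : IsGap L Q) {f : Circle ≃ₜ Circle}
    (hf : OrientationPreserving f) (hfL : Preserves f L) : IsGap L (GoodInterval.map f '' Q) where
  subset := by
    rintro _ ⟨I, hI, rfl⟩
    exact hfL.mem_iff.2 (hQ.subset hI)
  disjoint := by
    rintro _ ⟨I, hI, rfl⟩ _ ⟨J, hJ, rfl⟩ hne
    rw [GoodInterval.arc_map hf, GoodInterval.arc_map hf, disjoint_image_iff f.injective]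
    exact hQ.disjoint I hI J hJ fun e => hne (by rw [e])
  lies := by
    intro I hI
    obtain ⟨J, hJ, e⟩ := hQ.lies (I.map f⁻¹) (hfL.inv.mem_iff.2 hI)
    refine ⟨_, ⟨J, hJ, rfl⟩, ?_⟩
    have h1 : (I.map f⁻¹).map f = I := GoodInterval.map_map_inv I
    rcases e with e | e
    · left
      rw [← GoodInterval.map_arc_subset hf, h1] at e
      exact e
    · right
      rw [← GoodInterval.map_arc_subset hf, GoodInterval.map_opp, h1] at e
      exact e

/-- In a loose lamination there is at most one gap with a given vertex at which no side ends. -/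
theorem IsTame.eq_of_pivot {L Q R : Set GoodInterval} (hL : IsTame L) (hQ : IsGap L Q)
    (hR : IsGap L R) (hp : p ∈ vertexSet Q) (hp' : p ∈ vertexSet R) (hs : ∀ I ∈ Q, I.left ≠ p)
    (hs' : ∀ I ∈ R, I.left ≠ p) : Q = R := by
  have key : ∀ Q, IsGap L Q → p ∈ vertexSet Q → (∀ I ∈ Q, I.left ≠ p) → IsNonLeafGap L Q := by
    rintro Q hQ hp hs
    refine ⟨hQ, ?_⟩
    rintro ⟨I, -, rfl⟩
    rw [vertexSet_leaf] at hp
    rcases hp with e | e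
    · exact hs I (Or.inl rfl) e.symm
    · exact hs I.opp (Or.inr rfl) e.symm
  by_contra hne
  exact Set.disjoint_left.1 (hL.loose Q R (key Q hQ hp hs) (key R hR hp' hs') hne) hp hp'

theorem IsTame.preserves_of_pivot {L Q : Set GoodInterval} (hL : IsTame L) (hQ : IsGap L Q)
    (hp : p ∈ vertexSet Q) (hs : ∀ I ∈ Q, I.left ≠ p) {f : Circle ≃ₜ Circle}
    (hf : OrientationPreserving f) (hfL : Preserves f L) (hfp : f p = p) : Preserves f Q := by
  refine hL.eq_of_pivot (hQ.image_map hf hfL) hQ ?_ hp ?_ hs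
  · rw [mem_vertexSet] at hp ⊢
    rintro _ ⟨I, hI, rfl⟩ e
    rw [← hfp, GoodInterval.mem_map_arc hf] at e
    exact hp I hI e
  · rintro _ ⟨I, hI, rfl⟩ e
    exact hs I hI (f.injective (e.trans hfp.symm))

/-- If `g ∈ G` has exactly one fixed point `p`, then `G` acts by shifts on the sides of the crown of
`L₁` with pivot `p`. Either this action is faithful and `G` is generated by a parabolic element, or
some non-trivial element of `G` fixes all sides; this has a zigzag with exceptional point `p`,
and `G` preserves both gaps of the zigzag. -/
theorem IsPseudoFibered.outcome_of_fix_singleton (hC : IsPseudoFibered L₁ L₂)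
    {G : Subgroup (Circle ≃ₜ Circle)} (hG : G ≤ autPair L₁ L₂) (hgG : g ∈ G)
    (hgo : ¬ IsOfFinOrder g) (hF : Fix g = {p})
    (hfix : ∀ f ∈ G, ∀ z, g (f z) = f z ↔ g z = z) : Outcome L₁ L₂ G := by
  have hA : ∀ f ∈ G, IsAut L₁ L₂ f := fun f hf => mem_autPair.1 (hG hf)
  have hga := hA g hgG
  have hgp : g p = p := by rw [← mem_Fix, hF]; rfl
  have hfp : ∀ f ∈ G, f p = p := fun f hf => by
    have : f p ∈ Fix g := (hfix f hf p).2 hgp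
    rwa [hF] at this
  have hnp : ∀ y, ¬ Lf L₁ p y ∧ ¬ Lf L₂ p y := by
    intro y
    constructor
    · intro e
      have : y ∈ Fix g := hC.isTame_left.fixed_of_lf hga.1 hga.2 hgp e
      rw [hF] at this
      exact e.1 this.symm
    · intro e
      have : y ∈ Fix g := hC.isTame_right.fixed_of_lf hga.1 hga.3 hgp e
      rw [hF] at this
      exact e.1 this.symm
  obtain ⟨Q, hQ, hpQ, hsQ⟩ := hC.isTame_left.exists_crown hga.1 hga.2 hF
  have hpres : ∀ f ∈ G, Preserves f Q := fun f hf => hC.isTame_left.preserves_of_pivot hQ.1 hpQ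
    (fun I hI => (hsQ I hI).1) (hA f hf).1 (hA f hf).2 (hfp f hf)
  obtain ⟨hQg, t, -, ht, -, hQt, -⟩ := hQ
  have hside : ∀ i, (⟨t i, t (i + 1), ht i⟩ : GoodInterval) ∈ Q := fun i => hQt ▸ ⟨i, rfl⟩
  have hsh : ∀ f ∈ G, ∃ j, Shifts f t j := by
    intro f hf
    refine exists_shifts (fun i => ?_) (fun i j e => ?_) (fun i j e => ?_)
    · have h1 := (hpres f hf).mem_iff.2 (hside i)
      rw [hQt] at h1
      obtain ⟨m, hm⟩ := h1
      exact ⟨m, (congrArg GoodInterval.left hm).symm, (congrArg GoodInterval.right hm).symm⟩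
    · exact congrArg GoodInterval.right (hQg.eq_of_left_eq (hside i) (hside j) e)
    · exact congrArg GoodInterval.left (hQg.eq_of_right_eq (hside (i - 1)) (hside (j - 1))
        (by simpa using e))
  by_cases htriv : G ⊓ fixer (range t) = ⊥
  · obtain ⟨f, hf, d, hfd, hd⟩ := exists_shift_generator G t
    have hGf : G = Subgroup.zpowers f := by
      refine le_antisymm (fun f' hf' => ?_) (by rw [Subgroup.zpowers_le]; exact hf)
      obtain ⟨j, hj⟩ := hsh f' hf'
      obtain ⟨n, hn⟩ := hd f' hf' j hj
      have h1 : (f ^ n)⁻¹ * f' ∈ G ⊓ fixer (range t) := by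
        refine ⟨G.mul_mem (G.inv_mem (G.zpow_mem hf n)) hf', ?_⟩
        have := (hfd.zpow n).inv.mul hj
        rw [hn, neg_add_cancel] at this
        rintro _ ⟨i, rfl⟩
        rw [this, add_zero]
      rw [htriv, Subgroup.mem_bot, inv_mul_eq_one] at h1
      exact Subgroup.mem_zpowers_iff.2 ⟨n, h1⟩
    obtain ⟨n, hn⟩ := Subgroup.mem_zpowers_iff.1 (hGf ▸ hgG : g ∈ Subgroup.zpowers f)
    refine .cyclic f hGf (fun e => hgo (hn ▸ e.zpow)) (Or.inl ⟨p, Subset.antisymm ?_ ?_⟩)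
    · rw [← hF, ← hn]
      exact Fix_subset_Fix_zpow f n
    · rintro _ rfl
      exact hfp f hf
  · obtain ⟨k, ⟨hkG, hkt⟩, hk1⟩ := (Subgroup.bot_or_exists_ne_one _).resolve_left htriv
    have hkA := hA k hkG
    have hp0 : p ∈ Fix k := hfp k hkG
    have ht0 : t 0 ∈ Fix k := hkt _ ⟨0, rfl⟩
    have ht1 : t 1 ∈ Fix k := hkt _ ⟨1, rfl⟩
    have n1 : t 0 ≠ p := (hsQ _ (hside 0)).1
    have n2 : t 1 ≠ p := (hsQ _ (hside 1)).1
    have n3 : t 0 ≠ t 1 := ht 0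
    rcases hC.fix_trichotomy hkA hk1 (hfp k hkG) with e | ⟨c, d, -, e⟩ | ⟨P, hP⟩
    · rw [e] at ht0
      exact absurd ht0 n1
    · rw [e, mem_insert_iff, mem_singleton_iff] at hp0 ht0 ht1
      exfalso
      grind
    · have hpe : p ∈ ends P := by
        refine ((hP.fixed_iff hC hkA).1 (hfp k hkG)).resolve_left ?_
        rintro ⟨i, rfl⟩
        obtain ⟨j, rfl | rfl⟩ := Int.even_or_odd' i
        · exact (hnp _).1 (hP.even j)
        · exact (hnp _).2 (hP.odd j)
      obtain ⟨hg1, hg2, -⟩ := hP.isInterleavingPair hC hkA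
      have hv1 := (hP.mem_vertexSet_even hC).2 (Or.inr hpe)
      have hv2 := (hP.mem_vertexSet_odd hC).2 (Or.inr hpe)
      refine hP.outcome hC hkA hG hkG fun f hf z => ?_
      have hp1 : Preserves f (chainSides fun i => P (2 * i)) :=
        hC.isTame_left.preserves_of_pivot hg1 hv1
          (by rintro I ⟨i, hl, -⟩ e; exact (hpe _).1 (e.symm.trans hl)) (hA f hf).1 (hA f hf).2
          (hfp f hf)
      have hp2 : Preserves f (chainSides fun i => P (2 * i + 1)) :=
        hC.isTame_right.preserves_of_pivot hg2 hv2
          (by rintro I ⟨i, hl, -⟩ e; exact (hpe _).1 (e.symm.trans hl)) (hA f hf).1 (hA f hf).3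
          (hfp f hf)
      have hfv : ∀ z, k z = z ↔ z ∈ vertexSet (chainSides fun i => P (2 * i)) ∨
          z ∈ vertexSet (chainSides fun i => P (2 * i + 1)) := by
        intro z
        rw [hP.fixed_iff hC hkA, hP.mem_vertexSet_even hC, hP.mem_vertexSet_odd hC]
        constructor
        · rintro (⟨i, rfl⟩ | e)
          · obtain ⟨j, rfl | rfl⟩ := Int.even_or_odd' i
            · exact Or.inl (Or.inl ⟨j, rfl⟩)
            · exact Or.inr (Or.inl ⟨j, rfl⟩)
          · exact Or.inl (Or.inr e)
        · rintro ((⟨i, rfl⟩ | e) | (⟨i, rfl⟩ | e))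
          exacts [Or.inl ⟨_, rfl⟩, Or.inr e, Or.inl ⟨_, rfl⟩, Or.inr e]
      rw [hfv, hfv, hp1.apply_mem_vertexSet (hA f hf).1, hp2.apply_mem_vertexSet (hA f hf).1]

/-- The structure of a group of laminar automorphisms with an infinite cyclic normal subgroup: some
power of a generator of the latter has a fixed point, and its fixed point set is `G`-invariant. -/
theorem IsPseudoFibered.outcome (hC : IsPseudoFibered L₁ L₂)
    {G : Subgroup (Circle ≃ₜ Circle)} (hG : G ≤ autPair L₁ L₂)
    (hN : ∃ N : Subgroup G, N.Normal ∧ IsCyclic N ∧ Infinite N) : Outcome L₁ L₂ G := by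
  obtain ⟨g₀, hg₀, hg₀o, hconj⟩ := exists_generator_of_normal hN
  have hg₀A := mem_autPair.1 (hG hg₀)
  obtain ⟨m, hm, x, hx⟩ := hC.quiteFull_left.exists_pow_fixed hC.lamination_left hg₀A.1 hg₀A.2
  set g := g₀ ^ m with hg
  have hgG : g ∈ G := G.pow_mem hg₀ m
  have hgo : ¬ IsOfFinOrder g := by
    rw [hg, isOfFinOrder_pow]
    exact not_or.2 ⟨hg₀o, hm.ne'⟩
  have hfix : ∀ f ∈ G, ∀ z, g (f z) = f z ↔ g z = z := by
    intro f hf z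
    have h1 : f * g * f⁻¹ = (f * g₀ * f⁻¹) ^ m := (conj_pow).symm
    rcases hconj f hf with e | e <;> rw [e] at h1
    · have h2 : f (g z) = g (f z) := by
        change (f * g) z = (g * f) z
        rw [mul_inv_eq_iff_eq_mul.1 h1]
      rw [← h2, f.injective.eq_iff]
    · rw [inv_pow] at h1
      have h2 : f (g z) = g⁻¹ (f z) := by
        change (f * g) z = (g⁻¹ * f) z
        rw [mul_inv_eq_iff_eq_mul.1 h1]
      rw [← f.injective.eq_iff (a := g z), h2, inv_apply_eq, eq_comm]
  have hg1 : g ≠ 1 := fun e => hgo (e ▸ IsOfFinOrder.one)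
  rcases hC.fix_trichotomy (mem_autPair.1 (hG hgG)) hg1 hx with e | ⟨a, b, hab, e⟩ | ⟨P, hP⟩
  · exact hC.outcome_of_fix_singleton hG hgG hgo e hfix
  · exact hC.outcome_of_fix_pair hG hgG hab e hfix
  · exact hP.outcome hC (mem_autPair.1 (hG hgG)) hG hgG hfix

end

/-! ### Uniqueness of the preserved interleaving pairs -/

theorem IsGap.eq_leaf {L Q : Set GoodInterval} (hQ : IsGap L Q) {I : GoodInterval} (hI : I ∈ Q)
    (hI' : I.opp ∈ Q) : Q = leaf I := by
  refine Subset.antisymm (fun J hJ => ?_) ?_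
  · by_contra hcon
    simp only [leaf, mem_insert_iff, mem_singleton_iff, not_or] at hcon
    have h1 := GoodInterval.disjoint_iff_subset_opp.1 (hQ.disjoint J hJ I hI hcon.1)
    obtain ⟨z, hz⟩ := J.nonempty_arc
    exact Set.disjoint_left.1 (hQ.disjoint J hJ _ hI' hcon.2) hz (h1 hz)
  · rintro J (rfl | rfl)
    exacts [hI, hI']

/-- A fixed point free automorphism preserves at most one gap of a lamination. If two
preserved gaps differ, then `I* ⊆ J` for some sides `I` of one and `J` of the other. The sides are
moved off themselves, so the image of `I` lies in `I* ⊆ J` and that of `J` in `J* ⊆ I`. This forces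
`J = I*`, and both gaps are the leaf of `I`. -/
theorem IsGap.eq_of_preserves {L Q R : Set GoodInterval} (hQ : IsGap L Q) (hR : IsGap L R)
    {e : Circle ≃ₜ Circle} (he : OrientationPreserving e) (hfree : ∀ z, e z ≠ z)
    (heQ : Preserves e Q) (heR : Preserves e R) : Q = R := by
  have hmove : ∀ {Q}, IsGap L Q → Preserves e Q → ∀ I ∈ Q, (I.map e).arc ⊆ I.opp.arc := by
    intro Q hQ heQ I hI
    rw [← GoodInterval.disjoint_iff_subset_opp]
    refine hQ.disjoint _ (heQ.mem_iff.2 hI) I hI fun e' => hfree I.left ?_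
    exact (GoodInterval.map_eq_self.1 e').1
  by_cases hcov : ∃ I ∈ Q, ∃ J ∈ R, I.opp.arc ⊆ J.arc
  · obtain ⟨I, hI, J, hJ, hIJ⟩ := hcov
    have h1 := hmove hQ heQ I hI
    have h2 := hmove hR heR J hJ
    have h3 : (I.map e).opp.arc ⊆ (J.map e).arc := by
      rw [← GoodInterval.map_opp]
      exact (GoodInterval.map_arc_subset he).2 hIJ
    have h4 : J.opp.arc ⊆ I.arc := GoodInterval.opp_subset_comm.1 hIJ
    -- the four inclusions close up to a cycle
    have h5 : (I.map e).opp.arc ⊆ I.arc := h3.trans (h2.trans h4)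
    have h6 : I.map e = I.opp := GoodInterval.eq_of_arc_eq
      (Subset.antisymm h1 (GoodInterval.opp_subset_comm.1 h5))
    rw [h6, GoodInterval.opp_opp] at h3
    have h7 : J.map e = I := GoodInterval.eq_of_arc_eq (Subset.antisymm (h2.trans h4) h3)
    have h8 : J.opp = I := GoodInterval.eq_of_arc_eq
      (Subset.antisymm h4 (by rw [← h7]; exact h2))
    have h9 : J = I.opp := by rw [← h8, GoodInterval.opp_opp]
    rw [hQ.eq_leaf hI (by rw [← h6]; exact heQ.mem_iff.2 hI),
      hR.eq_leaf (I := I) (by rw [← h7]; exact heR.mem_iff.2 hJ) (h9 ▸ hJ)]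
  · push Not at hcov
    have h1 : ∀ I ∈ Q, ∃ J ∈ R, I.arc ⊆ J.arc := fun I hI => by
      obtain ⟨J, hJ, e⟩ := hR.lies I (hQ.subset hI)
      exact ⟨J, hJ, e.resolve_right (hcov I hI J hJ)⟩
    have h2 : ∀ J ∈ R, ∃ I ∈ Q, J.arc ⊆ I.arc := fun J hJ => by
      obtain ⟨I, hI, e⟩ := hQ.lies J (hR.subset hJ)
      exact ⟨I, hI, e.resolve_right fun e' => hcov I hI J hJ (GoodInterval.opp_subset_comm.1 e')⟩
    have key : ∀ {Q R}, IsGap L Q → (∀ I ∈ Q, ∃ J ∈ R, I.arc ⊆ J.arc) →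
        (∀ J ∈ R, ∃ I ∈ Q, J.arc ⊆ I.arc) → Q ⊆ R := by
      intro Q R hQ h1 h2 I hI
      obtain ⟨J, hJ, hIJ⟩ := h1 I hI
      obtain ⟨I', hI', hJI⟩ := h2 J hJ
      obtain ⟨z, hz⟩ := I.nonempty_arc
      have : I = I' := hQ.eq_of_mem hI hI' hz (hJI (hIJ hz))
      subst this
      rw [GoodInterval.eq_of_arc_eq (Subset.antisymm hIJ hJI)]
      exact hJ
    exact Subset.antisymm (key hQ h1 h2) (key hR h2 h1)

/-- A parabolic automorphism preserves at most one crown of a loose lamination, as it fixes the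
pivot. -/
theorem IsTame.eq_of_isCrown {L Q R : Set GoodInterval} (hL : IsTame L) (hQ : IsCrown L Q)
    (hR : IsCrown L R) {h : Circle ≃ₜ Circle} (hh : OrientationPreserving h) (hp : IsParabolic h)
    (hhQ : Preserves h Q) (hhR : Preserves h R) : Q = R := by
  obtain ⟨w, hw⟩ := hp
  obtain ⟨p, hp1, hp2, hp3⟩ := hQ.exists_pivot
  obtain ⟨q, hq1, hq2, hq3⟩ := hR.exists_pivot
  have e1 : p ∈ Fix h := fixed_pivot hh hhQ hp3
  have e2 : q ∈ Fix h := fixed_pivot hh hhR hq3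
  rw [hw] at e1 e2
  have e3 : q = p := e2.trans e1.symm
  subst e3
  exact hL.eq_of_pivot hQ.1 hR.1 hp1 hq1 (fun I hI => (hp2 I hI).1) fun I hI => (hq2 I hI).1

theorem IsCrown.ne_leaf {L Q : Set GoodInterval} (hQ : IsCrown L Q) (I : GoodInterval) :
    Q ≠ leaf I := by
  rintro rfl
  obtain ⟨p, hp, hp', -⟩ := hQ.exists_pivot
  rw [vertexSet_leaf] at hp
  rcases hp with e | e
  · exact (hp' I (Or.inl rfl)).1 e.symm
  · exact (hp' I (Or.inl rfl)).2 e.symm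

end Laminar

theorem mainTheorem6 (L₁ L₂ : Set Laminar.GoodInterval) (hC : Laminar.IsPseudoFibered L₁ L₂)
    (G : Subgroup (Circle ≃ₜ Circle)) (hG : G ≤ Laminar.autPair L₁ L₂)
    (hN : ∃ N : Subgroup G, N.Normal ∧ IsCyclic N ∧ Infinite N) :
    (Nonempty (G ≃* Multiplicative ℤ) ∨
      Nonempty (G ≃* DihedralGroup 0) ∨
      (∃ n : ℕ, 1 < n ∧ Nonempty (G ≃* Multiplicative ℤ × Multiplicative (ZMod n))) ∨
      Nonempty (G ≃* Multiplicative ℤ × Multiplicative ℤ)) ∧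
    (Nonempty (G ≃* Multiplicative ℤ) →
      ∃ g, G = Subgroup.zpowers g ∧
        (Laminar.IsParabolic g ∨ Laminar.IsHyperbolic g ∨ Laminar.IsPALike L₁ L₂ g)) ∧
    (Nonempty (G ≃* DihedralGroup 0) →
      ∃ g e, Laminar.IsHyperbolic g ∧ Laminar.IsElliptic e ∧ orderOf e = 2 ∧
        G = Subgroup.closure {g, e} ∧ Laminar.HasDihedralPresentation G g e) ∧
    (∀ n : ℕ, 1 < n → Nonempty (G ≃* Multiplicative ℤ × Multiplicative (ZMod n)) →
      (∃! P : Set Laminar.GoodInterval × Set Laminar.GoodInterval,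
        Laminar.IsInterleavingPair L₁ L₂ P.1 P.2 ∧
        Laminar.IsIdealPolygon L₁ P.1 ∧ Laminar.IsIdealPolygon L₂ P.2 ∧
        ∀ f ∈ G, Laminar.Preserves f P.1 ∧ Laminar.Preserves f P.2) ∧
      ∃ g e, Laminar.IsPALike L₁ L₂ g ∧ Laminar.IsElliptic e ∧ orderOf e = n ∧
        Laminar.IsInternalProduct G g e) ∧
    (Nonempty (G ≃* Multiplicative ℤ × Multiplicative ℤ) →
      (∃! P : Set Laminar.GoodInterval × Set Laminar.GoodInterval,
        Laminar.IsAsterisk L₁ L₂ P.1 P.2 ∧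
        Laminar.IsCrown L₁ P.1 ∧ Laminar.IsCrown L₂ P.2 ∧
        ∀ f ∈ G, Laminar.Preserves f P.1 ∧ Laminar.Preserves f P.2) ∧
      ∃ g h, Laminar.IsProperlyPA L₁ L₂ g ∧ Laminar.IsParabolic h ∧
        Laminar.IsInternalProduct G g h) := by
  have hA : ∀ f ∈ G, Laminar.IsAut L₁ L₂ f := fun f hf => Laminar.mem_autPair.1 (hG hf)
  rcases hC.outcome hG hN with ⟨g, hGg, hg, hgt⟩ | ⟨g, e, hGg, hg, hyp, he1, he, hge⟩ |
    ⟨g, e, hGg, hg, hpA, he, F₁, F₂, hF, hF₁, hF₂, hGF⟩ |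
    ⟨g, f, hGg, hg, hf, hpA, hpar, F₁, F₂, hF, hF₁, hF₂, hGF⟩
  · obtain ⟨φ⟩ := Laminar.nonempty_mulEquiv_of_zpowers hGg hg
    refine ⟨Or.inl ⟨φ⟩, fun _ => ⟨g, hGg, hgt⟩, ?_, ?_, ?_⟩
    · rintro ⟨ψ⟩
      exact (Laminar.not_commutative_of_mulEquiv (φ.symm.trans ψ) mul_comm).elim
    · rintro n hn ⟨ψ⟩
      have := Laminar.torsionCard_congr (φ.symm.trans ψ)
      rw [Laminar.torsionCard_int, Laminar.torsionCard_int_prod_zmod hn] at this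
      omega
    · rintro ⟨ψ⟩
      exact (Laminar.not_isCyclic_int_prod_int (isCyclic_of_surjective (φ.symm.trans ψ)
        (φ.symm.trans ψ).surjective)).elim
  · obtain ⟨φ⟩ := Laminar.nonempty_mulEquiv_dihedral he hge hg hGg
    have heo : orderOf e = 2 := orderOf_eq_prime (by rw [pow_two, he]) he1
    have hee : IsOfFinOrder e := orderOf_pos_iff.1 (by omega)
    refine ⟨Or.inr (Or.inl ⟨φ⟩), ?_, fun _ => ⟨g, e, hyp, ⟨he1, hee⟩, heo, hGg,
      Laminar.hasDihedralPresentation he hge hg hGg⟩, ?_, ?_⟩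
    · rintro ⟨ψ⟩
      exact (Laminar.not_commutative_of_mulEquiv (ψ.symm.trans φ) mul_comm).elim
    · rintro n hn ⟨ψ⟩
      exact (Laminar.not_commutative_of_mulEquiv (ψ.symm.trans φ) mul_comm).elim
    · rintro ⟨ψ⟩
      exact (Laminar.not_commutative_of_mulEquiv (ψ.symm.trans φ) mul_comm).elim
  · obtain ⟨φ⟩ := hGg.nonempty_mulEquiv
    have hn1 : 1 < orderOf e := by
      have h1 := orderOf_pos_iff.2 he.2
      have h2 := mt orderOf_eq_one_iff.1 he.1
      omega
    rw [orderOf_eq_zero hg] at φ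
    change G ≃* Multiplicative ℤ × Multiplicative (ZMod (orderOf e)) at φ
    have htor := (Laminar.torsionCard_congr φ).trans (Laminar.torsionCard_int_prod_zmod hn1)
    refine ⟨Or.inr (Or.inr (Or.inl ⟨_, hn1, ⟨φ⟩⟩)), ?_, ?_, ?_, ?_⟩
    · rintro ⟨ψ⟩
      rw [Laminar.torsionCard_congr ψ, Laminar.torsionCard_int] at htor
      omega
    · rintro ⟨ψ⟩
      exact (Laminar.not_commutative_of_mulEquiv (φ.symm.trans ψ) mul_comm).elim
    · rintro n hn ⟨ψ⟩
      rw [Laminar.torsionCard_congr ψ, Laminar.torsionCard_int_prod_zmod hn] at htor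
      have heG : e ∈ G := hGg.1 ▸ Subgroup.mem_sup_right (Subgroup.mem_zpowers e)
      have hfree : ∀ z, e z ≠ z := fun z hz =>
        he.1 (Laminar.eq_one_of_isOfFinOrder (hA e heG).1 he.2 hz)
      refine ⟨⟨(F₁, F₂), ⟨hF, hF₁, hF₂, hGF⟩, ?_⟩, g, e, hpA, he, htor.symm, hGg⟩
      rintro ⟨Q₁, Q₂⟩ ⟨hQ, -, -, hGQ⟩
      exact Prod.ext (hQ.1.eq_of_preserves hF.1 (hA e heG).1 hfree (hGQ e heG).1 (hGF e heG).1)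
        (hQ.2.1.eq_of_preserves hF.2.1 (hA e heG).1 hfree (hGQ e heG).2 (hGF e heG).2)
    · rintro ⟨ψ⟩
      rw [Laminar.torsionCard_congr ψ, Laminar.torsionCard_int_prod, Laminar.torsionCard_int]
        at htor
      omega
  · obtain ⟨φ⟩ := hGg.nonempty_mulEquiv
    rw [orderOf_eq_zero hg, orderOf_eq_zero hf] at φ
    change G ≃* Multiplicative ℤ × Multiplicative ℤ at φ
    refine ⟨Or.inr (Or.inr (Or.inr ⟨φ⟩)), ?_, ?_, ?_, fun _ => ⟨?_, g, f, hpA, hpar, hGg⟩⟩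
    · rintro ⟨ψ⟩
      exact (Laminar.not_isCyclic_int_prod_int (isCyclic_of_surjective (ψ.symm.trans φ)
        (ψ.symm.trans φ).surjective)).elim
    · rintro ⟨ψ⟩
      exact (Laminar.not_commutative_of_mulEquiv (φ.symm.trans ψ) mul_comm).elim
    · rintro n hn ⟨ψ⟩
      have := Laminar.torsionCard_congr (φ.symm.trans ψ)
      rw [Laminar.torsionCard_int_prod, Laminar.torsionCard_int,
        Laminar.torsionCard_int_prod_zmod hn] at this
      omega
    · have hfG : f ∈ G := hGg.1 ▸ Subgroup.mem_sup_right (Subgroup.mem_zpowers f)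
      refine ⟨(F₁, F₂), ⟨⟨hF, fun hl => ?_⟩, hF₁, hF₂, hGF⟩, ?_⟩
      · obtain ⟨⟨I, -, hI⟩, -⟩ := hl
        exact hF₁.ne_leaf I hI
      · rintro ⟨Q₁, Q₂⟩ ⟨-, hQ₁, hQ₂, hGQ⟩
        exact Prod.ext
          (hC.isTame_left.eq_of_isCrown hQ₁ hF₁ (hA f hfG).1 hpar (hGQ f hfG).1 (hGF f hfG).1)
          (hC.isTame_right.eq_of_isCrown hQ₂ hF₂ (hA f hfG).1 hpar (hGQ f hfG).2 (hGF f hfG).2)
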